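/- Let $\Gamma$ be a finite index subgroup of $\Gamma_1=\mathrm{SL}_2(\mathbb Z)$ normalized by $\epsilon=\begin{pmatrix}-1&0\\0&1\end{pmatrix}$, let $k\ge 2$ be an integer, $w=k-2$, and let $S_k(\Gamma)$ be the space of cusp forms of weight $k$ for $\Gamma$. Let $V_w$ be the space of complex polynomials of degree at most $w$. For $f\in S_k(\Gamma)$ let $\rho_f:\Gamma\backslash\Gamma_1\to V_w$ be $$\rho_f(A)=\int_0^{i\infty} (f|_kA)(t)\,(t-X)^w\,dt .$$ For a map $P:\Gamma\backslash\Gamma_1\to V_w$ and $g=\begin{pmatrix}a&b\\c&d\end{pmatrix}\in\Gamma_1$ put $(P|g)(A)=(cX+d)^w\,P(Ag^{-1})\!\left(\frac{aX+b}{cX+d}\right)$ and $(P|\epsilon)(A)(X)=P(\epsilon A\epsilon)(-X)$; let $P^{\pm}=\frac12(P\pm P|\epsilon)$ be the even and odd parts of $P$, and let $\overline P$ be obtained by conjugating the coefficients of all $P(A)$. Define $$\Big\langle \sum a_nX^n,\sum b_nX^n\Big\rangle=\sum_{n=0}^w(-1)^{w-n}\binom wn^{-1}a_nb_{w-n},\qquad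 \langle\!\langle P,Q\rangle\!\rangle=\frac1{[\Gamma_1:\Gamma]}\sum_{A\in\Gamma\backslash\Gamma_1}\langle P(A),Q(A)\rangle,$$ $$\{P,Q\}=\langle\!\langle P|T-P|T^{-1},\,Q\rangle\!\rangle,\qquad T=\begin{pmatrix}1&1\\0&1\end{pmatrix}.$$ Let $$(f,g)=\frac1{[\overline\Gamma_1:\overline\Gamma]}\int_{\Gamma\backslash\mathbb H}f(z)\overline{g(z)}\,y^k\,\frac{dx\,dy}{y^2},$$ where $\overline\Gamma=\Gamma/(\Gamma\cap\{\pm1\})$, $\overline\Gamma_1=\Gamma_1/\{\pm1\}$, and let $C_k=-(2i)^{k-1}$. Then for all $f,g\in S_k(\Gamma)$ $$3\,C_k\,(f,g)=\{\rho_f^{\kappa_1},\overline{\rho_g^{\kappa_2}}\}$$ for any $\kappa_1,\kappa_2\in\{+,-\}$ with $\kappa_1\ne\kappa_2$ if $k$ is even and $\kappa_1=\kappa_2$ if $k$ is odd. In particular, each of the two maps $\rho^{+}:f\mapsto\rho_f^{+}$ and $\rho^{-}:f\mapsto\rho_f^{-}$ on $S_k(\Gamma)$ is injective. -/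

import Mathlib

open scoped MatrixGroups ModularForm ComplexConjugate Polynomial
open MeasureTheory UpperHalfPlane

namespace Haberland

noncomputable section

/-! ### Conjugation by `ε = diag(-1, 1)` -/

/-- The matrix `ε = diag(-1, 1)`. -/
def eps : Matrix (Fin 2) (Fin 2) ℤ := !![-1, 0; 0, 1]

theorem eps_mul_eps : eps * eps = 1 := by decide

/-- The automorphism `A ↦ A' = ε A ε` of `SL(2, ℤ)` (note that `ε⁻¹ = ε`). -/
def epsConj : SL(2, ℤ) →* SL(2, ℤ) where
  toFun A := ⟨eps * A.1 * eps, by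
    rw [Matrix.det_mul, Matrix.det_mul, A.2, mul_one, ← Matrix.det_mul, eps_mul_eps,
      Matrix.det_one]⟩
  map_one' := Subtype.ext (by simp [eps_mul_eps])
  map_mul' A B := Subtype.ext (by
    change eps * (A.1 * B.1) * eps = (eps * A.1 * eps) * (eps * B.1 * eps)
    calc eps * (A.1 * B.1) * eps = eps * A.1 * 1 * B.1 * eps := by simp [mul_assoc]
      _ = (eps * A.1 * eps) * (eps * B.1 * eps) := by rw [← eps_mul_eps]; simp only [mul_assoc])

/-- `Γ` is normalized by `ε`: `ε γ ε⁻¹ ∈ Γ` for all `γ ∈ Γ`. -/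
def NormalizedByEps (Γ : Subgroup SL(2, ℤ)) : Prop := ∀ γ ∈ Γ, epsConj γ ∈ Γ

/-! ### The coset space `Γ \ Γ₁` -/

/-- The space `Γ \ SL(2, ℤ)` of cosets `Γ A`. -/
abbrev Cosets (Γ : Subgroup SL(2, ℤ)) : Type := Quotient (QuotientGroup.rightRel Γ)

/-- The map `Γ A ↦ Γ A h`. -/
def cosetMul {Γ : Subgroup SL(2, ℤ)} (A : Cosets Γ) (h : SL(2, ℤ)) : Cosets Γ :=
  Quotient.map' (fun a : SL(2, ℤ) => a * h) (fun a b hab => by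
    rw [QuotientGroup.rightRel_apply] at hab ⊢
    simpa [mul_assoc] using hab) A

/-- The map `Γ A ↦ Γ A'` with `A' = ε A ε`, for `Γ` normalized by `ε`. -/
def cosetEps {Γ : Subgroup SL(2, ℤ)} (hΓ : NormalizedByEps Γ) (A : Cosets Γ) : Cosets Γ :=
  Quotient.map' epsConj (fun a b hab => by
    rw [QuotientGroup.rightRel_apply] at hab ⊢
    simpa using hΓ _ hab) A

/-! ### Polynomials and maps `Γ \ Γ₁ → V_w`

`V_w` is the space of complex polynomials of degree at most `w`. Maps `Γ \ Γ₁ → V_w` are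
written as functions `Cosets Γ → ℂ[X]`; all polynomials below have degree at most `w`. -/

/-- The action `(P|g)(X) = P((aX + b)/(cX + d)) (cX + d)^w` on polynomials of degree at most `w`,
where `g = (a, b; c, d)`. -/
def polySlash (w : ℕ) (P : ℂ[X]) (g : SL(2, ℤ)) : ℂ[X] :=
  ∑ n ∈ Finset.range (w + 1), Polynomial.C (P.coeff n) *
    (Polynomial.C (g 0 0 : ℂ) * Polynomial.X + Polynomial.C (g 0 1 : ℂ)) ^ n *
    (Polynomial.C (g 1 0 : ℂ) * Polynomial.X + Polynomial.C (g 1 1 : ℂ)) ^ (w - n)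

/-- The action of `Γ₁` on maps `P : Γ \ Γ₁ → V_w`, namely `(P|g)(A) = P(A g⁻¹)|g`. -/
def indSlash {Γ : Subgroup SL(2, ℤ)} (w : ℕ) (P : Cosets Γ → ℂ[X]) (g : SL(2, ℤ)) :
    Cosets Γ → ℂ[X] :=
  fun A => polySlash w (P (cosetMul A g⁻¹)) g

/-- The action of `ε` on maps `P : Γ \ Γ₁ → V_w`, namely `(P|ε)(A) = P(A')|ε`, where
`(Q|ε)(X) = Q(-X)` for a polynomial `Q`. -/
def indEps {Γ : Subgroup SL(2, ℤ)} (hΓ : NormalizedByEps Γ) (P : Cosets Γ → ℂ[X]) :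
    Cosets Γ → ℂ[X] :=
  fun A => (P (cosetEps hΓ A)).comp (-Polynomial.X)

/-- The even part `P⁺` (for `κ = 1`) and the odd part `P⁻` (for `κ = -1`):
`P^κ = (P + κ P|ε) / 2`. -/
def parityPart {Γ : Subgroup SL(2, ℤ)} (hΓ : NormalizedByEps Γ) (κ : ℤˣ)
    (P : Cosets Γ → ℂ[X]) : Cosets Γ → ℂ[X] :=
  fun A => Polynomial.C (1 / 2 : ℂ) *
    (P A + Polynomial.C (((κ : ℤ) : ℂ)) * indEps hΓ P A)

/-- Complex conjugation of the coefficients of every `P(A)`. -/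
def conjCoeff {Γ : Subgroup SL(2, ℤ)} (P : Cosets Γ → ℂ[X]) : Cosets Γ → ℂ[X] :=
  fun A => (P A).map (starRingEnd ℂ)

/-! ### Period polynomials -/

/-- The integral `∫_0^{i∞} h(t) (t - X)^w dt`, computed coefficientwise along `t = iy`, `y > 0`
(so `dt = i dy`). -/
def periodIntegral (w : ℕ) (h : ℍ → ℂ) : ℂ[X] :=
  ∑ n ∈ Finset.range (w + 1), Polynomial.monomial n
    (∫ y in Set.Ioi (0 : ℝ), h (ofComplex (Complex.I * y)) *
      ((Polynomial.C (Complex.I * y) - Polynomial.X : ℂ[X]) ^ w).coeff n * Complex.I)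

/-- The (multiple) period polynomial of `f ∈ S_k(Γ)`:
`ρ_f(A) = ∫_0^{i∞} (f|_k A)(t) (t - X)^(k-2) dt` for `A ∈ Γ \ Γ₁`. -/
def rho {Γ : Subgroup SL(2, ℤ)} {k : ℕ}
    (f : CuspForm (Γ : Subgroup (GL (Fin 2) ℝ)) (k : ℤ)) : Cosets Γ → ℂ[X] :=
  fun A => Quotient.liftOn' A
    (fun a : SL(2, ℤ) => periodIntegral (k - 2) ((f : ℍ → ℂ) ∣[(k : ℤ)] a))
    (fun a b hab => by
      have hab' := (QuotientGroup.rightRel_apply).mp hab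
      have hf : (f : ℍ → ℂ) ∣[(k : ℤ)] (b * a⁻¹) = f :=
        SlashInvariantFormClass.slash_action_eq f _ (Subgroup.mem_map_of_mem _ hab')
      have hb : (f : ℍ → ℂ) ∣[(k : ℤ)] b = (f : ℍ → ℂ) ∣[(k : ℤ)] a := by
        conv_rhs => rw [← hf, ← SlashAction.slash_mul, inv_mul_cancel_right]
      simp only [hb])

/-! ### Pairings -/

/-- The pairing `⟨∑ aₙ Xⁿ, ∑ bₙ Xⁿ⟩ = ∑ (-1)^(w-n) (w choose n)⁻¹ aₙ b_{w-n}` on `V_w`. -/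
def polyPairing (w : ℕ) (P Q : ℂ[X]) : ℂ :=
  ∑ n ∈ Finset.range (w + 1),
    (-1) ^ (w - n) * ((w.choose n : ℕ) : ℂ)⁻¹ * P.coeff n * Q.coeff (w - n)

/-- The normalized pairing `⟪P, Q⟫ = [Γ₁ : Γ]⁻¹ ∑_{A ∈ Γ \ Γ₁} ⟨P(A), Q(A)⟩`. On maps with
`P(-A) = (-1)^w P(A)`, such as period polynomials, it agrees with the analogous normalized sum over
the projectivized cosets. -/
def indPairing {Γ : Subgroup SL(2, ℤ)} (w : ℕ) (P Q : Cosets Γ → ℂ[X]) : ℂ :=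
  ((Γ.index : ℕ) : ℂ)⁻¹ * ∑ᶠ A : Cosets Γ, polyPairing w (P A) (Q A)

/-- The modified pairing `{P, Q} = ⟪P|(T - T⁻¹), Q⟫` with `T = (1, 1; 0, 1)`. -/
def modPairing {Γ : Subgroup SL(2, ℤ)} (w : ℕ) (P Q : Cosets Γ → ℂ[X]) : ℂ :=
  indPairing w (indSlash w P ModularGroup.T - indSlash w P ModularGroup.T⁻¹) Q

/-! ### The Petersson scalar product -/

/-- The projectivization `Γ / (Γ ∩ {±1})`, realized as the group of transformations of the upper
half plane induced by `Γ` (the kernel of the action of `SL(2, ℤ)` on `ℍ` is `{±1}`). -/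
def projectivization (Γ : Subgroup SL(2, ℤ)) : Subgroup (Equiv.Perm ℍ) :=
  Γ.map (MulAction.toPermHom SL(2, ℤ) ℍ)

/-- The index of the projectivization of `Γ` in the projectivization of `SL(2, ℤ)`. -/
def projIndex (Γ : Subgroup SL(2, ℤ)) : ℕ :=
  (projectivization Γ).relIndex (projectivization ⊤)

/-- `F` is a fundamental domain for `Γ \ ℍ`: up to null sets for the hyperbolic measure
`dx dy / y²`, its translates under the projectivization of `Γ` cover `ℍ` without overlap. -/
def IsFundDomain (Γ : Subgroup SL(2, ℤ)) (F : Set ℍ) : Prop :=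
  IsFundamentalDomain (projectivization Γ) F (volume : Measure ℍ)

/-- The normalized Petersson scalar product
`(f, g) = [Γ₁-bar : Γ-bar]⁻¹ ∫_{Γ \ ℍ} f(z) conj(g(z)) y^k dx dy / y²`,
the integral over `Γ \ ℍ` being taken over a fundamental domain `F`. The measure `volume` on
`ℍ` is `dx dy / y²`. -/
def petersson (Γ : Subgroup SL(2, ℤ)) (k : ℕ) (F : Set ℍ) (f g : ℍ → ℂ) : ℂ :=
  ((projIndex Γ : ℕ) : ℂ)⁻¹ * ∫ z in F, f z * conj (g z) * ((z.im : ℝ) : ℂ) ^ k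

/-- The constant `C_k = -(2i)^(k-1)`. -/
def haberlandConst (k : ℕ) : ℂ := -(2 * Complex.I) ^ (k - 1)

end

end Haberland

/-! Write `f_A = f|A` and `F_A(z) = ∫_{i∞}^z f_A(t) (t - X)^w dt` (`tailFam`). A change of variables
gives `F(Tz)|T = F(z)` and `F(Sz)|S = F(z) + ρ_f`. Iterating the `S` rule twice, and the resulting
rule for `U = TS` three times, yields the period relations `ρ|S = -ρ` and `ρ|(1 + U + U²) = 0`. At
the fixed point `ζ = e^(iπ/3)` of `U` the cocycle becomes a coboundary: `ρ_g = Z|U - Z`, where `Z`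
is the value at `ζ` of the tail family of `g`. Pure algebra (`modPairing_coboundary`) then turns
`{ρ_f, ρ_g}` into `3⟪ρ_f|U, Z⟫`.

The analytic input is the one-form `ω = ∑_A F_A(z)(τz) τ(g_A(z)) τ(dz)`, with `τ` either complex
conjugation or the identity. It is invariant under `T`. The map `S` reverses the unit arc from `ζ -
1` to `ζ` and changes `ω` by an exact form, since pairing with `(s - X)^w` is evaluation at `s`.
Hence twice the arc integral is `[Γ₁ : Γ]⟪ρ_f|U, τZ⟫`, and `[Γ₁ : Γ]{ρ_f, τρ_g} = 6∫ω`
(`modPairing_periodFam`).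

For conjugation, `dω = ∑_A f_A(z) (z - conj z)^w conj(g_A(z)) dz ∧ d(conj z)`. In Stokes' theorem on
the standard domain the vertical sides cancel and the arc remains, so `{ρ_f, conj ρ_g} = 6 C_k (f,
g)` (`integral_arc_conj`). For the identity, `ω` is holomorphic, hence closed, and the arc integral
is zero (`integral_arc_id`). Applied to `f` and `z ↦ conj(g(-conj z))`, whose period polynomial is a
sign times `conj ρ_g|ε`, this gives `{ρ_f, conj ρ_g|ε} = 0`.

Now expand both parity parts. The mixed terms vanish, and the two others agree because `ε`
multiplies `{·,·}` by `(-1)^(w+1) = κ₁κ₂`. What is left is half of `6 C_k (f, g)`. If one parity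
part of `ρ_f` vanishes, the formula with `g = f` gives `(f, f) = 0`, so `f = 0`. -/

namespace Haberland

/-! ### Holomorphic functions with exponential decay at `i∞`, and their primitives. -/

open Filter Topology Set

/-- A function holomorphic on the upper half plane which decays exponentially as the imaginary part
grows, uniformly on vertical strips bounded away from the real axis. -/
structure HolDecay (a : ℂ → ℂ) : Prop where
  diff : DifferentiableOn ℂ a {z | 0 < z.im}
  decay : ∀ B y₀ : ℝ, 0 < y₀ → ∃ C c : ℝ, 0 ≤ C ∧ 0 < c ∧
    ∀ z : ℂ, |z.re| ≤ B → y₀ ≤ z.im → ‖a z‖ ≤ C * Real.exp (-c * z.im)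

namespace HolDecay

variable {a b : ℂ → ℂ}

theorem isOpen_im_pos : IsOpen {z : ℂ | 0 < z.im} := isOpen_lt continuous_const Complex.continuous_im

theorem differentiableAt (ha : HolDecay a) {z : ℂ} (hz : 0 < z.im) : DifferentiableAt ℂ a z :=
  ha.diff.differentiableAt (isOpen_im_pos.mem_nhds hz)

theorem const_mul (ha : HolDecay a) (r : ℂ) : HolDecay (fun z => r * a z) where
  diff := ha.diff.const_mul r
  decay B y₀ hy := by
    obtain ⟨C, c, hC, hc, h⟩ := ha.decay B y₀ hy
    refine ⟨‖r‖ * C, c, by positivity, hc, fun z h1 h2 => ?_⟩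
    rw [norm_mul, mul_assoc]
    exact mul_le_mul_of_nonneg_left (h z h1 h2) (norm_nonneg _)

/-- On a strip `|z|` grows linearly in `Im z`, and half of the exponential rate absorbs this growth.
-/
theorem mul_id (ha : HolDecay a) : HolDecay (fun z => a z * z) where
  diff := ha.diff.mul differentiableOn_id
  decay B y₀ hy := by
    obtain ⟨C, c, hC, hc, h⟩ := ha.decay B y₀ hy
    refine ⟨C * (|B| + 2 / c), c / 2, by positivity, by positivity, fun z h1 h2 => ?_⟩
    have hz : 0 ≤ z.im := hy.le.trans h2
    have hn : ‖z‖ ≤ |B| + z.im := by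
      refine (Complex.norm_le_abs_re_add_abs_im z).trans ?_
      rw [abs_of_nonneg hz]
      exact add_le_add (h1.trans (le_abs_self B)) le_rfl
    have hexp : z.im ≤ 2 / c * Real.exp (c / 2 * z.im) := by
      have := Real.add_one_le_exp (c / 2 * z.im)
      rw [div_mul_eq_mul_div, le_div_iff₀ hc]
      nlinarith
    have h1e : 1 ≤ Real.exp (c / 2 * z.im) := Real.one_le_exp (by positivity)
    have hsplit : Real.exp (-c * z.im) * Real.exp (c / 2 * z.im) = Real.exp (-(c / 2) * z.im) := by
      rw [← Real.exp_add]
      ring_nf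
    calc ‖a z * z‖ = ‖a z‖ * ‖z‖ := norm_mul _ _
      _ ≤ (C * Real.exp (-c * z.im)) * ((|B| + 2 / c) * Real.exp (c / 2 * z.im)) := by
        refine mul_le_mul (h z h1 h2) (hn.trans ?_) (norm_nonneg _) (by positivity)
        rw [add_mul]
        refine add_le_add ?_ hexp
        exact le_mul_of_one_le_right (abs_nonneg _) h1e
      _ = C * (|B| + 2 / c) * Real.exp (-(c / 2) * z.im) := by rw [← hsplit]; ring

theorem mul_pow (ha : HolDecay a) (n : ℕ) : HolDecay (fun z => a z * z ^ n) := by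
  induction n with
  | zero => simpa using ha
  | succ n ih => simpa [pow_succ, mul_assoc] using ih.mul_id

/-- Cauchy's estimate on a disc of fixed radius `y₀ / 2`: the disc stays in a slightly wider strip
above height `y₀ / 2`, and moving down by `y₀ / 2` costs only the constant `exp(c y₀ / 2)`. -/
theorem deriv (ha : HolDecay a) : HolDecay (deriv a) where
  diff := ha.diff.deriv isOpen_im_pos
  decay B y₀ hy := by
    obtain ⟨C, c, hC, hc, h⟩ := ha.decay (B + y₀ / 2) (y₀ / 2) (by positivity)
    refine ⟨C * Real.exp (c * (y₀ / 2)) / (y₀ / 2), c, by positivity, hc, fun z h1 h2 => ?_⟩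
    have key : ∀ t ∈ Metric.closedBall z (y₀ / 2), |t.re| ≤ B + y₀ / 2 ∧ z.im - y₀ / 2 ≤ t.im := by
      intro t ht
      rw [Metric.mem_closedBall, dist_eq_norm] at ht
      have hre := (Complex.abs_re_le_norm (t - z)).trans ht
      have him := (Complex.abs_im_le_norm (t - z)).trans ht
      rw [Complex.sub_re] at hre
      rw [Complex.sub_im] at him
      constructor
      · have := abs_add_le (t.re - z.re) z.re
        simp only [sub_add_cancel] at this
        linarith
      · linarith [(abs_le.mp him).1]
    have hd : DiffContOnCl ℂ a (Metric.ball z (y₀ / 2)) := by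
      refine DifferentiableOn.diffContOnCl_ball (U := {z | 0 < z.im}) ha.diff fun t ht => ?_
      have := (key t ht).2
      change 0 < t.im
      linarith
    have := Complex.norm_deriv_le_of_forall_mem_sphere_norm_le (c := z) (R := y₀ / 2)
      (C := C * Real.exp (c * (y₀ / 2)) * Real.exp (-c * z.im)) (f := a) (by positivity) hd ?_
    · refine this.trans (le_of_eq ?_)
      ring
    · intro t ht
      obtain ⟨k1, k2⟩ := key t (Metric.sphere_subset_closedBall ht)
      refine (h t k1 (by linarith)).trans ?_
      rw [mul_assoc, ← Real.exp_add]
      gcongr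
      nlinarith

theorem continuousOn_vertical (ha : HolDecay a) {z : ℂ} (hz : 0 < z.im) :
    ContinuousOn (fun u : ℝ => a (z + u * Complex.I)) (Ici 0) := by
  refine ha.diff.continuousOn.comp (by fun_prop) fun u hu => ?_
  simp only [mem_Ici] at hu
  simp
  linarith

theorem integrableOn_vertical (ha : HolDecay a) {z : ℂ} (hz : 0 < z.im) :
    IntegrableOn (fun u : ℝ => a (z + u * Complex.I)) (Ioi 0) := by
  obtain ⟨C, c, hC, hc, h⟩ := ha.decay |z.re| z.im hz
  have hg : IntegrableOn (fun u : ℝ => C * Real.exp (-c * u)) (Ioi 0) :=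
    (exp_neg_integrableOn_Ioi 0 hc).const_mul C
  refine Integrable.mono' hg
    (((ha.continuousOn_vertical hz).mono Ioi_subset_Ici_self).aestronglyMeasurable
      measurableSet_Ioi) ?_
  refine (ae_restrict_mem measurableSet_Ioi).mono fun u hu => ?_
  simp only [mem_Ioi] at hu
  refine (h (z + u * Complex.I) (by simp) (by simp; linarith)).trans ?_
  gcongr 2
  simp only [Complex.add_im, Complex.mul_im, Complex.ofReal_re, Complex.I_im, mul_one,
    Complex.ofReal_im, Complex.I_re, mul_zero, add_zero]
  nlinarith

theorem tendsto_vertical (ha : HolDecay a) (z : ℂ) :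
    Tendsto (fun u : ℝ => a (z + u * Complex.I)) atTop (𝓝 0) := by
  obtain ⟨C, c, hC, hc, h⟩ := ha.decay |z.re| 1 one_pos
  have hg : Tendsto (fun u : ℝ => C * Real.exp (-c * (z.im + u))) atTop (𝓝 0) := by
    rw [← mul_zero C]
    refine Tendsto.const_mul C (Real.tendsto_exp_atBot.comp ?_)
    exact (tendsto_atTop_add_const_left _ _ tendsto_id).const_mul_atTop_of_neg (neg_lt_zero.mpr hc)
  refine squeeze_zero_norm' ?_ hg
  filter_upwards [eventually_ge_atTop (1 - z.im)] with u hu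
  refine (h (z + u * Complex.I) (by simp) (by simp; linarith)).trans (by simp)

end HolDecay

/-- The primitive `z ↦ ∫_{i∞}^z a(t) dt`, the integral being taken along a vertical ray. -/
noncomputable def prim (a : ℂ → ℂ) (z : ℂ) : ℂ :=
  -Complex.I * ∫ u in Ioi (0 : ℝ), a (z + u * Complex.I)

namespace HolDecay

variable {a b : ℂ → ℂ}

/-- Differentiate under the integral sign, with the decay of `a'` near `z` as dominating function.
The integral of `a'` along the ray is then computed by the fundamental theorem of calculus, `a`
vanishing at `i∞`. -/
theorem hasDerivAt_prim (ha : HolDecay a) {z : ℂ} (hz : 0 < z.im) :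
    HasDerivAt (prim a) (a z) z := by
  obtain ⟨C, c, hC, hc, h⟩ := ha.deriv.decay (|z.re| + z.im / 2) (z.im / 2) (by positivity)
  have key : ∀ t ∈ Metric.ball z (z.im / 2), |t.re| ≤ |z.re| + z.im / 2 ∧ z.im / 2 ≤ t.im := by
    intro t ht
    rw [Metric.mem_ball, dist_eq_norm] at ht
    have hre := (Complex.abs_re_le_norm (t - z)).trans ht.le
    have him := (Complex.abs_im_le_norm (t - z)).trans ht.le
    rw [Complex.sub_re] at hre
    rw [Complex.sub_im] at him
    constructor
    · have := abs_add_le (t.re - z.re) z.re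
      simp only [sub_add_cancel] at this
      linarith
    · linarith [(abs_le.mp him).1]
  have hball : Metric.ball z (z.im / 2) ∈ 𝓝 z := Metric.ball_mem_nhds z (by positivity)
  have main := (hasDerivAt_integral_of_dominated_loc_of_deriv_le (𝕜 := ℂ)
    (μ := volume.restrict (Ioi (0 : ℝ))) (F := fun t (u : ℝ) => a (t + u * Complex.I))
    (F' := fun t (u : ℝ) => _root_.deriv a (t + u * Complex.I)) (x₀ := z)
    (bound := fun u : ℝ => C * Real.exp (-c * u)) hball ?_ (ha.integrableOn_vertical hz) ?_ ?_ ?_ ?_).2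
  · have ftc : ∫ u in Ioi (0 : ℝ), _root_.deriv a (z + u * Complex.I) * Complex.I = 0 - a z := by
      have := integral_Ioi_of_hasDerivAt_of_tendsto (a := 0)
        (f := fun u : ℝ => a (z + u * Complex.I))
        (f' := fun u : ℝ => _root_.deriv a (z + u * Complex.I) * Complex.I) (m := 0)
        ((ha.continuousOn_vertical hz).continuousWithinAt self_mem_Ici) ?_ ?_
        (ha.tendsto_vertical z)
      · simpa using this
      · intro u hu
        simp only [mem_Ioi] at hu
        have h1 : HasDerivAt (fun u : ℝ => z + u * Complex.I) Complex.I u := by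
          simpa using ((Complex.ofRealCLM.hasDerivAt (x := u)).mul_const Complex.I).const_add z
        have h2 := (ha.differentiableAt (z := z + u * Complex.I) (by simp; linarith)).hasDerivAt
        exact h2.comp_of_eq u h1 rfl
      · exact (ha.deriv.integrableOn_vertical hz).mul_const _
    rw [integral_mul_const] at ftc
    have := main.const_mul (-Complex.I)
    convert! this using 1
    linear_combination ftc
  · filter_upwards [hball] with t ht
    have ht' : 0 < t.im := by linarith [(key t ht).2]
    exact (ha.integrableOn_vertical ht').aestronglyMeasurable
  · exact (ha.deriv.integrableOn_vertical hz).aestronglyMeasurable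
  · refine (ae_restrict_mem measurableSet_Ioi).mono fun u hu t ht => ?_
    simp only [mem_Ioi] at hu
    obtain ⟨k1, k2⟩ := key t ht
    refine (h (t + u * Complex.I) (by simpa using k1) (by simp; linarith)).trans ?_
    gcongr 2
    simp only [Complex.add_im, Complex.mul_im, Complex.ofReal_re, Complex.I_im, mul_one,
      Complex.ofReal_im, Complex.I_re, mul_zero, add_zero]
    nlinarith
  · exact (exp_neg_integrableOn_Ioi 0 hc).const_mul C
  · refine (ae_restrict_mem measurableSet_Ioi).mono fun u hu t ht => ?_
    simp only [mem_Ioi] at hu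
    have ht' : 0 < t.im := by linarith [(key t ht).2]
    have h2 := (ha.differentiableAt (z := t + u * Complex.I) (by simp; linarith)).hasDerivAt
    exact h2.comp_add_const t _

theorem prim (ha : HolDecay a) : HolDecay (prim a) where
  diff z hz := (ha.hasDerivAt_prim hz).differentiableAt.differentiableWithinAt
  decay B y₀ hy := by
    obtain ⟨C, c, hC, hc, h⟩ := ha.decay B y₀ hy
    refine ⟨C / c, c, by positivity, hc, fun z h1 h2 => ?_⟩
    rw [Haberland.prim, norm_mul, norm_neg, Complex.norm_I, one_mul]
    have hg : IntegrableOn (fun u : ℝ => C * Real.exp (-c * z.im) * Real.exp (-c * u)) (Ioi 0) :=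
      (exp_neg_integrableOn_Ioi 0 hc).const_mul _
    refine (norm_integral_le_of_norm_le hg ?_).trans (le_of_eq ?_)
    · refine (ae_restrict_mem measurableSet_Ioi).mono fun u hu => ?_
      simp only [mem_Ioi] at hu
      refine (h (z + u * Complex.I) (by simpa using h1) (by simp; linarith)).trans (le_of_eq ?_)
      rw [mul_assoc, ← Real.exp_add]
      congr 2
      simp
      ring
    · rw [integral_const_mul, integral_exp_mul_Ioi (by linarith)]
      simp
      field_simp

end HolDecay

end Haberland

/-! ### Families of cusp forms indexed by cosets. -/

namespace Haberland

open Filter Topology Set Asymptotics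

/-- The asymptotic bound controls heights above some `Y`. The rest of the strip is compact, and
there a bound by a constant suffices. -/
theorem HolDecay.of_isBigO {f : ℍ → ℂ}
    (hf : DifferentiableOn ℂ (f ∘ ofComplex) {z | 0 < z.im}) {c : ℝ} (hc : 0 < c)
    (h : f =O[atImInfty] fun τ => Real.exp (-c * τ.im)) : HolDecay (f ∘ ofComplex) where
  diff := hf
  decay B y₀ hy := by
    obtain ⟨C, hC⟩ := h.bound
    obtain ⟨Y, hY⟩ := (atImInfty_mem _).mp hC
    have hK : IsCompact (Icc (-B) B ×ℂ Icc y₀ Y) := isCompact_Icc.reProdIm isCompact_Icc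
    have hcont : ContinuousOn (f ∘ ofComplex) (Icc (-B) B ×ℂ Icc y₀ Y) := by
      refine hf.continuousOn.mono fun z hz => ?_
      exact hy.trans_le (Complex.mem_reProdIm.mp hz).2.1
    obtain ⟨M, hM⟩ := hK.exists_bound_of_continuousOn hcont
    refine ⟨max |C| (|M| * Real.exp (c * Y)), c, by positivity, hc, fun z h1 h2 => ?_⟩
    rcases le_total Y z.im with h3 | h3
    · have hz : 0 < z.im := hy.trans_le h2
      have := hY ⟨z, hz⟩ h3
      simp only [mem_ofPred_eq, Real.norm_eq_abs, Real.abs_exp] at this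
      rw [Function.comp_apply, ofComplex_apply_of_im_pos hz]
      refine this.trans ?_
      change C * Real.exp (-c * z.im) ≤ _
      gcongr
      exact (le_abs_self C).trans (le_max_left _ _)
    · refine (hM z (Complex.mem_reProdIm.mpr ⟨abs_le.mp h1, h2, h3⟩)).trans ?_
      calc M ≤ |M| := le_abs_self M
        _ ≤ |M| * Real.exp (c * Y) * Real.exp (-c * z.im) := by
          rw [mul_assoc, ← Real.exp_add]
          refine le_mul_of_one_le_right (abs_nonneg _) (Real.one_le_exp ?_)
          nlinarith
        _ ≤ _ := by
          gcongr
          exact le_max_right _ _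

/-- A family of functions indexed by `Γ \ SL(2, ℤ)`, compatible with the weight `k` slash action,
all of whose members decay exponentially at `i∞`. -/
structure IsCuspFamily {Γ : Subgroup SL(2, ℤ)} (k : ℕ) (h : Cosets Γ → ℍ → ℂ) : Prop where
  holDecay : ∀ A, HolDecay (h A ∘ ofComplex)
  slash : ∀ A g, h (cosetMul A g) = h A ∣[(k : ℤ)] g

/-- The family `A ↦ f|A`. -/
noncomputable def formFamily {Γ : Subgroup SL(2, ℤ)} {k : ℕ}
    (f : CuspForm (Γ : Subgroup (GL (Fin 2) ℝ)) (k : ℤ)) : Cosets Γ → ℍ → ℂ :=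
  fun A => Quotient.liftOn' A (fun a : SL(2, ℤ) => (f : ℍ → ℂ) ∣[(k : ℤ)] a) (fun a b hab => by
    have hab' := (QuotientGroup.rightRel_apply).mp hab
    have hf : (f : ℍ → ℂ) ∣[(k : ℤ)] (b * a⁻¹) = f :=
      SlashInvariantFormClass.slash_action_eq f _ (Subgroup.mem_map_of_mem _ hab')
    conv_lhs => rw [← hf, ← SlashAction.slash_mul, inv_mul_cancel_right])

@[simp] theorem formFamily_mk {Γ : Subgroup SL(2, ℤ)} {k : ℕ}
    (f : CuspForm (Γ : Subgroup (GL (Fin 2) ℝ)) (k : ℤ)) (a : SL(2, ℤ)) :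
    formFamily f (Quotient.mk'' a) = (f : ℍ → ℂ) ∣[(k : ℤ)] a := rfl

theorem rho_apply {Γ : Subgroup SL(2, ℤ)} {k : ℕ}
    (f : CuspForm (Γ : Subgroup (GL (Fin 2) ℝ)) (k : ℤ)) (A : Cosets Γ) :
    rho f A = periodIntegral (k - 2) (formFamily f A) := by
  induction A using Quotient.inductionOn'
  rfl

open ConjAct Pointwise Matrix.SpecialLinearGroup in
theorem isCuspFamily_formFamily {Γ : Subgroup SL(2, ℤ)} [Γ.FiniteIndex] {k : ℕ}
    (f : CuspForm (Γ : Subgroup (GL (Fin 2) ℝ)) (k : ℤ)) : IsCuspFamily k (formFamily f) where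
  holDecay A := by
    induction A using Quotient.inductionOn' with | h a => ?_
    -- `f|a` is a cusp form for a conjugate of `Γ`. That conjugate is again arithmetic, so
    -- exponential decay at `i∞` applies to it.
    have : ((toConjAct (a : GL (Fin 2) ℝ)⁻¹) • (Γ : Subgroup (GL (Fin 2) ℝ))).IsArithmetic := by
      simpa [(show Rat.castHom ℝ = algebraMap ℚ ℝ by rfl), map_inv, map_mapGL]
        using! Subgroup.IsArithmetic.conj (Γ : Subgroup (GL (Fin 2) ℝ)) (mapGL ℚ a)⁻¹
    obtain ⟨c, hc, h⟩ := CuspFormClass.exp_decay_atImInfty' (CuspForm.translate f (a : GL (Fin 2) ℝ))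
    exact HolDecay.of_isBigO
      (mdifferentiable_iff.mp (CuspForm.translate f (a : GL (Fin 2) ℝ)).holo') hc h
  slash A g := by
    induction A using Quotient.inductionOn' with | h a => ?_
    exact SlashAction.slash_mul _ _ _ _

/-- The family attached to `z ↦ conj (f (-conj z))` when `h` is the one attached to `f`. -/
noncomputable def epsFamily {Γ : Subgroup SL(2, ℤ)} (hΓ : NormalizedByEps Γ) (k : ℕ)
    (h : Cosets Γ → ℍ → ℂ) : Cosets Γ → ℍ → ℂ :=
  fun A => h (cosetEps hΓ A) ∣[(k : ℤ)] J

theorem coe_epsConj (g : SL(2, ℤ)) :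
    (epsConj g : Matrix (Fin 2) (Fin 2) ℤ) = !![g 0 0, -g 0 1; -g 1 0, g 1 1] := by
  change eps * g.1 * eps = _
  ext i j
  fin_cases i <;> fin_cases j <;> simp [eps, Matrix.mul_apply, Fin.sum_univ_two, Matrix.vecMul,
    dotProduct]

theorem J_mul_mapGL (g : SL(2, ℤ)) : J * (g : GL (Fin 2) ℝ) = (epsConj g : GL (Fin 2) ℝ) * J := by
  ext i j
  fin_cases i <;> fin_cases j <;>
    simp [coe_epsConj, Matrix.mul_apply, Fin.sum_univ_two]

theorem cosetEps_cosetMul {Γ : Subgroup SL(2, ℤ)} (hΓ : NormalizedByEps Γ) (A : Cosets Γ)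
    (g : SL(2, ℤ)) :
    cosetEps hΓ (cosetMul A g) = cosetMul (cosetEps hΓ A) (epsConj g) := by
  induction A using Quotient.inductionOn' with | h a => ?_
  simp [cosetEps, cosetMul]

theorem slash_J_apply (k : ℤ) (f : ℍ → ℂ) (z : ℍ) : (f ∣[k] J) z = conj (f (J • z)) := by
  simp [ModularForm.slash_apply]

theorem ofComplex_neg_conj {z : ℂ} (hz : 0 < z.im) :
    J • ofComplex z = ofComplex (-conj z) := by
  apply UpperHalfPlane.ext
  rw [coe_J_smul, ofComplex_apply_of_im_pos hz, ofComplex_apply_of_im_pos (by simpa using hz)]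

/-- Reflection in the imaginary axis preserves strips and heights, hence decay. Compatibility with
the slash action is the relation `J g = (ε g ε) J`. -/
theorem IsCuspFamily.eps {Γ : Subgroup SL(2, ℤ)} (hΓ : NormalizedByEps Γ) {k : ℕ}
    {h : Cosets Γ → ℍ → ℂ} (hh : IsCuspFamily k h) : IsCuspFamily k (epsFamily hΓ k h) where
  holDecay A := by
    have hA := hh.holDecay (cosetEps hΓ A)
    refine ⟨?_, fun B y₀ hy => ?_⟩
    · exact mdifferentiable_iff.mp
        (MDifferentiable.slash (mdifferentiable_iff.mpr hA.diff) (k : ℤ) J)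
    · obtain ⟨C, c, hC, hc, hb⟩ := hA.decay B y₀ hy
      refine ⟨C, c, hC, hc, fun z h1 h2 => ?_⟩
      have := hb (-conj z) (by simpa using h1) (by simpa using h2)
      rw [Function.comp_apply, epsFamily, slash_J_apply, ofComplex_neg_conj (hy.trans_le h2),
        RCLike.norm_conj]
      simpa using this
  slash A g := by
    rw [epsFamily, cosetEps_cosetMul, hh.slash, epsFamily, ModularForm.SL_slash,
      ModularForm.SL_slash, ← SlashAction.slash_mul, ← SlashAction.slash_mul, J_mul_mapGL]

end Haberland

/-! ### The action on polynomials and the invariant pairing. -/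

namespace Haberland

open Filter Topology Set Polynomial

section polySlash

variable {w : ℕ} {P Q : ℂ[X]} {g : SL(2, ℤ)}

/-- The denominator `cX + d` of a Möbius transformation, as a polynomial. -/
noncomputable def polyDenom (g : SL(2, ℤ)) : ℂ[X] := C (g 1 0 : ℂ) * X + C (g 1 1 : ℂ)

/-- The numerator `aX + b` of a Möbius transformation, as a polynomial. -/
noncomputable def polyNum (g : SL(2, ℤ)) : ℂ[X] := C (g 0 0 : ℂ) * X + C (g 0 1 : ℂ)

theorem polyDenom_ne_zero (g : SL(2, ℤ)) : polyDenom g ≠ 0 := by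
  intro h
  have h0 := congrArg (fun p => p.coeff 0) h
  have h1 := congrArg (fun p => p.coeff 1) h
  simp only [polyDenom, coeff_add, coeff_C_mul, coeff_X, coeff_C, coeff_zero] at h0 h1
  norm_num at h0 h1
  have := g.det_coe
  rw [Matrix.det_fin_two, h0, h1] at this
  simp at this

/-- This lets identities for the polynomial action be checked on values, away from the poles of the
Möbius transformations involved. -/
theorem eq_of_eval_eq_of_eval_ne_zero {q : ℂ[X]} (hq : q ≠ 0)
    (h : ∀ x, q.eval x ≠ 0 → P.eval x = Q.eval x) : P = Q := by
  have : (P - Q) * q = 0 := by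
    refine Polynomial.funext fun x => ?_
    by_cases hx : q.eval x = 0
    · simp [hx]
    · simp [h x hx]
  exact sub_eq_zero.mp ((mul_eq_zero.mp this).resolve_right hq)

theorem eval_polySlash (hP : P.natDegree ≤ w) {x : ℂ} (hx : (polyDenom g).eval x ≠ 0) :
    (polySlash w P g).eval x =
      (polyDenom g).eval x ^ w * P.eval ((polyNum g).eval x / (polyDenom g).eval x) := by
  rw [polySlash, eval_finsetSum, eval_eq_sum_range' (Nat.lt_succ_of_le hP), Finset.mul_sum]
  refine Finset.sum_congr rfl fun n hn => ?_
  have hn' : n ≤ w := Nat.lt_succ_iff.mp (Finset.mem_range.mp hn)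
  have : (polyDenom g).eval x ^ w = (polyDenom g).eval x ^ (w - n) * (polyDenom g).eval x ^ n := by
    rw [← pow_add, Nat.sub_add_cancel hn']
  rw [this, div_pow]
  simp only [eval_mul, eval_C, eval_pow]
  change _ * (polyNum g).eval x ^ n * (polyDenom g).eval x ^ (w - n) = _
  field_simp

theorem natDegree_polySlash_le (w : ℕ) (P : ℂ[X]) (g : SL(2, ℤ)) :
    (polySlash w P g).natDegree ≤ w := by
  refine natDegree_sum_le_of_forall_le _ _ fun n hn => ?_
  have hn' : n ≤ w := Nat.lt_succ_iff.mp (Finset.mem_range.mp hn)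
  have h1 : ∀ a b : ℂ, ∀ m, ((C a * X + C b) ^ m).natDegree ≤ m := fun a b m =>
    (natDegree_pow_le_of_le m (natDegree_linear_le)).trans (by simp)
  refine (natDegree_mul_le_of_le (m := n) (n := w - n) ?_ (h1 _ _ _)).trans (by omega)
  exact (natDegree_C_mul_le _ _).trans (h1 _ _ _)

theorem polySlash_add (w : ℕ) (P Q : ℂ[X]) (g : SL(2, ℤ)) :
    polySlash w (P + Q) g = polySlash w P g + polySlash w Q g := by
  simp only [polySlash, ← Finset.sum_add_distrib, coeff_add, C_add, add_mul]

theorem polySlash_C_mul (w : ℕ) (r : ℂ) (P : ℂ[X]) (g : SL(2, ℤ)) :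
    polySlash w (C r * P) g = C r * polySlash w P g := by
  simp only [polySlash, Finset.mul_sum, coeff_C_mul, C_mul, mul_assoc]

theorem polySlash_neg (w : ℕ) (P : ℂ[X]) (g : SL(2, ℤ)) :
    polySlash w (-P) g = -polySlash w P g := by
  simpa using polySlash_C_mul w (-1) P g

theorem polySlash_sub (w : ℕ) (P Q : ℂ[X]) (g : SL(2, ℤ)) :
    polySlash w (P - Q) g = polySlash w P g - polySlash w Q g := by
  rw [sub_eq_add_neg, polySlash_add, polySlash_neg, sub_eq_add_neg]

theorem map_polySlash (τ : ℂ →+* ℂ) (w : ℕ) (P : ℂ[X]) (g : SL(2, ℤ)) :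
    (polySlash w P g).map τ = polySlash w (P.map τ) g := by
  simp [polySlash, Polynomial.map_sum]

theorem polySlash_one (hP : P.natDegree ≤ w) : polySlash w P 1 = P := by
  refine eq_of_eval_eq_of_eval_ne_zero (polyDenom_ne_zero 1) fun x hx => ?_
  rw [eval_polySlash hP hx]
  simp [polyDenom, polyNum]

theorem polyDenom_mul (g h : SL(2, ℤ)) {x : ℂ} (hx : (polyDenom h).eval x ≠ 0) :
    (polyDenom (g * h)).eval x =
      (polyDenom g).eval ((polyNum h).eval x / (polyDenom h).eval x) * (polyDenom h).eval x := by
  simp only [polyDenom, polyNum, eval_add, eval_mul, eval_C, eval_X] at hx ⊢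
  simp only [Matrix.SpecialLinearGroup.coe_mul, Matrix.mul_apply, Fin.sum_univ_two]
  push_cast
  field_simp
  ring

theorem polyNum_mul (g h : SL(2, ℤ)) {x : ℂ} (hx : (polyDenom h).eval x ≠ 0) :
    (polyNum (g * h)).eval x =
      (polyNum g).eval ((polyNum h).eval x / (polyDenom h).eval x) * (polyDenom h).eval x := by
  simp only [polyDenom, polyNum, eval_add, eval_mul, eval_C, eval_X] at hx ⊢
  simp only [Matrix.SpecialLinearGroup.coe_mul, Matrix.mul_apply, Fin.sum_univ_two]
  push_cast
  field_simp
  ring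

theorem polySlash_polySlash (hP : P.natDegree ≤ w) (g h : SL(2, ℤ)) :
    polySlash w (polySlash w P g) h = polySlash w P (g * h) := by
  refine eq_of_eval_eq_of_eval_ne_zero
    (mul_ne_zero (polyDenom_ne_zero h) (polyDenom_ne_zero (g * h))) fun x hx => ?_
  rw [eval_mul] at hx
  have h1 := left_ne_zero_of_mul hx
  have h2 := right_ne_zero_of_mul hx
  have h3 := h2
  rw [polyDenom_mul g h h1] at h3
  rw [eval_polySlash (natDegree_polySlash_le _ _ _) h1, eval_polySlash hP h2,
    eval_polySlash hP (left_ne_zero_of_mul h3), polyDenom_mul g h h1, polyNum_mul g h h1,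
    mul_div_mul_right _ _ h1]
  ring

end polySlash

section polyPairing

variable {w : ℕ} {P Q : ℂ[X]}

theorem polyPairing_add_left (w : ℕ) (P P' Q : ℂ[X]) :
    polyPairing w (P + P') Q = polyPairing w P Q + polyPairing w P' Q := by
  simp only [polyPairing, ← Finset.sum_add_distrib, coeff_add]
  exact Finset.sum_congr rfl fun _ _ => by ring

theorem polyPairing_add_right (w : ℕ) (P Q Q' : ℂ[X]) :
    polyPairing w P (Q + Q') = polyPairing w P Q + polyPairing w P Q' := by
  simp only [polyPairing, ← Finset.sum_add_distrib, coeff_add]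
  exact Finset.sum_congr rfl fun _ _ => by ring

theorem polyPairing_C_mul_left (w : ℕ) (r : ℂ) (P Q : ℂ[X]) :
    polyPairing w (C r * P) Q = r * polyPairing w P Q := by
  simp only [polyPairing, Finset.mul_sum, coeff_C_mul]
  exact Finset.sum_congr rfl fun _ _ => by ring

theorem polyPairing_C_mul_right (w : ℕ) (r : ℂ) (P Q : ℂ[X]) :
    polyPairing w P (C r * Q) = r * polyPairing w P Q := by
  simp only [polyPairing, Finset.mul_sum, coeff_C_mul]
  exact Finset.sum_congr rfl fun _ _ => by ring

/-- `(s - X)^w = ∑ (-1)^n (w choose n) s^(w-n) X^n`. -/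
theorem coeff_C_sub_X_pow (w n : ℕ) (s : ℂ) (hn : n ≤ w) :
    ((C s - X : ℂ[X]) ^ w).coeff n = (-1) ^ n * (w.choose n : ℂ) * s ^ (w - n) := by
  have h : (C s - X : ℂ[X]) ^ w = C ((-1) ^ w) * (X + C (-s)) ^ w := by
    rw [C_pow, ← mul_pow]
    congr 1
    simp [sub_eq_add_neg, add_comm]
  rw [h, coeff_C_mul, coeff_X_add_C_pow, neg_pow s]
  have : (-1 : ℂ) ^ w * (-1) ^ (w - n) = (-1) ^ n := by
    rw [← pow_add, show w + (w - n) = n + 2 * (w - n) by omega, pow_add, pow_mul]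
    simp
  rw [← this]
  ring

/-- The reproducing property: the signs and inverse binomials in the pairing are exactly those that
cancel the coefficients of `(s - X)^w`. It gives both the invariance of the pairing and the
antiderivative in `hasDerivAt_polyPairing_tail`. -/
theorem polyPairing_pow (hP : P.natDegree ≤ w) (s : ℂ) :
    polyPairing w P ((C s - X) ^ w) = P.eval s := by
  rw [polyPairing, eval_eq_sum_range' (Nat.lt_succ_of_le hP)]
  refine Finset.sum_congr rfl fun n hn => ?_
  have hn' : n ≤ w := Nat.lt_succ_iff.mp (Finset.mem_range.mp hn)
  rw [coeff_C_sub_X_pow w (w - n) s (Nat.sub_le _ _), Nat.choose_symm hn', Nat.sub_sub_self hn']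
  have h1 : ((w.choose n : ℕ) : ℂ) ≠ 0 := Nat.cast_ne_zero.mpr (Nat.choose_pos hn').ne'
  have h2 : (-1 : ℂ) ^ (w - n) * (-1) ^ (w - n) = 1 := by rw [← mul_pow]; simp
  field_simp
  linear_combination (P.coeff n * s ^ n) * h2

theorem natDegree_C_sub_X_pow_le (w : ℕ) (s : ℂ) : ((C s - X : ℂ[X]) ^ w).natDegree ≤ w := by
  have : (C s - X : ℂ[X]).natDegree ≤ 1 := (natDegree_sub_le _ _).trans (by simp)
  simpa using natDegree_pow_le_of_le w this

/-- A linear functional on polynomials of degree at most `w` that vanishes on `(s - X)^w` for all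
but finitely many `s` is zero. -/
theorem eq_of_forall_pow_eq {L L' : ℂ[X] →ₗ[ℂ] ℂ} {q : ℂ[X]} (hq : q ≠ 0)
    (h : ∀ s, q.eval s ≠ 0 → L ((C s - X) ^ w) = L' ((C s - X) ^ w)) (hQ : Q.natDegree ≤ w) :
    L Q = L' Q := by
  -- As a function of `s` this value is a polynomial, whose coefficients are nonzero multiples of
  -- the numbers `M(Xⁿ)`, `n ≤ w`. It therefore determines `M` in degree at most `w`.
  have expand : ∀ (M : ℂ[X] →ₗ[ℂ] ℂ) (s : ℂ), M ((C s - X) ^ w) =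
      (∑ n ∈ Finset.range (w + 1),
        C ((-1) ^ n * (w.choose n : ℂ) * M (X ^ n)) * X ^ (w - n) : ℂ[X]).eval s := by
    intro M s
    conv_lhs => rw [((C s - X : ℂ[X]) ^ w).as_sum_range' (w + 1)
      (Nat.lt_succ_of_le (natDegree_C_sub_X_pow_le w s))]
    rw [map_sum, eval_finsetSum]
    refine Finset.sum_congr rfl fun n hn => ?_
    rw [coeff_C_sub_X_pow w n s (Nat.lt_succ_iff.mp (Finset.mem_range.mp hn)),
      ← C_mul_X_pow_eq_monomial, ← smul_eq_C_mul, map_smul]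
    simp
    ring
  have hpoly := eq_of_eval_eq_of_eval_ne_zero hq fun s hs =>
    (expand L s).symm.trans ((h s hs).trans (expand L' s))
  have hmono : ∀ n ≤ w, L (X ^ n) = L' (X ^ n) := by
    intro n hn
    have := congrArg (fun p => p.coeff (w - n)) hpoly
    simp only [finsetSum_coeff, coeff_C_mul, coeff_X_pow] at this
    rw [Finset.sum_eq_single n, Finset.sum_eq_single n] at this
    · have h1 : ((w.choose n : ℕ) : ℂ) ≠ 0 := Nat.cast_ne_zero.mpr (Nat.choose_pos hn).ne'
      have h2 : ((-1 : ℂ) ^ n) ≠ 0 := by simp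
      simpa [h1, h2] using this
    all_goals first
      | (intro m hm hmn
         rw [if_neg, mul_zero]
         have := Finset.mem_range.mp hm
         omega)
      | (intro hm
         exact absurd (Finset.mem_range.mpr (Nat.lt_succ_of_le hn)) hm)
  rw [Q.as_sum_range' (w + 1) (Nat.lt_succ_of_le hQ), map_sum, map_sum]
  refine Finset.sum_congr rfl fun n hn => ?_
  rw [← C_mul_X_pow_eq_monomial, ← smul_eq_C_mul, map_smul, map_smul,
    hmono n (Nat.lt_succ_iff.mp (Finset.mem_range.mp hn))]

/-- The pairing with a fixed polynomial, as a linear functional. -/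
noncomputable def pairingHom (w : ℕ) (P : ℂ[X]) : ℂ[X] →ₗ[ℂ] ℂ where
  toFun := polyPairing w P
  map_add' := polyPairing_add_right w P
  map_smul' r Q := by simpa [smul_eq_C_mul] using polyPairing_C_mul_right w r P Q

/-- The action of a matrix on polynomials, as a linear map. -/
noncomputable def slashHom (w : ℕ) (g : SL(2, ℤ)) : ℂ[X] →ₗ[ℂ] ℂ[X] where
  toFun P := polySlash w P g
  map_add' P Q := polySlash_add w P Q g
  map_smul' r P := by simpa [smul_eq_C_mul] using polySlash_C_mul w r P g

theorem polySlash_pow (w : ℕ) (g : SL(2, ℤ)) {s : ℂ} (hs : (polyDenom g⁻¹).eval s ≠ 0) :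
    polySlash w ((C s - X) ^ w) g =
      C ((polyDenom g⁻¹).eval s ^ w) *
        (C ((polyNum g⁻¹).eval s / (polyDenom g⁻¹).eval s) - X) ^ w := by
  refine eq_of_eval_eq_of_eval_ne_zero (polyDenom_ne_zero g) fun x hx => ?_
  rw [eval_polySlash (natDegree_C_sub_X_pow_le w s) hx]
  simp only [eval_pow, eval_sub, eval_C, eval_X, eval_mul, ← mul_pow]
  congr 1
  simp only [polyDenom, polyNum, eval_add, eval_mul, eval_C, eval_X,
    Matrix.SpecialLinearGroup.SL2_inv_expl, Matrix.cons_val_zero,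
    Matrix.cons_val_one] at hs hx ⊢
  simp at hs hx ⊢
  field_simp
  ring

/-- It suffices to take `Q = (s - X)^w`. Since `Q|g` is a scalar multiple of such a power based at
`g⁻¹s`, the reproducing property turns the left side into `((P|g)|g⁻¹)(s) = P(s)`. -/
theorem polyPairing_slash (hP : P.natDegree ≤ w) (hQ : Q.natDegree ≤ w) (g : SL(2, ℤ)) :
    polyPairing w (polySlash w P g) (polySlash w Q g) = polyPairing w P Q := by
  refine eq_of_forall_pow_eq (L := pairingHom w (polySlash w P g) ∘ₗ slashHom w g)
    (L' := pairingHom w P) (polyDenom_ne_zero g⁻¹) (fun s hs => ?_) hQ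
  change polyPairing w (polySlash w P g) (polySlash w ((C s - X) ^ w) g) =
    polyPairing w P ((C s - X) ^ w)
  rw [polySlash_pow w g hs, polyPairing_C_mul_right, polyPairing_pow (natDegree_polySlash_le _ _ _),
    ← eval_polySlash (natDegree_polySlash_le _ _ _) hs, polySlash_polySlash hP, mul_inv_cancel,
    polySlash_one hP, polyPairing_pow hP]

end polyPairing

/-! ### The induced action and pairing on maps from the coset space. -/

section cosets

variable {Γ : Subgroup SL(2, ℤ)}

@[simp] theorem cosetMul_mul (A : Cosets Γ) (g h : SL(2, ℤ)) :
    cosetMul (cosetMul A g) h = cosetMul A (g * h) := by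
  induction A using Quotient.inductionOn' with | h a => ?_
  simp [cosetMul, mul_assoc]

@[simp] theorem cosetMul_one (A : Cosets Γ) : cosetMul A 1 = A := by
  induction A using Quotient.inductionOn' with | h a => ?_
  simp [cosetMul]

/-- Right translation by `g` as a permutation of `Γ \ SL(2, ℤ)`. -/
def cosetMulEquiv (Γ : Subgroup SL(2, ℤ)) (g : SL(2, ℤ)) : Cosets Γ ≃ Cosets Γ where
  toFun A := cosetMul A g
  invFun A := cosetMul A g⁻¹
  left_inv A := by simp
  right_inv A := by simp

instance finite_cosets [Γ.FiniteIndex] : Finite (Cosets Γ) :=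
  Finite.of_equiv _ (QuotientGroup.quotientRightRelEquivQuotientLeftRel Γ).symm

theorem indSlash_indSlash {w : ℕ} {P : Cosets Γ → ℂ[X]} (hP : ∀ A, (P A).natDegree ≤ w)
    (g h : SL(2, ℤ)) : indSlash w (indSlash w P g) h = indSlash w P (g * h) := by
  funext A
  simp only [indSlash, polySlash_polySlash (hP _), cosetMul_mul, mul_inv_rev]

theorem indSlash_one {w : ℕ} {P : Cosets Γ → ℂ[X]} (hP : ∀ A, (P A).natDegree ≤ w) :
    indSlash w P 1 = P := by
  funext A
  simp [indSlash, polySlash_one (hP _)]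

theorem natDegree_indSlash_le (w : ℕ) (P : Cosets Γ → ℂ[X]) (g : SL(2, ℤ)) (A : Cosets Γ) :
    (indSlash w P g A).natDegree ≤ w := natDegree_polySlash_le _ _ _

theorem indSlash_add (w : ℕ) (P Q : Cosets Γ → ℂ[X]) (g : SL(2, ℤ)) :
    indSlash w (P + Q) g = indSlash w P g + indSlash w Q g :=
  funext fun _ => polySlash_add _ _ _ _

theorem indSlash_sub (w : ℕ) (P Q : Cosets Γ → ℂ[X]) (g : SL(2, ℤ)) :
    indSlash w (P - Q) g = indSlash w P g - indSlash w Q g :=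
  funext fun _ => polySlash_sub _ _ _ _

theorem indSlash_neg (w : ℕ) (P : Cosets Γ → ℂ[X]) (g : SL(2, ℤ)) :
    indSlash w (-P) g = -indSlash w P g :=
  funext fun _ => polySlash_neg _ _ _

theorem indPairing_add_left [Γ.FiniteIndex] (w : ℕ) (P P' Q : Cosets Γ → ℂ[X]) :
    indPairing w (P + P') Q = indPairing w P Q + indPairing w P' Q := by
  simp only [indPairing, Pi.add_apply, polyPairing_add_left]
  rw [finsum_add_distrib (Set.toFinite _) (Set.toFinite _), mul_add]

theorem indPairing_add_right [Γ.FiniteIndex] (w : ℕ) (P Q Q' : Cosets Γ → ℂ[X]) :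
    indPairing w P (Q + Q') = indPairing w P Q + indPairing w P Q' := by
  simp only [indPairing, Pi.add_apply, polyPairing_add_right]
  rw [finsum_add_distrib (Set.toFinite _) (Set.toFinite _), mul_add]

theorem indPairing_C_mul_left (w : ℕ) (r : ℂ) (P Q : Cosets Γ → ℂ[X]) :
    indPairing w (fun A => C r * P A) Q = r * indPairing w P Q := by
  simp only [indPairing, polyPairing_C_mul_left]
  rw [← mul_finsum, mul_left_comm]

theorem indPairing_C_mul_right (w : ℕ) (r : ℂ) (P Q : Cosets Γ → ℂ[X]) :
    indPairing w P (fun A => C r * Q A) = r * indPairing w P Q := by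
  simp only [indPairing, polyPairing_C_mul_right]
  rw [← mul_finsum, mul_left_comm]

theorem indPairing_neg_left (w : ℕ) (P Q : Cosets Γ → ℂ[X]) :
    indPairing w (-P) Q = -indPairing w P Q := by
  have := indPairing_C_mul_left w (-1) P Q
  simp only [C_neg, C_1, neg_one_mul] at this
  exact this

theorem indPairing_neg_right (w : ℕ) (P Q : Cosets Γ → ℂ[X]) :
    indPairing w P (-Q) = -indPairing w P Q := by
  have := indPairing_C_mul_right w (-1) P Q
  simp only [C_neg, C_1, neg_one_mul] at this
  exact this

theorem indPairing_sub_left [Γ.FiniteIndex] (w : ℕ) (P P' Q : Cosets Γ → ℂ[X]) :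
    indPairing w (P - P') Q = indPairing w P Q - indPairing w P' Q := by
  rw [sub_eq_add_neg, indPairing_add_left, indPairing_neg_left, sub_eq_add_neg]

theorem indPairing_sub_right [Γ.FiniteIndex] (w : ℕ) (P Q Q' : Cosets Γ → ℂ[X]) :
    indPairing w P (Q - Q') = indPairing w P Q - indPairing w P Q' := by
  rw [sub_eq_add_neg, indPairing_add_right, indPairing_neg_right, sub_eq_add_neg]

theorem indPairing_slash {w : ℕ} {P Q : Cosets Γ → ℂ[X]} (hP : ∀ A, (P A).natDegree ≤ w)
    (hQ : ∀ A, (Q A).natDegree ≤ w) (g : SL(2, ℤ)) :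
    indPairing w (indSlash w P g) (indSlash w Q g) = indPairing w P Q := by
  simp only [indPairing, indSlash, polyPairing_slash (hP _) (hQ _)]
  congr 1
  exact finsum_comp_equiv (cosetMulEquiv Γ g⁻¹) (f := fun A => polyPairing w (P A) (Q A))

end cosets

end Haberland

/-! ### Tail integrals `∫_{i∞}^z` and their transformation under `SL(2, ℤ)`. -/

namespace Haberland

open Filter Topology Set Polynomial

section moebius

theorem eval_polyDenom (g : SL(2, ℤ)) (z : ℂ) : (polyDenom g).eval z = g 1 0 * z + g 1 1 := by
  simp [polyDenom]

theorem eval_polyNum (g : SL(2, ℤ)) (z : ℂ) : (polyNum g).eval z = g 0 0 * z + g 0 1 := by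
  simp [polyNum]

theorem denom_eq_eval (g : SL(2, ℤ)) (z : ℂ) :
    denom (g : GL (Fin 2) ℝ) z = (polyDenom g).eval z := by
  simp [eval_polyDenom, denom]

theorem coe_smul_eq_eval (g : SL(2, ℤ)) (z : ℍ) :
    ((g • z : ℍ) : ℂ) = (polyNum g).eval (z : ℂ) / (polyDenom g).eval (z : ℂ) := by
  rw [coe_specialLinearGroup_apply, eval_polyDenom, eval_polyNum]
  simp

theorem eval_polyDenom_ne_zero (g : SL(2, ℤ)) (z : ℍ) : (polyDenom g).eval (z : ℂ) ≠ 0 := by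
  rw [← denom_eq_eval]
  exact denom_ne_zero _ z

theorem slash_apply_eval (f : ℍ → ℂ) (k : ℕ) (g : SL(2, ℤ)) (z : ℍ) :
    (f ∣[(k : ℤ)] g) z * (polyDenom g).eval (z : ℂ) ^ k = f (g • z) := by
  have := eval_polyDenom_ne_zero g z
  rw [ModularForm.SL_slash_apply, denom_eq_eval, zpow_neg, zpow_natCast]
  field_simp

theorem det_eq_one (g : SL(2, ℤ)) : (g 0 0 : ℂ) * g 1 1 - g 0 1 * g 1 0 = 1 := by
  have := g.det_coe
  rw [Matrix.det_fin_two] at this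
  exact_mod_cast this

theorem hasDerivAt_moebius (g : SL(2, ℤ)) {z : ℂ} (hz : (polyDenom g).eval z ≠ 0) :
    HasDerivAt (fun z => (polyNum g).eval z / (polyDenom g).eval z)
      (1 / (polyDenom g).eval z ^ 2) z := by
  have h := ((polyNum g).hasDerivAt z).div ((polyDenom g).hasDerivAt z) hz
  refine h.congr_deriv ?_
  congr 1
  have : derivative (polyNum g) = C (g 0 0 : ℂ) := by simp [polyNum]
  rw [this]
  have : derivative (polyDenom g) = C (g 1 0 : ℂ) := by simp [polyDenom]
  rw [this, eval_C, eval_C, eval_polyNum, eval_polyDenom]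
  linear_combination det_eq_one g

theorem moebius_sub_moebius (g : SL(2, ℤ)) {z x : ℂ} (hz : (polyDenom g).eval z ≠ 0)
    (hx : (polyDenom g).eval x ≠ 0) :
    (polyNum g).eval z / (polyDenom g).eval z - (polyNum g).eval x / (polyDenom g).eval x =
      (z - x) / ((polyDenom g).eval z * (polyDenom g).eval x) := by
  rw [div_sub_div _ _ hz hx]
  congr 1
  simp only [eval_polyNum, eval_polyDenom]
  linear_combination (z - x) * det_eq_one g

end moebius

/-- The polynomial `∫_{i∞}^z h(t) (t - X)^w dt`. -/
noncomputable def tailPoly (w : ℕ) (h : ℍ → ℂ) (z : ℂ) : ℂ[X] :=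
  ∑ n ∈ Finset.range (w + 1), monomial n
    (prim (fun t => h (ofComplex t) * ((C t - X : ℂ[X]) ^ w).coeff n) z)

section tailPoly

variable {w : ℕ} {h : ℍ → ℂ}

theorem HolDecay.mul_coeff {a : ℂ → ℂ} (ha : HolDecay a) (w n : ℕ) (hn : n ≤ w) :
    HolDecay (fun t => a t * ((C t - X : ℂ[X]) ^ w).coeff n) := by
  have := (ha.mul_pow (w - n)).const_mul ((-1) ^ n * (w.choose n : ℂ))
  convert! this using 2 with t
  rw [coeff_C_sub_X_pow w n t hn]
  ring

theorem natDegree_tailPoly_le (w : ℕ) (h : ℍ → ℂ) (z : ℂ) : (tailPoly w h z).natDegree ≤ w := by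
  refine natDegree_sum_le_of_forall_le _ _ fun n hn => ?_
  exact (natDegree_monomial_le _).trans (Nat.lt_succ_iff.mp (Finset.mem_range.mp hn))

theorem coeff_tailPoly (h : ℍ → ℂ) (z : ℂ) {n : ℕ} (hn : n ≤ w) :
    (tailPoly w h z).coeff n =
      prim (fun t => h (ofComplex t) * ((C t - X : ℂ[X]) ^ w).coeff n) z := by
  rw [tailPoly, finsetSum_coeff, Finset.sum_eq_single n]
  · simp
  · intro m _ hm
    rw [coeff_monomial, if_neg hm]
  · intro hm
    exact absurd (Finset.mem_range.mpr (Nat.lt_succ_of_le hn)) hm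

theorem holDecay_coeff_tailPoly (hh : HolDecay (h ∘ ofComplex)) {n : ℕ} (hn : n ≤ w) :
    HolDecay (fun z => (tailPoly w h z).coeff n) := by
  simp only [coeff_tailPoly h _ hn]
  exact (hh.mul_coeff w n hn).prim

theorem hasDerivAt_coeff_tailPoly (hh : HolDecay (h ∘ ofComplex)) {n : ℕ} (hn : n ≤ w) {z : ℂ}
    (hz : 0 < z.im) : HasDerivAt (fun z => (tailPoly w h z).coeff n)
      (h (ofComplex z) * ((C z - X : ℂ[X]) ^ w).coeff n) z := by
  simp only [coeff_tailPoly h _ hn]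
  exact (hh.mul_coeff w n hn).hasDerivAt_prim hz

theorem eval_tailPoly (w : ℕ) (h : ℍ → ℂ) (z x : ℂ) : (tailPoly w h z).eval x =
    ∑ n ∈ Finset.range (w + 1), (tailPoly w h z).coeff n * x ^ n :=
  eval_eq_sum_range' (Nat.lt_succ_of_le (natDegree_tailPoly_le w h z)) x

theorem eval_pow_eq_sum (w : ℕ) (z x : ℂ) : (z - x) ^ w =
    ∑ n ∈ Finset.range (w + 1), ((C z - X : ℂ[X]) ^ w).coeff n * x ^ n := by
  rw [← eval_eq_sum_range' (Nat.lt_succ_of_le (natDegree_C_sub_X_pow_le w z)) x]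
  simp

theorem hasDerivAt_eval_tailPoly (hh : HolDecay (h ∘ ofComplex)) (x : ℂ) {z : ℂ}
    (hz : 0 < z.im) : HasDerivAt (fun z => (tailPoly w h z).eval x)
      (h (ofComplex z) * (z - x) ^ w) z := by
  simp only [eval_tailPoly, eval_pow_eq_sum, Finset.mul_sum, ← mul_assoc]
  exact HasDerivAt.fun_sum fun n hn => (hasDerivAt_coeff_tailPoly hh
    (Nat.lt_succ_iff.mp (Finset.mem_range.mp hn)) hz).mul_const _

theorem tendsto_eval_tailPoly (hh : HolDecay (h ∘ ofComplex)) (x z : ℂ) :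
    Tendsto (fun u : ℝ => (tailPoly w h (z + u * Complex.I)).eval x) atTop (𝓝 0) := by
  simp only [eval_tailPoly]
  have : (0 : ℂ) = ∑ n ∈ Finset.range (w + 1), 0 * x ^ n := by simp
  rw [this]
  exact tendsto_finsetSum _ fun n hn => ((holDecay_coeff_tailPoly hh
    (Nat.lt_succ_iff.mp (Finset.mem_range.mp hn))).tendsto_vertical z).mul_const _

/-- The transformation behaviour of `∫_{i∞}^z h(t) (t - X)^w dt` up to a polynomial independent
of `z`. -/
theorem polySlash_tailPoly_sub_eq (hh : HolDecay (h ∘ ofComplex)) (g : SL(2, ℤ))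
    (hg : HolDecay ((h ∣[((w + 2 : ℕ) : ℤ)] g) ∘ ofComplex)) (z z' : ℍ) :
    polySlash w (tailPoly w h (g • z : ℍ)) g - tailPoly w (h ∣[((w + 2 : ℕ) : ℤ)] g) z =
      polySlash w (tailPoly w h (g • z' : ℍ)) g - tailPoly w (h ∣[((w + 2 : ℕ) : ℤ)] g) z' := by
  refine eq_of_eval_eq_of_eval_ne_zero (polyDenom_ne_zero g) fun x hx => ?_
  rw [eval_sub, eval_sub, eval_polySlash (natDegree_tailPoly_le _ _ _) hx,
    eval_polySlash (natDegree_tailPoly_le _ _ _) hx]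
  set x' := (polyNum g).eval x / (polyDenom g).eval x with hx'
  set Φ : ℂ → ℂ := fun z => (polyDenom g).eval x ^ w *
    (tailPoly w h ((polyNum g).eval z / (polyDenom g).eval z)).eval x' -
      (tailPoly w (h ∣[((w + 2 : ℕ) : ℤ)] g) z).eval x with hΦ
  -- The two derivatives cancel: the weight `w + 2` factor meets `d(gz) = dz / (cz + d)²` and `gz -
  -- gx = (z - x) / ((cz + d)(cx + d))`.
  have hd : ∀ z : ℂ, 0 < z.im → HasDerivAt Φ 0 z := by
    intro z hz
    have hdz : (polyDenom g).eval z ≠ 0 := eval_polyDenom_ne_zero g ⟨z, hz⟩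
    have hcoe := coe_smul_eq_eval g ⟨z, hz⟩
    have him : 0 < ((polyNum g).eval z / (polyDenom g).eval z).im := by
      change _ = (polyNum g).eval z / (polyDenom g).eval z at hcoe
      rw [← hcoe]
      exact (g • (⟨z, hz⟩ : ℍ)).im_pos
    have h1 := (hasDerivAt_eval_tailPoly (w := w) hh x' him).comp z (hasDerivAt_moebius g hdz)
    have h2 := (h1.const_mul ((polyDenom g).eval x ^ w)).sub (hasDerivAt_eval_tailPoly (w := w) hg x hz)
    refine h2.congr_deriv ?_
    have e1 : ofComplex ((polyNum g).eval z / (polyDenom g).eval z) = g • ofComplex z := by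
      rw [ofComplex_apply_of_im_pos hz, ofComplex_apply_of_im_pos him]
      exact UpperHalfPlane.ext hcoe.symm
    have e2 := slash_apply_eval h (w + 2) g (ofComplex z)
    rw [ofComplex_apply_of_im_pos hz] at e1 e2 ⊢
    change _ * (polyDenom g).eval z ^ (w + 2) = _ at e2
    rw [e1, ← e2, hx', moebius_sub_moebius g hdz hx, div_pow, mul_pow]
    field_simp
    ring
  have hconst := HolDecay.isOpen_im_pos.is_const_of_deriv_eq_zero
    (convex_halfSpace_im_gt 0).isPreconnected
    (fun z hz => (hd z hz).differentiableAt.differentiableWithinAt)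
    (fun z hz => (hd z hz).deriv) z.im_pos z'.im_pos
  simp only [hΦ] at hconst
  rw [coe_smul_eq_eval, coe_smul_eq_eval]
  exact hconst

/-- The discrepancy is independent of `z`, and both terms tend to zero as `z → i∞`, because a
translation fixes the cusp `i∞`. -/
theorem polySlash_tailPoly_of_translation (hh : HolDecay (h ∘ ofComplex)) (g : SL(2, ℤ))
    (hg : HolDecay ((h ∣[((w + 2 : ℕ) : ℤ)] g) ∘ ofComplex)) {r : ℂ}
    (hr : ∀ z : ℍ, ((g • z : ℍ) : ℂ) = z + r) (z : ℍ) :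
    polySlash w (tailPoly w h (g • z : ℍ)) g = tailPoly w (h ∣[((w + 2 : ℕ) : ℤ)] g) z := by
  rw [← sub_eq_zero]
  refine eq_of_eval_eq_of_eval_ne_zero (polyDenom_ne_zero g) fun x hx => ?_
  set P := polySlash w (tailPoly w h (g • z : ℍ)) g - tailPoly w (h ∣[((w + 2 : ℕ) : ℤ)] g) z
    with hP
  have hconst : ∀ u : ℝ, 0 < u → P.eval x = (polyDenom g).eval x ^ w *
      (tailPoly w h (Complex.I + r + u * Complex.I)).eval
        ((polyNum g).eval x / (polyDenom g).eval x) -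
      (tailPoly w (h ∣[((w + 2 : ℕ) : ℤ)] g) (Complex.I + u * Complex.I)).eval x := by
    intro u hu
    have him : 0 < (Complex.I + u * Complex.I).im := by simp; linarith
    rw [hP, polySlash_tailPoly_sub_eq hh g hg z ⟨Complex.I + u * Complex.I, him⟩, eval_sub,
      eval_polySlash (natDegree_tailPoly_le _ _ _) hx, hr]
    change _ * (tailPoly w h (Complex.I + u * Complex.I + r)).eval _ - _ = _
    rw [add_right_comm]
  have hlim := ((tendsto_eval_tailPoly (w := w) hh ((polyNum g).eval x / (polyDenom g).eval x)
    (Complex.I + r)).const_mul ((polyDenom g).eval x ^ w)).sub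
      (tendsto_eval_tailPoly (w := w) hg x Complex.I)
  rw [mul_zero, sub_zero] at hlim
  rw [eval_zero]
  refine tendsto_nhds_unique (tendsto_const_nhds (x := P.eval x) (f := (atTop : Filter ℝ))) ?_
  exact hlim.congr' ((eventually_gt_atTop 0).mono fun u hu => (hconst u hu).symm)

theorem S_smul_coe (z : ℍ) : ((ModularGroup.S • z : ℍ) : ℂ) = -(z : ℂ)⁻¹ := by
  rw [modular_S_smul]
  exact inv_neg

theorem eval_polyDenom_S (x : ℂ) : (polyDenom ModularGroup.S).eval x = x := by
  rw [eval_polyDenom]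
  simp [ModularGroup.S]

theorem eval_polyNum_S (x : ℂ) : (polyNum ModularGroup.S).eval x = -1 := by
  rw [eval_polyNum]
  simp [ModularGroup.S]

theorem im_I_mul {y : ℝ} (hy : 0 < y) : 0 < (Complex.I * y).im := by simpa using hy

theorem HolDecay.integrableOn_axis {a : ℂ → ℂ} (ha : HolDecay a) {y : ℝ} (hy : 0 < y) :
    IntegrableOn (fun s : ℝ => a (Complex.I * s)) (Ioi y) := by
  have h1 := ha.integrableOn_vertical (im_I_mul hy)
  have h2 := (measurePreserving_add_left volume y).integrableOn_comp_preimage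
    (measurableEmbedding_addLeft y) (f := fun s : ℝ => a (Complex.I * s)) (s := Ioi y)
  rw [← h2]
  simp only [Set.preimage_const_add_Ioi, sub_self]
  refine h1.congr_fun (fun u _ => ?_) measurableSet_Ioi
  simp only [Function.comp_apply, Complex.ofReal_add]
  ring_nf

theorem prim_axis (a : ℂ → ℂ) (y : ℝ) :
    prim a (Complex.I * y) = -Complex.I * ∫ s in Ioi y, a (Complex.I * s) := by
  have h2 := (measurePreserving_add_left volume y).setIntegral_preimage_emb
    (measurableEmbedding_addLeft y) (fun s : ℝ => a (Complex.I * s)) (Ioi y)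
  rw [prim, ← h2]
  simp only [Set.preimage_const_add_Ioi, sub_self]
  congr 1
  refine setIntegral_congr_fun measurableSet_Ioi fun u _ => ?_
  simp only [Complex.ofReal_add]
  ring_nf

/-- On `[1, ∞)` decay of `h` suffices. On `(0, 1]` write `h(iy) = (h|S)(i/y) (i/y)^(w+2)`, which is
bounded by the decay of `h|S`. -/
theorem integrableOn_period (hh : HolDecay (h ∘ ofComplex))
    (hS : HolDecay ((h ∣[((w + 2 : ℕ) : ℤ)] ModularGroup.S) ∘ ofComplex)) {n : ℕ} (hn : n ≤ w) :
    IntegrableOn (fun y : ℝ => h (ofComplex (Complex.I * y)) *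
      ((C (Complex.I * y) - X : ℂ[X]) ^ w).coeff n) (Ioi 0) := by
  rw [← Ioc_union_Ioi_eq_Ioi (zero_le_one' ℝ)]
  refine IntegrableOn.union ?_ ((hh.mul_coeff w n hn).integrableOn_axis one_pos)
  obtain ⟨C₁, c, hC, hc, hb⟩ := (hS.mul_pow (w + 2)).decay 0 1 one_pos
  have hcont : ContinuousOn (fun y : ℝ => h (ofComplex (Complex.I * y)) *
      ((C (Complex.I * y) - X : ℂ[X]) ^ w).coeff n) (Ioc 0 1) := by
    refine (hh.mul_coeff w n hn).diff.continuousOn.comp (by fun_prop) fun y hy => ?_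
    exact im_I_mul hy.1
  refine IntegrableOn.of_bound (by simp) (hcont.aestronglyMeasurable measurableSet_Ioc)
    (C₁ * (w.choose n)) ?_
  refine (ae_restrict_mem measurableSet_Ioc).mono fun y hy => ?_
  have hy0 : 0 < y := hy.1
  have hyinv : 1 ≤ y⁻¹ := (one_le_inv₀ hy0).mpr hy.2
  have him : 0 < (Complex.I * (y⁻¹ : ℝ)).im := im_I_mul (inv_pos.mpr hy0)
  have e1 : ModularGroup.S • ofComplex (Complex.I * (y⁻¹ : ℝ)) = ofComplex (Complex.I * y) := by
    apply UpperHalfPlane.ext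
    rw [S_smul_coe, ofComplex_apply_of_im_pos him, ofComplex_apply_of_im_pos (im_I_mul hy0)]
    simp [mul_comm]
  have e2 := slash_apply_eval h (w + 2) ModularGroup.S (ofComplex (Complex.I * (y⁻¹ : ℝ)))
  rw [e1, eval_polyDenom_S] at e2
  have e3 : ((ofComplex (Complex.I * (y⁻¹ : ℝ)) : ℍ) : ℂ) = Complex.I * (y⁻¹ : ℝ) := by
    rw [ofComplex_apply_of_im_pos him]
  rw [e3] at e2
  rw [norm_mul, ← e2, coeff_C_sub_X_pow w n _ hn]
  refine mul_le_mul ?_ ?_ (norm_nonneg _) hC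
  · refine (hb (Complex.I * (y⁻¹ : ℝ)) (by simp) (by simpa using hyinv)).trans ?_
    refine mul_le_of_le_one_right hC (Real.exp_le_one_iff.mpr ?_)
    simp only [Complex.mul_im, Complex.I_re, Complex.ofReal_im, mul_zero, Complex.I_im,
      Complex.ofReal_re, one_mul, zero_add]
    nlinarith
  · simp only [norm_mul, norm_pow, norm_neg, norm_one, one_pow, one_mul, Complex.norm_natCast,
      Complex.norm_I, Complex.norm_real, Real.norm_of_nonneg hy0.le]
    exact mul_le_of_le_one_right (Nat.cast_nonneg _) (pow_le_one₀ hy0.le hy.2)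

theorem natDegree_periodIntegral_le (w : ℕ) (h : ℍ → ℂ) : (periodIntegral w h).natDegree ≤ w := by
  refine natDegree_sum_le_of_forall_le _ _ fun n hn => ?_
  exact (natDegree_monomial_le _).trans (Nat.lt_succ_iff.mp (Finset.mem_range.mp hn))

theorem coeff_periodIntegral (h : ℍ → ℂ) {n : ℕ} (hn : n ≤ w) :
    (periodIntegral w h).coeff n = (∫ y in Ioi (0 : ℝ), h (ofComplex (Complex.I * y)) *
      ((C (Complex.I * y) - X : ℂ[X]) ^ w).coeff n) * Complex.I := by
  rw [periodIntegral, finsetSum_coeff, Finset.sum_eq_single n]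
  · rw [coeff_monomial, if_pos rfl, integral_mul_const]
  · intro m _ hm
    rw [coeff_monomial, if_neg hm]
  · intro hm
    exact absurd (Finset.mem_range.mpr (Nat.lt_succ_of_le hn)) hm

theorem tendsto_eval_tailPoly_zero (hh : HolDecay (h ∘ ofComplex))
    (hS : HolDecay ((h ∣[((w + 2 : ℕ) : ℤ)] ModularGroup.S) ∘ ofComplex)) (x : ℂ) :
    Tendsto (fun y : ℝ => (tailPoly w h (Complex.I * (y⁻¹ : ℝ))).eval x) atTop
      (𝓝 (-(periodIntegral w h).eval x)) := by
  rw [eval_eq_sum_range' (Nat.lt_succ_of_le (natDegree_periodIntegral_le w h)) x,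
    ← Finset.sum_neg_distrib]
  simp only [eval_tailPoly]
  refine tendsto_finsetSum _ fun n hn => ?_
  have hn' : n ≤ w := Nat.lt_succ_iff.mp (Finset.mem_range.mp hn)
  rw [← neg_mul]
  refine Tendsto.mul_const _ ?_
  rw [coeff_periodIntegral h hn']
  simp only [coeff_tailPoly h _ hn', prim_axis]
  have hint := integrableOn_period hh hS hn'
  have hcov := (aecover_Ioi_of_Ioi (μ := volume) (A := (0 : ℝ)) (l := (atTop : Filter ℝ))
    (a := fun y => y⁻¹) tendsto_inv_atTop_zero).integral_tendsto_of_countably_generated hint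
  have := hcov.const_mul (-Complex.I)
  rw [mul_comm _ Complex.I, ← neg_mul]
  refine this.congr' ((eventually_gt_atTop 0).mono fun y hy => ?_)
  have hy' : (0 : ℝ) < y⁻¹ := inv_pos.mpr hy
  simp only [Measure.restrict_restrict measurableSet_Ioi, Ioi_inter_Ioi, sup_of_le_left hy'.le]

/-- The discrepancy is constant, so it may be computed as `z = i/u → 0`. There `Sz = iu → i∞`
removes the first tail, and the tail of `h|S` tends to minus its period polynomial. -/
theorem polySlash_tailPoly_S (hh : HolDecay (h ∘ ofComplex))
    (hS : HolDecay ((h ∣[((w + 2 : ℕ) : ℤ)] ModularGroup.S) ∘ ofComplex))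
    (hSS : HolDecay (((h ∣[((w + 2 : ℕ) : ℤ)] ModularGroup.S) ∣[((w + 2 : ℕ) : ℤ)]
      ModularGroup.S) ∘ ofComplex)) (z : ℍ) :
    polySlash w (tailPoly w h (ModularGroup.S • z : ℍ)) ModularGroup.S =
      tailPoly w (h ∣[((w + 2 : ℕ) : ℤ)] ModularGroup.S) z +
        periodIntegral w (h ∣[((w + 2 : ℕ) : ℤ)] ModularGroup.S) := by
  rw [← sub_eq_iff_eq_add']
  refine eq_of_eval_eq_of_eval_ne_zero (polyDenom_ne_zero ModularGroup.S) fun x hx => ?_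
  set P := polySlash w (tailPoly w h (ModularGroup.S • z : ℍ)) ModularGroup.S -
    tailPoly w (h ∣[((w + 2 : ℕ) : ℤ)] ModularGroup.S) z with hP
  have hconst : ∀ u : ℝ, 0 < u → P.eval x = x ^ w *
      (tailPoly w h (0 + u * Complex.I)).eval (-1 / x) -
      (tailPoly w (h ∣[((w + 2 : ℕ) : ℤ)] ModularGroup.S) (Complex.I * (u⁻¹ : ℝ))).eval x := by
    intro u hu
    have him := im_I_mul (inv_pos.mpr hu)
    rw [hP, polySlash_tailPoly_sub_eq hh _ hS z ⟨_, him⟩, eval_sub,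
      eval_polySlash (natDegree_tailPoly_le _ _ _) hx, eval_polyDenom_S, eval_polyNum_S]
    have : ((ModularGroup.S • (⟨Complex.I * (u⁻¹ : ℝ), him⟩ : ℍ) : ℍ) : ℂ) =
        0 + u * Complex.I := by
      rw [S_smul_coe]
      change -(Complex.I * (u⁻¹ : ℝ))⁻¹ = _
      simp [mul_comm]
    rw [this]
  have hlim := ((tendsto_eval_tailPoly (w := w) hh (-1 / x) 0).const_mul (x ^ w)).sub
    (tendsto_eval_tailPoly_zero (w := w) hS hSS x)
  rw [mul_zero, zero_sub, neg_neg] at hlim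
  refine tendsto_nhds_unique (tendsto_const_nhds (x := P.eval x) (f := (atTop : Filter ℝ))) ?_
  exact hlim.congr' ((eventually_gt_atTop 0).mono fun u hu => (hconst u hu).symm)

end tailPoly

end Haberland

/-! ### Period relations and the algebra of the modified pairing. -/

namespace Haberland

open Filter Topology Set Polynomial ModularGroup

variable {Γ : Subgroup SL(2, ℤ)} {w : ℕ} {h : Cosets Γ → ℍ → ℂ}

/-- The family of polynomials `∫_{i∞}^z h_A(t) (t - X)^w dt`. -/
noncomputable def tailFam (w : ℕ) (h : Cosets Γ → ℍ → ℂ) (z : ℂ) : Cosets Γ → ℂ[X] :=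
  fun A => tailPoly w (h A) z

/-- The family of period polynomials of a family of functions. -/
noncomputable def periodFam (w : ℕ) (h : Cosets Γ → ℍ → ℂ) : Cosets Γ → ℂ[X] :=
  fun A => periodIntegral w (h A)

/-- Apply a ring homomorphism to the coefficients of every `P(A)`. -/
noncomputable def mapCoeff (τ : ℂ →+* ℂ) (P : Cosets Γ → ℂ[X]) : Cosets Γ → ℂ[X] :=
  fun A => (P A).map τ

theorem mapCoeff_indSlash (τ : ℂ →+* ℂ) (w : ℕ) (P : Cosets Γ → ℂ[X]) (g : SL(2, ℤ)) :
    mapCoeff τ (indSlash w P g) = indSlash w (mapCoeff τ P) g :=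
  funext fun _ => map_polySlash _ _ _ _

theorem mapCoeff_add (τ : ℂ →+* ℂ) (P Q : Cosets Γ → ℂ[X]) :
    mapCoeff τ (P + Q) = mapCoeff τ P + mapCoeff τ Q :=
  funext fun _ => Polynomial.map_add _

theorem mapCoeff_neg (τ : ℂ →+* ℂ) (P : Cosets Γ → ℂ[X]) : mapCoeff τ (-P) = -mapCoeff τ P :=
  funext fun _ => Polynomial.map_neg _

theorem natDegree_mapCoeff_le {P : Cosets Γ → ℂ[X]} (hP : ∀ A, (P A).natDegree ≤ w)
    (τ : ℂ →+* ℂ) (A : Cosets Γ) : (mapCoeff τ P A).natDegree ≤ w :=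
  natDegree_map_le.trans (hP A)

theorem natDegree_tailFam_le (w : ℕ) (h : Cosets Γ → ℍ → ℂ) (z : ℂ) (A : Cosets Γ) :
    (tailFam w h z A).natDegree ≤ w := natDegree_tailPoly_le _ _ _

theorem natDegree_periodFam_le (w : ℕ) (h : Cosets Γ → ℍ → ℂ) (A : Cosets Γ) :
    (periodFam w h A).natDegree ≤ w := natDegree_periodIntegral_le _ _

theorem IsCuspFamily.slash_inv {k : ℕ} (hh : IsCuspFamily k h) (A : Cosets Γ) (g : SL(2, ℤ)) :
    h (cosetMul A g⁻¹) ∣[(k : ℤ)] g = h A := by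
  rw [← hh.slash, cosetMul_mul, inv_mul_cancel, cosetMul_one]

theorem IsCuspFamily.tailFam_of_translation (hh : IsCuspFamily (w + 2) h) (g : SL(2, ℤ)) {r : ℂ}
    (hr : ∀ z : ℍ, ((g • z : ℍ) : ℂ) = z + r) (z : ℍ) :
    indSlash w (tailFam w h (g • z : ℍ)) g = tailFam w h z := by
  funext A
  have hA : HolDecay ((h (cosetMul A g⁻¹) ∣[((w + 2 : ℕ) : ℤ)] g) ∘ ofComplex) := by
    rw [hh.slash_inv]
    exact hh.holDecay A
  have := polySlash_tailPoly_of_translation (w := w) (hh.holDecay (cosetMul A g⁻¹)) g hA hr z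
  rw [hh.slash_inv] at this
  exact this

theorem IsCuspFamily.tailFam_T (hh : IsCuspFamily (w + 2) h) (z : ℍ) :
    indSlash w (tailFam w h (T • z : ℍ)) T = tailFam w h z :=
  hh.tailFam_of_translation T (r := 1) (fun z => by
    rw [modular_T_smul, coe_vadd, add_comm, Complex.ofReal_one]) z

theorem IsCuspFamily.tailFam_neg_one (hh : IsCuspFamily (w + 2) h) (z : ℍ) :
    indSlash w (tailFam w h z) (-1) = tailFam w h z := by
  have := hh.tailFam_of_translation (-1) (r := 0) (fun z => by simp) z
  simpa using this

theorem IsCuspFamily.tailFam_S (hh : IsCuspFamily (w + 2) h) (z : ℍ) :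
    indSlash w (tailFam w h (S • z : ℍ)) S = tailFam w h z + periodFam w h := by
  funext A
  have hA : h (cosetMul A S⁻¹) ∣[((w + 2 : ℕ) : ℤ)] S = h A := hh.slash_inv A S
  have := polySlash_tailPoly_S (w := w) (hh.holDecay (cosetMul A S⁻¹))
    (by rw [hA]; exact hh.holDecay A)
    (by rw [hA, ← hh.slash]; exact hh.holDecay _) z
  rw [hA] at this
  exact this

theorem S_mul_S : S * S = -1 := by decide

/-- The element `TS`, of order three modulo `±1`. -/
def U : SL(2, ℤ) := T * S

theorem U_mul_U_mul_U : U * U * U = -1 := by decide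

theorem IsCuspFamily.periodFam_neg_one (hh : IsCuspFamily (w + 2) h) :
    indSlash w (periodFam w h) (-1) = periodFam w h := by
  have hS := hh.tailFam_S I
  rw [← sub_eq_iff_eq_add'] at hS
  rw [← hS, indSlash_sub, indSlash_indSlash (natDegree_tailFam_le w h _), hh.tailFam_neg_one,
    mul_neg_one, ← neg_one_mul, ← indSlash_indSlash (natDegree_tailFam_le w h _),
    hh.tailFam_neg_one]

/-- Apply the `S` cocycle relation at `S • I` and again at `I`. As `S² = -1` acts trivially on
tails, the two period terms must cancel. -/
theorem IsCuspFamily.periodFam_S (hh : IsCuspFamily (w + 2) h) :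
    indSlash w (periodFam w h) S = -periodFam w h := by
  have h1 := congrArg (fun P => indSlash w P S) (hh.tailFam_S (S • I))
  simp only [indSlash_add, hh.tailFam_S I] at h1
  rw [indSlash_indSlash (natDegree_tailFam_le w h _), ← mul_smul, S_mul_S,
    ModularGroup.SL_neg_smul, one_smul, hh.tailFam_neg_one, add_assoc, left_eq_add,
    add_comm] at h1
  exact eq_neg_of_add_eq_zero_left h1

theorem IsCuspFamily.tailFam_U (hh : IsCuspFamily (w + 2) h) (z : ℍ) :
    indSlash w (tailFam w h (U • z : ℍ)) U = tailFam w h z + periodFam w h := by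
  rw [U, ← indSlash_indSlash (natDegree_tailFam_le w h _), mul_smul, hh.tailFam_T, hh.tailFam_S]

/-- Three applications of the `U` cocycle relation return to the starting tail, since `U³ = -1`; the
accumulated period terms sum to zero. -/
theorem IsCuspFamily.periodFam_U (hh : IsCuspFamily (w + 2) h) :
    periodFam w h + indSlash w (periodFam w h) U + indSlash w (periodFam w h) (U * U) = 0 := by
  have h1 := hh.tailFam_U (U • U • I)
  have h2 := congrArg (fun P => indSlash w P U) h1
  simp only [indSlash_add, hh.tailFam_U (U • I)] at h2
  have h3 := congrArg (fun P => indSlash w P U) h2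
  simp only [indSlash_add, hh.tailFam_U I] at h3
  rw [indSlash_indSlash (natDegree_indSlash_le _ _ _), indSlash_indSlash (natDegree_tailFam_le w h _),
    indSlash_indSlash (natDegree_periodFam_le w h), ← mul_smul, ← mul_smul, ← mul_assoc,
    U_mul_U_mul_U, ModularGroup.SL_neg_smul, one_smul, hh.tailFam_neg_one, add_assoc, add_assoc,
    left_eq_add] at h3
  rw [add_assoc]
  exact h3

theorem indPairing_slash_left {P Q : Cosets Γ → ℂ[X]} (hP : ∀ A, (P A).natDegree ≤ w)
    (hQ : ∀ A, (Q A).natDegree ≤ w) (g : SL(2, ℤ)) :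
    indPairing w (indSlash w P g) Q = indPairing w P (indSlash w Q g⁻¹) := by
  rw [← indPairing_slash (natDegree_indSlash_le w P g) hQ g⁻¹, indSlash_indSlash hP,
    mul_inv_cancel, indSlash_one hP]

theorem indSlash_T_inv {P : Cosets Γ → ℂ[X]} (hP : ∀ A, (P A).natDegree ≤ w) (hPneg : indSlash w P (-1) = P)
    (hPS : indSlash w P S = -P) : indSlash w P T⁻¹ = -indSlash w P (U * U) := by
  have : T⁻¹ = S * (-1 * (U * U)) := by decide
  rw [this, ← indSlash_indSlash hP, hPS, indSlash_neg, ← indSlash_indSlash hP, hPneg]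

section algebra

variable [Γ.FiniteIndex] {P Z : Cosets Γ → ℂ[X]}

/-- The pairing with a coboundary `Z|U - Z`, for `P` in the space of period polynomials. -/
theorem modPairing_coboundary (hP : ∀ A, (P A).natDegree ≤ w) (hZ : ∀ A, (Z A).natDegree ≤ w)
    (hPneg : indSlash w P (-1) = P) (hPS : indSlash w P S = -P)
    (hPU : P + indSlash w P U + indSlash w P (U * U) = 0)
    (hZS : indSlash w (indSlash w Z U - Z) S = -(indSlash w Z U - Z)) :
    modPairing w P (indSlash w Z U - Z) = 3 * indPairing w (indSlash w P U) Z := by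
  have hZU := natDegree_indSlash_le w Z U
  have hd : ∀ A, ((indSlash w Z U - Z) A).natDegree ≤ w := fun A =>
    (natDegree_sub_le _ _).trans (max_le (hZU A) (hZ A))
  have hT : indSlash w P T = indSlash w (indSlash w P U) S⁻¹ := by
    rw [indSlash_indSlash hP, U, mul_inv_cancel_right]
  have e0 : indPairing w P Z + indPairing w (indSlash w P U) Z +
      indPairing w (indSlash w P (U * U)) Z = 0 := by
    rw [← indPairing_add_left, ← indPairing_add_left, hPU]
    simp [indPairing, polyPairing]
  have e1 : indPairing w (indSlash w P U) (indSlash w Z U) = indPairing w P Z :=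
    indPairing_slash hP hZ U
  have e2 : indPairing w (indSlash w P (U * U)) (indSlash w Z U) =
      indPairing w (indSlash w P U) Z := by
    rw [← indSlash_indSlash hP, indPairing_slash (natDegree_indSlash_le _ _ _) hZ U]
  -- With `D = Z|U - Z`, moving `S` across gives `⟪P|T, D⟫ = -⟪P|U, D⟫`, while `⟪P|T⁻¹, D⟫ = -⟪P|U²,
  -- D⟫`. Invariance under `U` reduces the difference to `2⟪P|U, Z⟫ - ⟪P, Z⟫ - ⟪P|U², Z⟫`, and the
  -- three-term relation makes this `3⟪P|U, Z⟫`.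
  rw [modPairing, indPairing_sub_left, hT, indSlash_T_inv hP hPneg hPS,
    indPairing_slash_left (natDegree_indSlash_le _ _ _) hd, inv_inv, hZS, indPairing_neg_right,
    indPairing_neg_left, indPairing_sub_right, indPairing_sub_right, e1, e2]
  linear_combination -e0

/-- Evaluates the endpoint difference of the arc, whose ends `ζ` and `ζ - 1` differ by `T`: moving
`T` to the left produces `P|T⁻¹ = -P|U²`, and the three-term relation does the rest. -/
theorem indPairing_sub_T (hP : ∀ A, (P A).natDegree ≤ w) (hZ : ∀ A, (Z A).natDegree ≤ w)
    (hPneg : indSlash w P (-1) = P) (hPS : indSlash w P S = -P)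
    (hPU : P + indSlash w P U + indSlash w P (U * U) = 0) :
    indPairing w P Z - indPairing w P (indSlash w Z T) = -indPairing w (indSlash w P U) Z := by
  have e0 : indPairing w P Z + indPairing w (indSlash w P U) Z +
      indPairing w (indSlash w P (U * U)) Z = 0 := by
    rw [← indPairing_add_left, ← indPairing_add_left, hPU]
    simp [indPairing, polyPairing]
  have := indPairing_slash_left hP hZ T⁻¹
  rw [inv_inv, indSlash_T_inv hP hPneg hPS, indPairing_neg_left] at this
  rw [← this]
  linear_combination e0

end algebra

end Haberland

/-! ### The Eichler form along the unit arc. -/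

namespace Haberland

open Filter Topology Set Polynomial ModularGroup

section wirtinger

/-- An `ℝ`-algebra endomorphism of `ℂ` as a continuous `ℝ`-linear map. -/
noncomputable def endCLM (τ : ℂ →ₐ[ℝ] ℂ) : ℂ →L[ℝ] ℂ := τ.toLinearMap.toContinuousLinearMap

@[simp] theorem endCLM_apply (τ : ℂ →ₐ[ℝ] ℂ) (z : ℂ) : endCLM τ z = τ z := rfl

theorem continuous_end (τ : ℂ →ₐ[ℝ] ℂ) : Continuous τ := (endCLM τ).continuous

/-- `F` has real derivative of the form `v ↦ p v + q τ(v)` at `z`. -/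
def HasWDerivAt (τ : ℂ →ₐ[ℝ] ℂ) (F : ℂ → ℂ) (p z : ℂ) : Prop :=
  ∃ q : ℂ, HasFDerivAt F (p • ContinuousLinearMap.id ℝ ℂ + q • endCLM τ) z

namespace HasWDerivAt

variable {τ : ℂ →ₐ[ℝ] ℂ} {F G : ℂ → ℂ} {p p' z : ℂ}

theorem of_hasDerivAt (τ : ℂ →ₐ[ℝ] ℂ) (h : HasDerivAt F p z) : HasWDerivAt τ F p z :=
  ⟨0, by
    refine (h.hasFDerivAt.restrictScalars ℝ).congr_fderiv ?_
    ext
    simp [mul_comm]⟩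

theorem comp_of_hasDerivAt (τ : ℂ →ₐ[ℝ] ℂ) (h : HasDerivAt F p z) :
    HasWDerivAt τ (fun z => τ (F z)) 0 z :=
  ⟨τ p, by
    refine ((endCLM τ).hasFDerivAt.comp z (h.hasFDerivAt.restrictScalars ℝ)).congr_fderiv ?_
    ext
    simp [mul_comm]⟩

theorem mul (hF : HasWDerivAt τ F p z) (hG : HasWDerivAt τ G p' z) :
    HasWDerivAt τ (fun z => F z * G z) (p * G z + F z * p') z := by
  obtain ⟨q, hq⟩ := hF
  obtain ⟨q', hq'⟩ := hG
  refine ⟨q * G z + F z * q', (hq.mul hq').congr_fderiv ?_⟩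
  ext
  simp
  ring

theorem sum {ι : Type*} {s : Finset ι} {F : ι → ℂ → ℂ} {p : ι → ℂ}
    (h : ∀ i ∈ s, HasWDerivAt τ (F i) (p i) z) :
    HasWDerivAt τ (fun z => ∑ i ∈ s, F i z) (∑ i ∈ s, p i) z := by
  choose! q hq using h
  refine ⟨∑ i ∈ s, q i, (HasFDerivAt.fun_sum hq).congr_fderiv ?_⟩
  ext
  simp [Finset.sum_add_distrib, Finset.sum_mul]

theorem continuousAt (hF : HasWDerivAt τ F p z) : ContinuousAt F z := hF.choose_spec.continuousAt

end HasWDerivAt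

end wirtinger

variable {Γ : Subgroup SL(2, ℤ)} {w : ℕ} {f g : Cosets Γ → ℍ → ℂ}

/-- The sum over `A` of `(∫_{i∞}^z f_A(t) (t - τ(z))^w dt) τ(g_A(z))`. -/
noncomputable def tailSum (τ : ℂ →ₐ[ℝ] ℂ) (w : ℕ) (f g : Cosets Γ → ℍ → ℂ) (z : ℂ) : ℂ :=
  ∑ᶠ A, (tailPoly w (f A) z).eval (τ z) * τ (g A (ofComplex z))

/-- The powers of `τ z` and the factor `τ(g_A(z))` have no `dz` part. Only the coefficients of the
tail polynomial contribute, and evaluation at `τ z` turns `(z - X)^w` into `(z - τ z)^w`. -/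
theorem hasWDerivAt_tailSum [Fintype (Cosets Γ)] (τ : ℂ →ₐ[ℝ] ℂ) (hf : IsCuspFamily (w + 2) f)
    (hg : IsCuspFamily (w + 2) g) {z : ℂ} (hz : 0 < z.im) :
    HasWDerivAt τ (tailSum τ w f g)
      (∑ A, f A (ofComplex z) * (z - τ z) ^ w * τ (g A (ofComplex z))) z := by
  have hsum : tailSum τ w f g =
      fun z => ∑ A, (tailPoly w (f A) z).eval (τ z) * τ (g A (ofComplex z)) :=
    funext fun z => finsum_eq_sum_of_fintype _
  rw [hsum]
  refine HasWDerivAt.sum fun A _ => ?_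
  have h1 : HasWDerivAt τ (fun z => (tailPoly w (f A) z).eval (τ z))
      (f A (ofComplex z) * (z - τ z) ^ w) z := by
    simp only [eval_tailPoly, eval_pow_eq_sum, Finset.mul_sum]
    refine HasWDerivAt.sum fun n hn => ?_
    have hc := HasWDerivAt.of_hasDerivAt τ (hasDerivAt_coeff_tailPoly (hf.holDecay A)
      (Nat.lt_succ_iff.mp (Finset.mem_range.mp hn)) hz)
    have hp := HasWDerivAt.comp_of_hasDerivAt τ (hasDerivAt_pow n z)
    have := hc.mul hp
    simp only [map_pow, mul_zero, add_zero] at this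
    rwa [← mul_assoc]
  have h2 := h1.mul (HasWDerivAt.comp_of_hasDerivAt τ
    (((hg.holDecay A).differentiableAt hz).hasDerivAt))
  simpa using h2

section arc

/-- The unit circle in the upper half plane, parametrized by the real part. -/
noncomputable def arc (x : ℝ) : ℂ := x + √(1 - x ^ 2) * Complex.I

/-- The derivative of `arc`. -/
noncomputable def arcDeriv (x : ℝ) : ℂ := -Complex.I * arc x / √(1 - x ^ 2)

@[simp] theorem arc_re (x : ℝ) : (arc x).re = x := by simp [arc]

@[simp] theorem arc_im (x : ℝ) : (arc x).im = √(1 - x ^ 2) := by simp [arc]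

variable {x : ℝ}

theorem arc_sqrt_pos (hx : x ∈ Ioo (-1 : ℝ) 1) : 0 < √(1 - x ^ 2) :=
  Real.sqrt_pos.mpr (by nlinarith [hx.1, hx.2])

theorem arc_im_pos (hx : x ∈ Ioo (-1 : ℝ) 1) : 0 < (arc x).im := by
  rw [arc_im]
  exact arc_sqrt_pos hx

theorem hasDerivAt_sqrt_arc (hx : x ∈ Ioo (-1 : ℝ) 1) :
    HasDerivAt (fun x : ℝ => √(1 - x ^ 2)) (-x / √(1 - x ^ 2)) x := by
  have hpos : (0 : ℝ) < 1 - x ^ 2 := by nlinarith [hx.1, hx.2]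
  have h1 : HasDerivAt (fun x : ℝ => 1 - x ^ 2) (-(2 * x)) x := by
    simpa using (hasDerivAt_pow 2 x).const_sub 1
  convert! h1.sqrt hpos.ne' using 1
  field_simp

theorem arcDeriv_eq (hx : x ∈ Ioo (-1 : ℝ) 1) :
    arcDeriv x = 1 + ((-x / √(1 - x ^ 2) : ℝ) : ℂ) * Complex.I := by
  have hs : ((√(1 - x ^ 2) : ℝ) : ℂ) ≠ 0 := Complex.ofReal_ne_zero.mpr (arc_sqrt_pos hx).ne'
  rw [arcDeriv, arc]
  push_cast
  field_simp
  linear_combination (-(√(1 - x ^ 2) : ℝ) : ℂ) * Complex.I_sq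

theorem hasDerivAt_arc (hx : x ∈ Ioo (-1 : ℝ) 1) : HasDerivAt arc (arcDeriv x) x := by
  rw [arcDeriv_eq hx]
  exact ((hasDerivAt_id x).ofReal_comp).add ((hasDerivAt_sqrt_arc hx).ofReal_comp.mul_const _)

theorem arc_mul_arc_neg (hx : x ∈ Ioo (-1 : ℝ) 1) : arc x * arc (-x) = -1 := by
  have hpos : (0 : ℝ) ≤ 1 - x ^ 2 := by nlinarith [hx.1, hx.2]
  have hs : ((√(1 - x ^ 2) : ℝ) : ℂ) ^ 2 = 1 - x ^ 2 := by
    rw [← Complex.ofReal_pow, Real.sq_sqrt hpos]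
    push_cast
    rfl
  simp only [arc, neg_sq, Complex.ofReal_neg]
  linear_combination Complex.I ^ 2 * hs + (1 - (x : ℂ) ^ 2) * Complex.I_sq

theorem neg_mem_arc (hx : x ∈ Ioo (-1 : ℝ) 1) : -x ∈ Ioo (-1 : ℝ) 1 :=
  ⟨by linarith [hx.2], by linarith [hx.1]⟩

theorem half_mem {x : ℝ} (hx : x ∈ uIcc (-(1 / 2) : ℝ) (1 / 2)) : x ∈ Ioo (-1 : ℝ) 1 := by
  rw [uIcc_of_le (by norm_num)] at hx
  exact ⟨by linarith [hx.1], by linarith [hx.2]⟩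

theorem continuousOn_arc : ContinuousOn arc (uIcc (-(1 / 2) : ℝ) (1 / 2)) := fun _ hx =>
  (hasDerivAt_arc (half_mem hx)).continuousAt.continuousWithinAt

theorem continuousOn_arcDeriv : ContinuousOn arcDeriv (uIcc (-(1 / 2) : ℝ) (1 / 2)) := by
  refine ContinuousOn.div (continuousOn_const.mul continuousOn_arc) (by fun_prop) fun x hx => ?_
  exact Complex.ofReal_ne_zero.mpr (arc_sqrt_pos (half_mem hx)).ne'

theorem S_smul_arc (hx : x ∈ Ioo (-1 : ℝ) 1) :
    S • (⟨arc x, arc_im_pos hx⟩ : ℍ) = ⟨arc (-x), arc_im_pos (neg_mem_arc hx)⟩ := by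
  apply UpperHalfPlane.ext
  rw [S_smul_coe]
  change -(arc x)⁻¹ = arc (-x)
  have hne : arc x ≠ 0 := fun h => by simpa [h] using arc_im_pos hx
  field_simp
  linear_combination -(arc_mul_arc_neg hx)

theorem arcDeriv_neg (hx : x ∈ Ioo (-1 : ℝ) 1) :
    arcDeriv (-x) * arc x ^ 2 = -arcDeriv x := by
  simp only [arcDeriv, neg_sq]
  linear_combination (-Complex.I * arc x / √(1 - x ^ 2)) * arc_mul_arc_neg hx

end arc

theorem continuousAt_tailSum [Finite (Cosets Γ)] (τ : ℂ →ₐ[ℝ] ℂ)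
    (hf : IsCuspFamily (w + 2) f) (hg : IsCuspFamily (w + 2) g) {z : ℂ} (hz : 0 < z.im) :
    ContinuousAt (tailSum τ w f g) z := by
  cases nonempty_fintype (Cosets Γ)
  exact (hasWDerivAt_tailSum τ hf hg hz).continuousAt

/-- `S` sends `arc x` to `arc (-x)`. After reindexing the cosets by `S⁻¹`, the weight factors of
`f`, `g` and the differential cancel, and the period term in the `S` rule for tails is the only
defect of invariance. -/
theorem tailSum_flip [Finite (Cosets Γ)] (τ : ℂ →ₐ[ℝ] ℂ)
    (hf : IsCuspFamily (w + 2) f) (hg : IsCuspFamily (w + 2) g) {x : ℝ}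
    (hx : x ∈ Ioo (-1 : ℝ) 1) :
    tailSum τ w f g (arc (-x)) * τ (arcDeriv (-x)) =
      -(tailSum τ w f g (arc x) * τ (arcDeriv x) +
        ∑ᶠ A, (periodFam w f A).eval (τ (arc x)) * τ (g A (ofComplex (arc x)) * arcDeriv x)) := by
  cases nonempty_fintype (Cosets Γ)
  set z : ℍ := ⟨arc x, arc_im_pos hx⟩ with hz
  have hzc : (z : ℂ) = arc x := rfl
  have hne : arc x ≠ 0 := fun h => by simpa [h] using arc_im_pos hx
  have hτne : τ (arc x) ≠ 0 := by simpa using hne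
  have hSz := S_smul_arc hx
  have hSz' : ((S • z : ℍ) : ℂ) = arc (-x) := by rw [hz, hSz]
  have hinv : arc (-x) = -1 / arc x := by
    rw [eq_div_iff hne, mul_comm]
    exact arc_mul_arc_neg hx
  simp only [tailSum, finsum_eq_sum_of_fintype]
  rw [← (cosetMulEquiv Γ S⁻¹).sum_comp, Finset.sum_mul, Finset.sum_mul, ← Finset.sum_add_distrib,
    ← Finset.sum_neg_distrib]
  refine Finset.sum_congr rfl fun A _ => ?_
  change (tailPoly w (f (cosetMul A S⁻¹)) (arc (-x))).eval (τ (arc (-x))) *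
    τ (g (cosetMul A S⁻¹) (ofComplex (arc (-x)))) * _ = _
  have h1 := congrFun (hf.tailFam_S z) A
  have h2 := congrArg (eval (τ (arc x))) h1
  rw [indSlash, eval_polySlash (natDegree_tailFam_le _ _ _ _) (by rwa [eval_polyDenom_S]),
    eval_polyDenom_S, eval_polyNum_S, Pi.add_apply, eval_add, hSz', hzc] at h2
  have h3 : (-1 : ℂ) / τ (arc x) = τ (arc (-x)) := by rw [hinv]; simp
  rw [h3] at h2
  simp only [tailFam] at h2
  have h4 := slash_apply_eval (g (cosetMul A S⁻¹)) (w + 2) S z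
  rw [hg.slash_inv, eval_polyDenom_S, hzc] at h4
  rw [ofComplex_apply_of_im_pos (arc_im_pos hx),
    ofComplex_apply_of_im_pos (arc_im_pos (neg_mem_arc hx)), ← hSz, ← hz, ← h4]
  have h5 := congrArg τ (arcDeriv_neg hx)
  simp only [map_mul, map_pow, map_neg] at h5 ⊢
  linear_combination (τ (g A z) * τ (arc x) ^ w *
    eval (τ (arc (-x))) (tailPoly w (f (cosetMul A S⁻¹)) (arc (-x)))) * h5 -
      (τ (g A z) * τ (arcDeriv x)) * h2

/-- Pairing `P` with the derivative of the tail, a multiple of `(s - X)^w` at `s = τ (arc x)`,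
evaluates `P` at `s`. So the defect in `tailSum_flip` is an exact derivative. -/
theorem hasDerivAt_polyPairing_tail (τ : ℂ →ₐ[ℝ] ℂ) (hg : IsCuspFamily (w + 2) g)
    {P : ℂ[X]} (hP : P.natDegree ≤ w) (A : Cosets Γ) {x : ℝ} (hx : x ∈ Ioo (-1 : ℝ) 1) :
    HasDerivAt (fun x => polyPairing w P (mapCoeff (τ : ℂ →+* ℂ) (tailFam w g (arc x)) A))
      (P.eval (τ (arc x)) * τ (g A (ofComplex (arc x)) * arcDeriv x)) x := by
  have h1 : P.eval (τ (arc x)) * τ (g A (ofComplex (arc x)) * arcDeriv x) =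
      polyPairing w P ((C (g A (ofComplex (arc x)) * arcDeriv x) *
        (C (arc x) - X) ^ w).map (τ : ℂ →+* ℂ)) := by
    rw [Polynomial.map_mul, map_C, polyPairing_C_mul_right, Polynomial.map_pow,
      Polynomial.map_sub, map_C, map_X, polyPairing_pow hP, mul_comm]
    rfl
  rw [h1]
  simp only [polyPairing, mapCoeff, coeff_map, tailFam]
  refine HasDerivAt.fun_sum fun n _ => HasDerivAt.const_mul _ ?_
  have h2 := (hasDerivAt_coeff_tailPoly (w := w) (n := w - n) (hg.holDecay A) (Nat.sub_le _ _)
    (arc_im_pos hx)).scomp x (hasDerivAt_arc hx)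
  have h3 := (endCLM τ).hasFDerivAt.comp_hasDerivAt x h2
  refine h3.congr_deriv ?_
  rw [endCLM_apply, coeff_C_mul]
  change τ _ = τ _
  congr 1
  rw [smul_eq_mul]
  ring

/-- The elliptic point `e^(iπ/3)`, fixed by `TS`. -/
noncomputable def zetaPt : ℍ := ⟨arc (1 / 2), arc_im_pos ⟨by norm_num, by norm_num⟩⟩

theorem zetaPt_sub_one : arc (-(1 / 2)) + 1 = (zetaPt : ℂ) := by
  change _ = arc (1 / 2)
  simp only [arc, neg_sq]
  push_cast
  ring

theorem S_smul_zetaPt : S • zetaPt = ⟨arc (-(1 / 2)), arc_im_pos ⟨by norm_num, by norm_num⟩⟩ :=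
  S_smul_arc ⟨by norm_num, by norm_num⟩

theorem T_smul_S_smul_zetaPt : T • S • zetaPt = zetaPt := by
  apply UpperHalfPlane.ext
  rw [S_smul_zetaPt, modular_T_smul, coe_vadd, ← zetaPt_sub_one, add_comm]
  simp

theorem U_smul_zetaPt : U • zetaPt = zetaPt := by rw [U, mul_smul, T_smul_S_smul_zetaPt]

variable [Γ.FiniteIndex]

theorem index_ne_zero : ((Γ.index : ℕ) : ℂ) ≠ 0 :=
  Nat.cast_ne_zero.mpr Subgroup.FiniteIndex.index_ne_zero

/-- The integral of the Eichler form over the arc in terms of period polynomials. -/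
theorem two_mul_integral_arc (τ : ℂ →ₐ[ℝ] ℂ)
    (hf : IsCuspFamily (w + 2) f) (hg : IsCuspFamily (w + 2) g) :
    2 * ∫ x in (-(1 / 2) : ℝ)..(1 / 2), tailSum τ w f g (arc x) * τ (arcDeriv x) =
      Γ.index * indPairing w (indSlash w (periodFam w f) U)
        (mapCoeff (τ : ℂ →+* ℂ) (tailFam w g zetaPt)) := by
  cases nonempty_fintype (Cosets Γ)
  set ω : ℝ → ℂ := fun x => tailSum τ w f g (arc x) * τ (arcDeriv x) with hω
  set L : ℝ → ℂ := fun x => ∑ A, polyPairing w (periodFam w f A)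
    (mapCoeff (τ : ℂ →+* ℂ) (tailFam w g (arc x)) A) with hL
  set L' : ℝ → ℂ := fun x => ∑ A, (periodFam w f A).eval (τ (arc x)) *
    τ (g A (ofComplex (arc x)) * arcDeriv x) with hL'
  have hLd : ∀ x ∈ uIcc (-(1 / 2) : ℝ) (1 / 2), HasDerivAt L (L' x) x := fun x hx =>
    HasDerivAt.fun_sum fun A _ =>
      hasDerivAt_polyPairing_tail τ hg (natDegree_periodFam_le w f A) A (half_mem hx)
  have hωc : ContinuousOn ω (uIcc (-(1 / 2) : ℝ) (1 / 2)) := by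
    refine ContinuousOn.mul (fun x hx => ?_) ((continuous_end τ).comp_continuousOn
      continuousOn_arcDeriv)
    exact ((continuousAt_tailSum τ hf hg (arc_im_pos (half_mem hx))).comp
      (hasDerivAt_arc (half_mem hx)).continuousAt).continuousWithinAt
  have hL'c : ContinuousOn L' (uIcc (-(1 / 2) : ℝ) (1 / 2)) := by
    refine continuousOn_finsetSum _ fun A _ => ContinuousOn.mul ?_ ?_
    · exact (Polynomial.continuous _).comp_continuousOn
        ((continuous_end τ).comp_continuousOn continuousOn_arc)
    · refine (continuous_end τ).comp_continuousOn (ContinuousOn.mul ?_ continuousOn_arcDeriv)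
      exact (hg.holDecay A).diff.continuousOn.comp continuousOn_arc fun x hx =>
        arc_im_pos (half_mem hx)
  have hflip : ∀ x ∈ uIcc (-(1 / 2) : ℝ) (1 / 2), ω (-x) = -(ω x + L' x) := fun x hx => by
    have := tailSum_flip τ hf hg (half_mem hx)
    rwa [finsum_eq_sum_of_fintype] at this
  -- The interval is symmetric, so together with `hflip` this gives `2 ∫ ω = -∫ L' = L(-1/2) -
  -- L(1/2)`.
  have hsymm : ∫ x in (-(1 / 2) : ℝ)..(1 / 2), ω (-x) = ∫ x in (-(1 / 2) : ℝ)..(1 / 2), ω x := by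
    rw [intervalIntegral.integral_comp_neg, neg_neg]
  have hFTC := intervalIntegral.integral_eq_sub_of_hasDerivAt hLd hL'c.intervalIntegrable
  rw [intervalIntegral.integral_congr hflip, intervalIntegral.integral_neg,
    intervalIntegral.integral_add hωc.intervalIntegrable hL'c.intervalIntegrable, hFTC] at hsymm
  have hpair : ∀ z : ℂ, ∑ A, polyPairing w (periodFam w f A)
      (mapCoeff (τ : ℂ →+* ℂ) (tailFam w g z) A) = Γ.index * indPairing w (periodFam w f)
        (mapCoeff (τ : ℂ →+* ℂ) (tailFam w g z)) := fun z => by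
    rw [indPairing, finsum_eq_sum_of_fintype, mul_inv_cancel_left₀ index_ne_zero]
  have hL1 : L (1 / 2) = Γ.index * indPairing w (periodFam w f)
        (mapCoeff (τ : ℂ →+* ℂ) (tailFam w g zetaPt)) := hpair _
  have hL2 : L (-(1 / 2)) = Γ.index * indPairing w (periodFam w f)
        (indSlash w (mapCoeff (τ : ℂ →+* ℂ) (tailFam w g zetaPt)) T) := by
    have := hg.tailFam_T (S • zetaPt)
    rw [T_smul_S_smul_zetaPt] at this
    rw [← mapCoeff_indSlash, this, S_smul_zetaPt]
    exact hpair _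
  have hkey := indPairing_sub_T (natDegree_periodFam_le w f)
    (natDegree_mapCoeff_le (natDegree_tailFam_le w g zetaPt) (τ : ℂ →+* ℂ))
    hf.periodFam_neg_one hf.periodFam_S hf.periodFam_U
  rw [hL1, hL2] at hsymm
  linear_combination -hsymm - (Γ.index : ℂ) * hkey

/-- The modified pairing of period polynomials as an integral over the arc. -/
theorem modPairing_periodFam (τ : ℂ →ₐ[ℝ] ℂ)
    (hf : IsCuspFamily (w + 2) f) (hg : IsCuspFamily (w + 2) g) :
    Γ.index * modPairing w (periodFam w f) (mapCoeff (τ : ℂ →+* ℂ) (periodFam w g)) =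
      6 * ∫ x in (-(1 / 2) : ℝ)..(1 / 2), tailSum τ w f g (arc x) * τ (arcDeriv x) := by
  -- The `U` rule at the fixed point of `U` exhibits the period family as a coboundary; `τ` commutes
  -- with the action because the matrices are integral.
  have hZ : mapCoeff (τ : ℂ →+* ℂ) (periodFam w g) =
      indSlash w (mapCoeff (τ : ℂ →+* ℂ) (tailFam w g zetaPt)) U -
        mapCoeff (τ : ℂ →+* ℂ) (tailFam w g zetaPt) := by
    have := hg.tailFam_U zetaPt
    rw [U_smul_zetaPt] at this
    rw [← mapCoeff_indSlash, this, mapCoeff_add, add_sub_cancel_left]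
  have hS := congrArg (mapCoeff (τ : ℂ →+* ℂ)) hg.periodFam_S
  rw [mapCoeff_indSlash, mapCoeff_neg, hZ] at hS
  rw [hZ, modPairing_coboundary (natDegree_periodFam_le w f)
    (natDegree_mapCoeff_le (natDegree_tailFam_le w g zetaPt) _) hf.periodFam_neg_one
    hf.periodFam_S hf.periodFam_U hS]
  linear_combination -3 * two_mul_integral_arc τ hf hg

end Haberland

/-! ### Stokes' theorem on the standard fundamental domain. -/

namespace Haberland

open Filter Topology Set

/-- Complex conjugation as an `ℝ`-algebra endomorphism of `ℂ`. -/
noncomputable def conjAlg : ℂ →ₐ[ℝ] ℂ := Complex.conjAe.toAlgHom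

@[simp] theorem conjAlg_apply (z : ℂ) : conjAlg z = conj z := rfl

section stokes

variable {V p : ℂ → ℂ} {x : ℝ}

theorem differentiableAt_arcDeriv (hx : x ∈ Ioo (-1 : ℝ) 1) : DifferentiableAt ℝ arcDeriv x := by
  have h1 := (hasDerivAt_arc hx).differentiableAt
  have h2 := (hasDerivAt_sqrt_arc hx).ofReal_comp.differentiableAt
  exact (h1.const_mul (-Complex.I)).div h2
    (Complex.ofReal_ne_zero.mpr (arc_sqrt_pos hx).ne')

theorem arcDeriv_add_conj (hx : x ∈ Ioo (-1 : ℝ) 1) : arcDeriv x + conj (arcDeriv x) = 2 := by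
  rw [arcDeriv_eq hx]
  simp
  ring

theorem arc_add_im_pos (hx : x ∈ Ioo (-1 : ℝ) 1) {u : ℝ} (hu : 0 ≤ u) :
    0 < (arc x + u * Complex.I).im := by
  have := arc_im_pos hx
  simp only [Complex.add_im, Complex.mul_im, Complex.ofReal_re, Complex.I_im, mul_one,
    Complex.ofReal_im, Complex.I_re, mul_zero, add_zero]
  linarith

theorem hasFDerivAt_arc_add (hx : x ∈ Ioo (-1 : ℝ) 1) (u : ℝ) :
    HasFDerivAt (fun q : ℝ × ℝ => arc q.1 + q.2 * Complex.I)
      ((ContinuousLinearMap.fst ℝ ℝ ℝ).smulRight (arcDeriv x) +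
        (ContinuousLinearMap.snd ℝ ℝ ℝ).smulRight Complex.I) (x, u) := by
  have h1 := HasFDerivAt.comp (g := arc) (f := Prod.fst) (x, u) (hasDerivAt_arc hx).hasFDerivAt
    (hasFDerivAt_fst (𝕜 := ℝ))
  have h2 := (HasFDerivAt.comp (g := Complex.ofRealCLM) (f := Prod.snd) (x, u)
    Complex.ofRealCLM.hasFDerivAt (hasFDerivAt_snd (𝕜 := ℝ))).mul_const Complex.I
  refine (h1.add h2).congr_fderiv ?_
  ext <;> simp

theorem half_mem_Icc {x : ℝ} (hx : x ∈ Icc (-(1 / 2) : ℝ) (1 / 2)) : x ∈ Ioo (-1 : ℝ) 1 :=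
  ⟨by linarith [hx.1], by linarith [hx.2]⟩

theorem continuousOn_arc_add {S : Set (ℝ × ℝ)}
    (hS : S ⊆ Icc (-(1 / 2) : ℝ) (1 / 2) ×ˢ Ici 0) :
    ContinuousOn (fun q : ℝ × ℝ => arc q.1 + q.2 * Complex.I) S := fun q hq =>
  (hasFDerivAt_arc_add (half_mem_Icc (hS hq).1) q.2).continuousAt.continuousWithinAt

/-- Stokes for `V d(conj z)`, pulled back to a rectangle by `(x, u) ↦ arc x + iu`. The vertical
sides cancel by periodicity; the bottom is the arc and the top is the arc shifted up by `M`. -/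
theorem stokes_truncated (hV : ∀ z : ℂ, 0 < z.im → HasWDerivAt conjAlg V (p z) z)
    (hp : ContinuousOn p {z | 0 < z.im}) (hper : ∀ z : ℂ, 0 < z.im → V (z + 1) = V z)
    {M : ℝ} (hM : 0 ≤ M) :
    ∫ x in (-(1 / 2) : ℝ)..(1 / 2), ∫ u in (0 : ℝ)..M, 2 * p (arc x + u * Complex.I) =
      Complex.I * (∫ x in (-(1 / 2) : ℝ)..(1 / 2), V (arc x) * conj (arcDeriv x)) -
      Complex.I * ∫ x in (-(1 / 2) : ℝ)..(1 / 2), V (arc x + M * Complex.I) * conj (arcDeriv x) := by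
  choose! q hq using hV
  set m : ℝ × ℝ → ℂ := fun q => arc q.1 + q.2 * Complex.I with hm
  set m' : ℝ → (ℝ × ℝ →L[ℝ] ℂ) := fun x => (ContinuousLinearMap.fst ℝ ℝ ℝ).smulRight (arcDeriv x) +
        (ContinuousLinearMap.snd ℝ ℝ ℝ).smulRight Complex.I with hm'
  set V' : ℂ → (ℂ →L[ℝ] ℂ) := fun z => p z • ContinuousLinearMap.id ℝ ℂ + q z • endCLM conjAlg
  -- The pulled-back form is `V (conj(arcDeriv x) dx - i du)`. Divided by `-i`, its exterior
  -- derivative is the divergence of the field `(V, -cV)` up to the sign convention of the `dx`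
  -- term; with this `c` the field `(V, cV)` has divergence `p (arcDeriv x + conj(arcDeriv x)) =
  -- 2p`, all `q` terms cancelling.
  set c : ℝ × ℝ → ℂ := fun y => -Complex.I * conj (arcDeriv y.1) with hc
  have hcd : ∀ y : ℝ × ℝ, y.1 ∈ Ioo (-1 : ℝ) 1 → ∃ d : ℂ, HasFDerivAt c
      ((ContinuousLinearMap.fst ℝ ℝ ℝ).smulRight d) y := by
    intro y hy
    have h1 := ((endCLM conjAlg).hasFDerivAt.comp_hasDerivAt y.1
      (differentiableAt_arcDeriv hy).hasDerivAt).const_mul (-Complex.I)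
    have h2 := h1.hasFDerivAt.comp y hasFDerivAt_fst
    refine ⟨-Complex.I * endCLM conjAlg (deriv arcDeriv y.1), h2.congr_fderiv ?_⟩
    ext <;> simp
  choose! d hd using hcd
  have hrect : ∀ y ∈ uIcc (-(1 / 2) : ℝ) (1 / 2) ×ˢ uIcc 0 M,
      y.1 ∈ Ioo (-1 : ℝ) 1 ∧ 0 ≤ y.2 ∧ 0 < (m y).im := by
    intro y hy
    have h1 := half_mem hy.1
    have h2 : 0 ≤ y.2 := by
      have := hy.2
      rw [uIcc_of_le hM] at this
      exact this.1
    exact ⟨h1, h2, arc_add_im_pos h1 h2⟩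
  have hFd : ∀ y ∈ uIcc (-(1 / 2) : ℝ) (1 / 2) ×ˢ uIcc 0 M,
      HasFDerivAt (fun y => V (m y)) ((V' (m y)).comp (m' y.1)) y := fun y hy =>
    (hq (m y) (hrect y hy).2.2).comp y (hasFDerivAt_arc_add (hrect y hy).1 y.2)
  have hGd : ∀ y ∈ uIcc (-(1 / 2) : ℝ) (1 / 2) ×ˢ uIcc 0 M,
      HasFDerivAt (fun y => c y * V (m y)) (c y • (V' (m y)).comp (m' y.1) +
        V (m y) • (ContinuousLinearMap.fst ℝ ℝ ℝ).smulRight (d y)) y := fun y hy =>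
    (hd y (hrect y hy).1).mul (hFd y hy)
  have hsub : Ioo (min (-(1 / 2) : ℝ) (1 / 2)) (max (-(1 / 2) : ℝ) (1 / 2)) ×ˢ
      Ioo (min 0 M) (max 0 M) ⊆ uIcc (-(1 / 2) : ℝ) (1 / 2) ×ˢ uIcc 0 M :=
    prod_mono Ioo_subset_Icc_self Ioo_subset_Icc_self
  have hval : ∀ y ∈ uIcc (-(1 / 2) : ℝ) (1 / 2) ×ˢ uIcc 0 M,
      ((V' (m y)).comp (m' y.1)) (1, 0) + (c y • (V' (m y)).comp (m' y.1) +
        V (m y) • (ContinuousLinearMap.fst ℝ ℝ ℝ).smulRight (d y)) (0, 1) = 2 * p (m y) := by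
    intro y hy
    have h2 := arcDeriv_add_conj (hrect y hy).1
    simp [m', V', c]
    linear_combination p (m y) * h2 + (-p (m y) * conj (arcDeriv y.1) +
      q (m y) * conj (arcDeriv y.1)) * Complex.I_sq
  have hint : IntegrableOn (fun y => 2 * p (m y)) (uIcc (-(1 / 2) : ℝ) (1 / 2) ×ˢ uIcc 0 M) := by
    refine ContinuousOn.integrableOn_compact (isCompact_uIcc.prod isCompact_uIcc) ?_
    refine continuousOn_const.mul (hp.comp (fun y hy => ?_) fun y hy => (hrect y hy).2.2)
    exact (hasFDerivAt_arc_add (hrect y hy).1 y.2).continuousAt.continuousWithinAt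
  have main := integral2_divergence_prod_of_hasFDerivAt_off_countable
    (fun y => V (m y)) (fun y => c y * V (m y)) (fun y => (V' (m y)).comp (m' y.1))
    (fun y => c y • (V' (m y)).comp (m' y.1) +
      V (m y) • (ContinuousLinearMap.fst ℝ ℝ ℝ).smulRight (d y))
    (-(1 / 2)) 0 (1 / 2) M ∅ countable_empty
    (fun y hy => (hFd y hy).continuousAt.continuousWithinAt)
    (fun y hy => (hGd y hy).continuousAt.continuousWithinAt)
    (fun y hy => hFd y (hsub hy.1)) (fun y hy => hGd y (hsub hy.1))
    (hint.congr_fun (fun y hy => (hval y hy).symm) (measurableSet_uIcc.prod measurableSet_uIcc))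
  have hl : ∫ x in (-(1 / 2) : ℝ)..(1 / 2), ∫ u in (0 : ℝ)..M, 2 * p (arc x + u * Complex.I) =
      ∫ x in (-(1 / 2) : ℝ)..(1 / 2), ∫ u in (0 : ℝ)..M,
        (((V' (m (x, u))).comp (m' x)) (1, 0) + (c (x, u) • (V' (m (x, u))).comp (m' x) +
        V (m (x, u)) • (ContinuousLinearMap.fst ℝ ℝ ℝ).smulRight (d (x, u))) (0, 1)) :=
    intervalIntegral.integral_congr fun x hx => intervalIntegral.integral_congr fun u hu =>
      (hval (x, u) ⟨hx, hu⟩).symm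
  have hside : ∫ u in (0 : ℝ)..M, V (m (1 / 2, u)) = ∫ u in (0 : ℝ)..M, V (m (-(1 / 2), u)) := by
    refine intervalIntegral.integral_congr fun u hu => ?_
    have := hper (m (-(1 / 2), u)) (hrect (-(1 / 2), u) ⟨left_mem_uIcc, hu⟩).2.2
    rw [← this]
    congr 1
    change arc (1 / 2) + _ = arc (-(1 / 2)) + _ + 1
    rw [show arc (1 / 2) = arc (-(1 / 2)) + 1 from zetaPt_sub_one.symm]
    ring
  rw [hl, main, hside]
  simp only [hc, hm, mul_assoc, intervalIntegral.integral_const_mul, neg_mul,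
    intervalIntegral.integral_neg, Complex.ofReal_zero, zero_mul, add_zero]
  simp only [mul_comm (conj (arcDeriv _))]
  ring

/-- Let the height of the rectangle tend to infinity: uniform decay of `V` on the strip removes the
top edge. -/
theorem stokes_domain (hV : ∀ z : ℂ, 0 < z.im → HasWDerivAt conjAlg V (p z) z)
    (hp : ContinuousOn p {z | 0 < z.im}) (hper : ∀ z : ℂ, 0 < z.im → V (z + 1) = V z)
    (hVlim : ∀ ε > 0, ∃ M₀ : ℝ, ∀ z : ℂ, |z.re| ≤ 1 / 2 → M₀ ≤ z.im → ‖V z‖ ≤ ε)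
    (hpint : IntegrableOn (fun q : ℝ × ℝ => p (arc q.1 + q.2 * Complex.I))
      (Ioc (-(1 / 2) : ℝ) (1 / 2) ×ˢ Ioi 0)) :
    2 * ∫ q in Ioc (-(1 / 2) : ℝ) (1 / 2) ×ˢ Ioi (0 : ℝ), p (arc q.1 + q.2 * Complex.I) =
      Complex.I * ∫ x in (-(1 / 2) : ℝ)..(1 / 2), V (arc x) * conj (arcDeriv x) := by
  have h1 : Tendsto (fun n : ℕ => ∫ q in Ioc (-(1 / 2) : ℝ) (1 / 2) ×ˢ Ioc (0 : ℝ) n,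
      p (arc q.1 + q.2 * Complex.I)) atTop
      (𝓝 (∫ q in Ioc (-(1 / 2) : ℝ) (1 / 2) ×ˢ Ioi (0 : ℝ), p (arc q.1 + q.2 * Complex.I))) := by
    have hU : Ioc (-(1 / 2) : ℝ) (1 / 2) ×ˢ Ioi (0 : ℝ) =
        ⋃ n : ℕ, Ioc (-(1 / 2) : ℝ) (1 / 2) ×ˢ Ioc (0 : ℝ) n := by
      rw [← prod_iUnion]
      congr 1
      ext y
      simp only [mem_Ioi, mem_iUnion, mem_Ioc]
      refine ⟨fun hy => ?_, fun ⟨n, h⟩ => h.1⟩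
      obtain ⟨n, hn⟩ := exists_nat_ge y
      exact ⟨n, hy, hn⟩
    rw [hU] at hpint ⊢
    refine tendsto_setIntegral_of_monotone (fun n => measurableSet_Ioc.prod measurableSet_Ioc)
      (fun a b hab => prod_mono_right (Ioc_subset_Ioc_right (Nat.cast_le.mpr hab))) hpint
  have h2 : ∀ n : ℕ, 2 * ∫ q in Ioc (-(1 / 2) : ℝ) (1 / 2) ×ˢ Ioc (0 : ℝ) n,
      p (arc q.1 + q.2 * Complex.I) =
      Complex.I * (∫ x in (-(1 / 2) : ℝ)..(1 / 2), V (arc x) * conj (arcDeriv x)) -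
      Complex.I * ∫ x in (-(1 / 2) : ℝ)..(1 / 2),
        V (arc x + (n : ℝ) * Complex.I) * conj (arcDeriv x) := fun n => by
    rw [← stokes_truncated hV hp hper (Nat.cast_nonneg n), Measure.volume_eq_prod,
      setIntegral_prod _ (hpint.mono_set (prod_mono_right Ioc_subset_Ioi_self)),
      intervalIntegral.integral_of_le (by norm_num)]
    simp only [intervalIntegral.integral_of_le (Nat.cast_nonneg (α := ℝ) n), integral_const_mul]
  have h3 : Tendsto (fun n : ℕ => ∫ x in (-(1 / 2) : ℝ)..(1 / 2),
      V (arc x + (n : ℝ) * Complex.I) * conj (arcDeriv x)) atTop (𝓝 0) := by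
    obtain ⟨D, hD⟩ := isCompact_uIcc.exists_bound_of_continuousOn continuousOn_arcDeriv
    rw [Metric.tendsto_atTop]
    intro ε hε
    have hD0 : 0 ≤ D := (norm_nonneg _).trans (hD _ left_mem_uIcc)
    obtain ⟨M₀, hM₀⟩ := hVlim (ε / (2 * (D + 1))) (by positivity)
    obtain ⟨N, hN⟩ := exists_nat_ge M₀
    refine ⟨N, fun n hn => ?_⟩
    rw [dist_zero_right]
    have := intervalIntegral.norm_integral_le_of_norm_le_const (a := (-(1 / 2) : ℝ)) (b := 1 / 2)
      (f := fun x => V (arc x + (n : ℝ) * Complex.I) * conj (arcDeriv x))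
      (C := ε / (2 * (D + 1)) * D) fun x hx => ?_
    · refine this.trans_lt ?_
      norm_num
      rw [div_mul_eq_mul_div, div_lt_iff₀ (by positivity)]
      nlinarith
    · have hx' := uIoc_subset_uIcc hx
      rw [norm_mul, RCLike.norm_conj]
      refine mul_le_mul (hM₀ _ ?_ ?_) (hD x hx') (norm_nonneg _) (by positivity)
      · rw [uIcc_of_le (by norm_num)] at hx'
        simpa [abs_le] using hx'
      · have : 0 < √(1 - x ^ 2) := arc_sqrt_pos (half_mem hx')
        have hNn : (N : ℝ) ≤ n := Nat.cast_le.mpr hn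
        simp
        linarith
  have h4 := tendsto_nhds_unique (h1.const_mul 2)
    ((tendsto_const_nhds.sub (h3.const_mul Complex.I)).congr fun n => (h2 n).symm)
  simpa using h4

end stokes

end Haberland

/-! ### Arc coordinates on the fundamental domain, and integrability. -/

namespace Haberland

open Filter Topology Set
open scoped Modular NNReal

section coordinates

/-- The coordinates `(x, u) ↦ arc x + iu` as a map to the complex plane. -/
noncomputable def arcCoord (q : ℝ × ℝ) : ℂ := arc q.1 + q.2 * Complex.I

/-- The shear `(x, u) ↦ (x, √(1 - x²) + u)`. -/
noncomputable def arcShear : ℝ × ℝ ≃ᵐ ℝ × ℝ where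
  toFun q := (q.1, √(1 - q.1 ^ 2) + q.2)
  invFun q := (q.1, q.2 - √(1 - q.1 ^ 2))
  left_inv q := by simp
  right_inv q := by simp
  measurable_toFun := by
    change Measurable fun q : ℝ × ℝ => (q.1, √(1 - q.1 ^ 2) + q.2)
    fun_prop
  measurable_invFun := by
    change Measurable fun q : ℝ × ℝ => (q.1, q.2 - √(1 - q.1 ^ 2))
    fun_prop

theorem arcCoord_eq : arcCoord = Complex.measurableEquivRealProd.symm ∘ arcShear := by
  funext q
  apply Complex.ext <;> simp [arcCoord, arcShear]

theorem measurePreserving_arcShear : MeasurePreserving arcShear volume volume := by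
  refine (MeasurePreserving.id (volume : Measure ℝ)).skew_product
    (g := fun x u : ℝ => √(1 - x ^ 2) + u) ?_ ?_
  · change Measurable fun q : ℝ × ℝ => √(1 - q.1 ^ 2) + q.2
    fun_prop
  · exact ae_of_all _ fun x => map_add_left_eq_self volume _

theorem measurePreserving_arcCoord : MeasurePreserving arcCoord volume volume := by
  rw [arcCoord_eq]
  exact (Complex.volume_preserving_equiv_real_prod.symm _).comp measurePreserving_arcShear

theorem measurableEmbedding_arcCoord : MeasurableEmbedding arcCoord := by
  rw [arcCoord_eq]
  exact (MeasurableEquiv.measurableEmbedding _).comp arcShear.measurableEmbedding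

theorem arcCoord_preimage :
    arcCoord ⁻¹' ((↑) '' 𝒟ᵒ) = Ioo (-(1 / 2) : ℝ) (1 / 2) ×ˢ Ioi (0 : ℝ) := by
  rw [ModularGroup.coe_fdo]
  ext ⟨x, u⟩
  have hre : (arcCoord (x, u)).re = x := by simp [arcCoord]
  have him : (arcCoord (x, u)).im = √(1 - x ^ 2) + u := by simp [arcCoord]
  have hn : ‖arcCoord (x, u)‖ ^ 2 = x ^ 2 + (√(1 - x ^ 2) + u) ^ 2 := by
    rw [← Complex.normSq_eq_norm_sq, Complex.normSq_apply, hre, him]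
    ring
  simp only [mem_preimage, mem_ofPred_eq, mem_prod, mem_Ioo, mem_Ioi, hre, him, abs_lt]
  constructor
  · rintro ⟨h1, h2, h3⟩
    refine ⟨h3, ?_⟩
    have hs : √(1 - x ^ 2) ^ 2 = 1 - x ^ 2 := Real.sq_sqrt (by nlinarith [h3.1, h3.2])
    have h4 : 1 < ‖arcCoord (x, u)‖ ^ 2 := by nlinarith
    by_contra hu
    nlinarith [Real.sqrt_nonneg (1 - x ^ 2)]
  · rintro ⟨h3, hu⟩
    have hs : √(1 - x ^ 2) ^ 2 = 1 - x ^ 2 := Real.sq_sqrt (by nlinarith [h3.1, h3.2])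
    have hs0 := Real.sqrt_nonneg (1 - x ^ 2)
    refine ⟨by linarith, ?_, h3⟩
    have h4 : 1 < ‖arcCoord (x, u)‖ ^ 2 := by nlinarith
    by_contra h
    nlinarith [norm_nonneg (arcCoord (x, u))]

theorem measurable_density :
    Measurable fun z : ℍ => ((1 / NNReal.mk z.im z.im_pos.le : ℝ≥0) ^ 2) := by
  refine Continuous.measurable ?_
  refine .pow (.div₀ continuous_const ?_ ?_) _
  · exact continuous_im.subtype_mk _
  · exact fun x ↦ NNReal.ne_iff.mp x.im_ne_zero

theorem measurePreserving_coe : MeasurePreserving UpperHalfPlane.coe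
    (volume.comap UpperHalfPlane.coe) (volume.restrict (range UpperHalfPlane.coe)) :=
  ⟨measurable_coe, by rw [measurableEmbedding_coe.map_comap]⟩

theorem measurableSet_fdo : MeasurableSet 𝒟ᵒ := ModularGroup.isOpen_fdo.measurableSet

theorem arc_strip_ae : (Ioo (-(1 / 2) : ℝ) (1 / 2) ×ˢ Ioi (0 : ℝ) : Set (ℝ × ℝ)) =ᵐ[volume]
    (Ioc (-(1 / 2) : ℝ) (1 / 2) ×ˢ Ioi (0 : ℝ) : Set (ℝ × ℝ)) :=
  Measure.set_prod_ae_eq Ioo_ae_eq_Ioc (ae_eq_refl _)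

/-- The density `1/y²` written for a function on the plane. -/
theorem density_smul (G : ℂ → ℂ) (z : ℍ) :
    ((1 / NNReal.mk z.im z.im_pos.le : ℝ≥0) ^ 2) • G z =
      ((fun t : ℂ => ((1 / t.im ^ 2 : ℝ) : ℂ) * G t) ∘ UpperHalfPlane.coe) z := by
  rw [NNReal.smul_def]
  simp

/-- Arc coordinates are a vertical shear of the plane, hence preserve Lebesgue measure, and they
straighten the open domain to a half-strip. The factor `1/y²` is the hyperbolic density. -/
theorem setIntegral_fdo (G : ℂ → ℂ) : ∫ z : ℍ in 𝒟ᵒ, G z =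
    ∫ q in Ioc (-(1 / 2) : ℝ) (1 / 2) ×ˢ Ioi (0 : ℝ),
      ((1 / (arcCoord q).im ^ 2 : ℝ) : ℂ) * G (arcCoord q) := by
  rw [volume_def, setIntegral_withDensity_eq_setIntegral_smul measurable_density _ measurableSet_fdo]
  simp only [density_smul, Function.comp_apply]
  rw [← measurePreserving_coe.setIntegral_image_emb measurableEmbedding_coe
    (fun t : ℂ => ((1 / t.im ^ 2 : ℝ) : ℂ) * G t) 𝒟ᵒ,
    Measure.restrict_restrict (measurableEmbedding_coe.measurableSet_image.mpr measurableSet_fdo),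
    inter_eq_left.mpr (image_subset_range _ _),
    ← measurePreserving_arcCoord.setIntegral_preimage_emb measurableEmbedding_arcCoord,
    arcCoord_preimage]
  exact setIntegral_congr_set arc_strip_ae

theorem integrableOn_fdo_iff (G : ℂ → ℂ) : IntegrableOn (fun z : ℍ => G z) 𝒟ᵒ ↔
    IntegrableOn (fun q => ((1 / (arcCoord q).im ^ 2 : ℝ) : ℂ) * G (arcCoord q))
      (Ioc (-(1 / 2) : ℝ) (1 / 2) ×ˢ Ioi (0 : ℝ)) := by
  rw [volume_def, IntegrableOn, restrict_withDensity measurableSet_fdo,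
    integrable_withDensity_iff_integrable_smul measurable_density]
  simp only [density_smul]
  rw [← IntegrableOn, ← integrableOn_congr_set_ae arc_strip_ae, ← arcCoord_preimage]
  have h1 := measurePreserving_arcCoord.integrableOn_comp_preimage measurableEmbedding_arcCoord
    (f := fun t : ℂ => ((1 / t.im ^ 2 : ℝ) : ℂ) * G t) (s := (↑) '' 𝒟ᵒ)
  have h2 := measurePreserving_coe.integrableOn_image measurableEmbedding_coe
    (f := fun t : ℂ => ((1 / t.im ^ 2 : ℝ) : ℂ) * G t) (s := 𝒟ᵒ)
  rw [IntegrableOn, Measure.restrict_restrict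
    (measurableEmbedding_coe.measurableSet_image.mpr measurableSet_fdo),
    inter_eq_left.mpr (image_subset_range _ _)] at h2
  exact h2.symm.trans h1.symm

end coordinates

section decay

variable {a b : ℂ → ℂ}

/-- The filter of points of the strip `|Re z| ≤ 1/2` going to `i∞`. -/
def stripTop : Filter ℂ := comap Complex.im atTop ⊓ 𝓟 {z | |z.re| ≤ 1 / 2}

theorem eventually_stripTop {q : ℂ → Prop} :
    (∀ᶠ z in stripTop, q z) ↔ ∃ M : ℝ, ∀ z : ℂ, |z.re| ≤ 1 / 2 → M ≤ z.im → q z := by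
  rw [stripTop, eventually_inf_principal, eventually_comap]
  simp only [eventually_atTop]
  constructor
  · rintro ⟨M, h⟩
    exact ⟨M, fun z h1 h2 => h z.im h2 z rfl h1⟩
  · rintro ⟨M, h⟩
    exact ⟨M, fun b hb z hz h1 => h z h1 (hz ▸ hb)⟩

theorem HolDecay.tendsto_stripTop (ha : HolDecay a) : Tendsto a stripTop (𝓝 0) := by
  obtain ⟨C, c, hC, hc, h⟩ := ha.decay (1 / 2) 1 one_pos
  have hg : Tendsto (fun z : ℂ => C * Real.exp (-c * z.im)) stripTop (𝓝 0) := by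
    rw [← mul_zero C]
    refine Tendsto.const_mul C (Real.tendsto_exp_atBot.comp ?_)
    refine Tendsto.const_mul_atTop_of_neg (neg_lt_zero.mpr hc) ?_
    exact tendsto_comap.mono_left inf_le_left
  exact squeeze_zero_norm' (eventually_stripTop.mpr ⟨1, h⟩) hg

theorem arcCoord_bounds {q : ℝ × ℝ} (hq : q ∈ Ioc (-(1 / 2) : ℝ) (1 / 2) ×ˢ Ioi (0 : ℝ)) :
    |(arcCoord q).re| ≤ 1 / 2 ∧ 1 / 2 ≤ (arcCoord q).im ∧ q.2 ≤ (arcCoord q).im := by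
  have h0 : 0 < q.2 := hq.2
  have hs : 1 / 2 ≤ √(1 - q.1 ^ 2) := by
    apply Real.le_sqrt_of_sq_le
    nlinarith [hq.1.1, hq.1.2]
  simp only [arcCoord, Complex.add_re, arc_re, Complex.mul_re, Complex.ofReal_re, Complex.I_re,
    mul_zero, Complex.ofReal_im, Complex.I_im, mul_one, sub_self, add_zero, Complex.add_im, arc_im,
    Complex.mul_im]
  exact ⟨abs_le.mpr ⟨hq.1.1.le, hq.1.2⟩, by linarith, by linarith⟩

theorem continuousOn_arcCoord :
    ContinuousOn arcCoord (Ioc (-(1 / 2) : ℝ) (1 / 2) ×ˢ Ioi (0 : ℝ)) :=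
  continuousOn_arc_add (prod_mono Ioc_subset_Icc_self Ioi_subset_Ici_self)

theorem measurableSet_strip :
    MeasurableSet (Ioc (-(1 / 2) : ℝ) (1 / 2) ×ˢ Ioi (0 : ℝ)) :=
  measurableSet_Ioc.prod measurableSet_Ioi

theorem integrableOn_strip_of_decay {H : ℂ → ℂ} (hH : ContinuousOn H {z | 0 < z.im})
    {C c : ℝ} (hc : 0 < c) (hC : 0 ≤ C)
    (hb : ∀ z : ℂ, |z.re| ≤ 1 / 2 → 1 / 2 ≤ z.im → ‖H z‖ ≤ C * Real.exp (-c * z.im)) :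
    IntegrableOn (fun q => H (arcCoord q)) (Ioc (-(1 / 2) : ℝ) (1 / 2) ×ˢ Ioi (0 : ℝ)) := by
  have hg : IntegrableOn (fun q : ℝ × ℝ => C * Real.exp (-c * q.2))
      (Ioc (-(1 / 2) : ℝ) (1 / 2) ×ˢ Ioi (0 : ℝ)) := by
    rw [IntegrableOn, Measure.volume_eq_prod, ← Measure.prod_restrict]
    exact (integrable_const C).mul_prod (exp_neg_integrableOn_Ioi 0 hc)
  refine Integrable.mono' hg ((hH.comp continuousOn_arcCoord fun q hq => ?_).aestronglyMeasurable
    measurableSet_strip) ?_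
  · exact lt_of_lt_of_le (by norm_num) (arcCoord_bounds hq).2.1
  · refine (ae_restrict_mem measurableSet_strip).mono fun q hq => ?_
    obtain ⟨h1, h2, h3⟩ := arcCoord_bounds hq
    refine (hb _ h1 h2).trans ?_
    gcongr 2
    nlinarith

theorem HolDecay.exists_bound_mul (ha : HolDecay a) (hb : HolDecay b) (n : ℕ) :
    ∃ C c : ℝ, 0 < c ∧ 0 ≤ C ∧ ∀ z : ℂ, |z.re| ≤ 1 / 2 → 1 / 2 ≤ z.im →
      ‖a z‖ * ‖z‖ ^ n * ‖b z‖ ≤ C * Real.exp (-c * z.im) := by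
  obtain ⟨C, c, hC, hc, h⟩ := (ha.mul_pow n).decay (1 / 2) (1 / 2) (by norm_num)
  obtain ⟨C', c', hC', hc', h'⟩ := hb.decay (1 / 2) (1 / 2) (by norm_num)
  refine ⟨C * C', c, hc, by positivity, fun z h1 h2 => ?_⟩
  have e1 := h z h1 h2
  have e2 : ‖b z‖ ≤ C' := (h' z h1 h2).trans (mul_le_of_le_one_right hC'
    (Real.exp_le_one_iff.mpr (by nlinarith)))
  rw [norm_mul, norm_pow] at e1
  calc ‖a z‖ * ‖z‖ ^ n * ‖b z‖ ≤ (C * Real.exp (-c * z.im)) * C' :=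
        mul_le_mul e1 e2 (norm_nonneg _) (by positivity)
    _ = _ := by ring

end decay

/-! ### The two arc integrals: Petersson product and vanishing. -/

section petersson

variable {Γ : Subgroup SL(2, ℤ)} {w : ℕ} {f g : Cosets Γ → ℍ → ℂ}

/-- The integrand `f_A(z) conj(g_A(z)) y^k` of the Petersson product. -/
noncomputable def petIntegrand (k : ℕ) (f g : ℍ → ℂ) (z : ℍ) : ℂ :=
  f z * conj (g z) * ((z.im : ℝ) : ℂ) ^ k

/-- The holomorphic derivative of `tailSum` for complex conjugation. -/
noncomputable def eichlerTerm (w : ℕ) (f g : ℍ → ℂ) (z : ℂ) : ℂ :=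
  f (ofComplex z) * (z - conj z) ^ w * conj (g (ofComplex z))

theorem continuousOn_eichlerTerm {f g : ℍ → ℂ} (hf : HolDecay (f ∘ ofComplex))
    (hg : HolDecay (g ∘ ofComplex)) : ContinuousOn (eichlerTerm w f g) {z | 0 < z.im} :=
  (hf.diff.continuousOn.mul (by fun_prop)).mul
    (Complex.continuous_conj.comp_continuousOn hg.diff.continuousOn)

theorem integrableOn_eichlerTerm {f g : ℍ → ℂ} (hf : HolDecay (f ∘ ofComplex))
    (hg : HolDecay (g ∘ ofComplex)) : IntegrableOn (fun q => eichlerTerm w f g (arcCoord q))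
      (Ioc (-(1 / 2) : ℝ) (1 / 2) ×ˢ Ioi (0 : ℝ)) := by
  obtain ⟨C, c, hc, hC, h⟩ := hf.exists_bound_mul hg w
  refine integrableOn_strip_of_decay (C := 2 ^ w * C) (continuousOn_eichlerTerm hf hg) hc
    (by positivity) fun z h1 h2 => ?_
  rw [mul_assoc]
  refine le_trans ?_ (mul_le_mul_of_nonneg_left (h z h1 h2) (by positivity))
  have : ‖z - conj z‖ ≤ 2 * ‖z‖ := (norm_sub_le _ _).trans (by rw [RCLike.norm_conj]; linarith)
  rw [eichlerTerm, norm_mul, norm_mul, norm_pow, RCLike.norm_conj]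
  calc ‖f (ofComplex z)‖ * ‖z - conj z‖ ^ w * ‖g (ofComplex z)‖
      ≤ ‖f (ofComplex z)‖ * (2 * ‖z‖) ^ w * ‖g (ofComplex z)‖ := by gcongr
    _ = _ := by simp only [Function.comp_apply]; ring

/-- Since `z - conj z = 2iy`, the power `w` gives `(2i)^w y^w`, and `y^w = y^(w+2) / y²`. -/
theorem petIntegrand_eq (f g : ℍ → ℂ) {z : ℂ} (hz : 0 < z.im) :
    eichlerTerm w f g z = (2 * Complex.I) ^ w * (((1 / z.im ^ 2 : ℝ) : ℂ) *
      petIntegrand (w + 2) f g (ofComplex z)) := by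
  have hz' : (z.im : ℂ) ≠ 0 := Complex.ofReal_ne_zero.mpr hz.ne'
  rw [eichlerTerm, petIntegrand, Complex.sub_conj, ofComplex_apply_of_im_pos hz]
  change _ = _ * (_ * (_ * _ * (z.im : ℂ) ^ (w + 2)))
  push_cast
  field_simp
  ring

theorem integrableOn_petIntegrand {f g : ℍ → ℂ} (hf : HolDecay (f ∘ ofComplex))
    (hg : HolDecay (g ∘ ofComplex)) : IntegrableOn (petIntegrand (w + 2) f g) 𝒟ᵒ := by
  have h1 := integrableOn_fdo_iff fun z => petIntegrand (w + 2) f g (ofComplex z)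
  simp only [ofComplex_apply] at h1
  rw [h1]
  have h2 := (integrableOn_eichlerTerm (w := w) hf hg).const_mul (((2 * Complex.I) ^ w)⁻¹)
  refine Integrable.congr h2 ((ae_restrict_mem measurableSet_strip).mono fun q hq => ?_)
  have hz : 0 < (arcCoord q).im := lt_of_lt_of_le (by norm_num) (arcCoord_bounds hq).2.1
  simp only [petIntegrand_eq (w := w) f g hz]
  rw [inv_mul_cancel_left₀ (by simp)]

theorem integral_eichlerTerm (f g : ℍ → ℂ) :
    ∫ q in Ioc (-(1 / 2) : ℝ) (1 / 2) ×ˢ Ioi (0 : ℝ), eichlerTerm w f g (arcCoord q) =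
      (2 * Complex.I) ^ w * ∫ z in 𝒟ᵒ, petIntegrand (w + 2) f g z := by
  have h1 := setIntegral_fdo fun z => petIntegrand (w + 2) f g (ofComplex z)
  simp only [ofComplex_apply] at h1
  rw [h1, ← integral_const_mul]
  refine setIntegral_congr_fun measurableSet_strip fun q hq => ?_
  exact petIntegrand_eq f g (lt_of_lt_of_le (by norm_num) (arcCoord_bounds hq).2.1)

theorem tailSum_add_one [Finite (Cosets Γ)] (τ : ℂ →ₐ[ℝ] ℂ) (hf : IsCuspFamily (w + 2) f)
    (hg : IsCuspFamily (w + 2) g) {z : ℂ} (hz : 0 < z.im) :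
    tailSum τ w f g (z + 1) = tailSum τ w f g z := by
  cases nonempty_fintype (Cosets Γ)
  set t : ℍ := ⟨z, hz⟩ with ht
  have hT : ((ModularGroup.T • t : ℍ) : ℂ) = z + 1 := by
    rw [modular_T_smul, coe_vadd, add_comm, Complex.ofReal_one]
  have hd : ∀ x : ℂ, (polyDenom ModularGroup.T).eval x = 1 := fun x => by
    rw [eval_polyDenom]
    simp [ModularGroup.T]
  have hn : ∀ x : ℂ, (polyNum ModularGroup.T).eval x = x + 1 := fun x => by
    rw [eval_polyNum]
    simp [ModularGroup.T]
  simp only [tailSum, finsum_eq_sum_of_fintype]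
  rw [← (cosetMulEquiv Γ ModularGroup.T⁻¹).sum_comp]
  refine Finset.sum_congr rfl fun A _ => ?_
  change (tailPoly w (f (cosetMul A ModularGroup.T⁻¹)) (z + 1)).eval (τ (z + 1)) *
    τ (g (cosetMul A ModularGroup.T⁻¹) (ofComplex (z + 1))) = _
  have h2 := congrArg (Polynomial.eval (τ z)) (congrFun (hf.tailFam_T t) A)
  rw [indSlash, eval_polySlash (natDegree_tailFam_le _ _ _ _) (by rw [hd]; exact one_ne_zero),
    hd, hn, one_pow, one_mul, div_one, hT] at h2
  have h4 := slash_apply_eval (g (cosetMul A ModularGroup.T⁻¹)) (w + 2) ModularGroup.T t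
  rw [hg.slash_inv, hd, one_pow, mul_one] at h4
  rw [map_add, map_one, ← hT, ofComplex_apply, ← h4, ofComplex_apply_of_im_pos hz]
  simp only [tailFam] at h2
  rw [hT, h2]

theorem tendsto_tailSum [Finite (Cosets Γ)] (τ : ℂ →ₐ[ℝ] ℂ) (hτ : ∀ z, ‖τ z‖ = ‖z‖)
    (hf : IsCuspFamily (w + 2) f) (hg : IsCuspFamily (w + 2) g) :
    Tendsto (tailSum τ w f g) stripTop (𝓝 0) := by
  cases nonempty_fintype (Cosets Γ)
  have hsum : tailSum τ w f g =
      fun z => ∑ A, (tailPoly w (f A) z).eval (τ z) * τ (g A (ofComplex z)) :=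
    funext fun z => finsum_eq_sum_of_fintype _
  have hz : (0 : ℂ) = ∑ A : Cosets Γ, 0 * 0 := by simp
  rw [hsum, hz]
  refine tendsto_finsetSum _ fun A _ => Tendsto.mul ?_ ?_
  · simp only [eval_tailPoly]
    rw [show (0 : ℂ) = ∑ n ∈ Finset.range (w + 1), 0 by simp]
    refine tendsto_finsetSum _ fun n hn => ?_
    have h1 := ((holDecay_coeff_tailPoly (hf.holDecay A)
      (Nat.lt_succ_iff.mp (Finset.mem_range.mp hn))).mul_pow n).tendsto_stripTop
    rw [tendsto_zero_iff_norm_tendsto_zero] at h1 ⊢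
    refine h1.congr fun z => ?_
    rw [norm_mul, norm_mul, norm_pow, norm_pow, hτ]
  · have h1 := (hg.holDecay A).tendsto_stripTop
    rw [tendsto_zero_iff_norm_tendsto_zero] at h1 ⊢
    exact h1.congr fun z => (hτ _).symm

theorem norm_le_of_tendsto_stripTop {V : ℂ → ℂ} (hV : Tendsto V stripTop (𝓝 0)) :
    ∀ ε > 0, ∃ M₀ : ℝ, ∀ z : ℂ, |z.re| ≤ 1 / 2 → M₀ ≤ z.im → ‖V z‖ ≤ ε := by
  intro ε hε
  rw [← eventually_stripTop]
  filter_upwards [hV (Metric.closedBall_mem_nhds 0 hε)] with z hz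
  simpa using hz

/-- The arc integral for a holomorphic and an antiholomorphic family is a Petersson product. -/
theorem integral_arc_conj [Finite (Cosets Γ)] (hf : IsCuspFamily (w + 2) f)
    (hg : IsCuspFamily (w + 2) g) :
    ∫ x in (-(1 / 2) : ℝ)..(1 / 2), tailSum conjAlg w f g (arc x) * conjAlg (arcDeriv x) =
      haberlandConst (w + 2) * ∑ᶠ A, ∫ z in 𝒟ᵒ, petIntegrand (w + 2) (f A) (g A) z := by
  cases nonempty_fintype (Cosets Γ)
  have key := stokes_domain (V := tailSum conjAlg w f g)
    (p := fun z => ∑ A, eichlerTerm w (f A) (g A) z)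
    (fun z hz => hasWDerivAt_tailSum conjAlg hf hg hz)
    (continuousOn_finsetSum _ fun A _ => continuousOn_eichlerTerm (hf.holDecay A) (hg.holDecay A))
    (fun z hz => tailSum_add_one conjAlg hf hg hz)
    (norm_le_of_tendsto_stripTop
      (tendsto_tailSum conjAlg (fun z => RCLike.norm_conj z) hf hg))
    (integrable_finsetSum _ fun A _ => integrableOn_eichlerTerm (hf.holDecay A) (hg.holDecay A))
  change 2 * ∫ q in Ioc (-(1 / 2) : ℝ) (1 / 2) ×ˢ Ioi (0 : ℝ),
    ∑ A, eichlerTerm w (f A) (g A) (arcCoord q) = _ at key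
  rw [integral_finsetSum _ fun A _ => integrableOn_eichlerTerm (hf.holDecay A) (hg.holDecay A)]
    at key
  simp only [integral_eichlerTerm] at key
  rw [← Finset.mul_sum] at key
  rw [finsum_eq_sum_of_fintype]
  change ∫ x in (-(1 / 2) : ℝ)..(1 / 2), tailSum conjAlg w f g (arc x) * conj (arcDeriv x) = _
  -- Stokes gives `2 (2i)^w` times the sum of Petersson integrals as `i` times the arc integral.
  -- Dividing by `i` produces `-(2i)^(w+1)`.
  rw [haberlandConst, show w + 2 - 1 = w + 1 by omega, pow_succ]
  linear_combination Complex.I * key + (∫ x in (-(1 / 2) : ℝ)..(1 / 2),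
    tailSum conjAlg w f g (arc x) * conj (arcDeriv x)) * Complex.I_sq

/-- The arc integral for two holomorphic families vanishes. -/
theorem integral_arc_id [Finite (Cosets Γ)] (hf : IsCuspFamily (w + 2) f)
    (hg : IsCuspFamily (w + 2) g) :
    ∫ x in (-(1 / 2) : ℝ)..(1 / 2), tailSum (AlgHom.id ℝ ℂ) w f g (arc x) *
      AlgHom.id ℝ ℂ (arcDeriv x) = 0 := by
  cases nonempty_fintype (Cosets Γ)
  -- For `τ = id` the sum is holomorphic. Its conjugate has no `dz` derivative, so the same form of
  -- Stokes applies with `p = 0`.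
  have key := stokes_domain (V := fun z => conj (tailSum (AlgHom.id ℝ ℂ) w f g z))
    (p := fun _ => 0) (fun z hz => ?_) continuousOn_const
    (fun z hz => by rw [tailSum_add_one _ hf hg hz])
    (fun ε hε => ?_) integrableOn_zero
  · have h2 : ∀ x : ℝ, conj (tailSum (AlgHom.id ℝ ℂ) w f g (arc x)) * conj (arcDeriv x) =
        conj (tailSum (AlgHom.id ℝ ℂ) w f g (arc x) * AlgHom.id ℝ ℂ (arcDeriv x)) :=
      fun x => (map_mul _ _ _).symm
    simp only [h2, integral_zero, mul_zero] at key
    have h3 := (mul_eq_zero.mp key.symm).resolve_left Complex.I_ne_zero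
    rw [intervalIntegral.integral_of_le (by norm_num), integral_conj] at h3
    rw [intervalIntegral.integral_of_le (by norm_num)]
    simpa using h3
  · obtain ⟨q, hq⟩ := hasWDerivAt_tailSum (AlgHom.id ℝ ℂ) hf hg hz
    refine ⟨conj (∑ A, f A (ofComplex z) * (z - AlgHom.id ℝ ℂ z) ^ w *
      AlgHom.id ℝ ℂ (g A (ofComplex z)) + q), ((endCLM conjAlg).hasFDerivAt.comp z hq).congr_fderiv ?_⟩
    ext
    simp [add_mul]
  · obtain ⟨M, hM⟩ := norm_le_of_tendsto_stripTop
      (tendsto_tailSum (AlgHom.id ℝ ℂ) (fun z => rfl) hf hg) ε hε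
    exact ⟨M, fun z h1 h2 => by rw [RCLike.norm_conj]; exact hM z h1 h2⟩

end petersson

end Haberland

/-! ### Fundamental domains for `Γ` and unfolding of the Petersson product. -/

namespace Haberland

open Filter Topology Set
open scoped Modular NNReal Pointwise

section invariance

instance : SMulInvariantMeasure SL(2, ℤ) ℍ volume where
  measure_preimage_smul g _ hs :=
    measure_preimage_smul_of_nullMeasurableSet (μ := (volume : Measure ℍ))
      hs.nullMeasurableSet (g : GL (Fin 2) ℝ)

instance : MeasurableConstSMul SL(2, ℤ) ℍ where
  measurable_const_smul g := (continuous_const_smul (g : GL (Fin 2) ℝ)).measurable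

variable {Γ : Subgroup SL(2, ℤ)}

theorem exists_smul_eq (h : projectivization Γ) : ∃ γ ∈ Γ, ∀ z : ℍ, h • z = γ • z := by
  obtain ⟨γ, hγ, hh⟩ := h.2
  exact ⟨γ, hγ, fun z => congrArg (fun e : Equiv.Perm ℍ => e z) hh.symm⟩

/-- The transformation of `ℍ` induced by an element of `Γ`. -/
noncomputable def toProj (γ : SL(2, ℤ)) (hγ : γ ∈ Γ) : projectivization Γ :=
  ⟨MulAction.toPermHom SL(2, ℤ) ℍ γ, Subgroup.mem_map_of_mem _ hγ⟩

instance : MeasurableConstSMul (projectivization Γ) ℍ where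
  measurable_const_smul h := by
    obtain ⟨γ, -, hh⟩ := exists_smul_eq h
    exact (funext hh : (fun z : ℍ => h • z) = fun z => γ • z) ▸ measurable_const_smul γ

instance : SMulInvariantMeasure (projectivization Γ) ℍ volume where
  measure_preimage_smul h s hs := by
    obtain ⟨γ, -, hh⟩ := exists_smul_eq h
    rw [show (fun z : ℍ => h • z) = fun z => γ • z from funext hh]
    exact measure_preimage_smul_of_nullMeasurableSet hs.nullMeasurableSet γ

instance : Countable SL(2, ℤ) :=
  Function.Injective.countable (β := Fin 2 → Fin 2 → ℤ) (f := fun A => A.1) Subtype.val_injective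

instance : Countable (projectivization Γ) := by
  refine Function.Surjective.countable (f := fun γ : Γ => toProj γ.1 γ.2) fun h => ?_
  obtain ⟨γ, hγ, hh⟩ := h.2
  exact ⟨⟨γ, hγ⟩, Subtype.ext hh⟩

end invariance

section domain

theorem volume_re_eq (c : ℝ) : volume {z : ℂ | z.re = c} = 0 := by
  rw [← measurePreserving_arcCoord.measure_preimage_emb measurableEmbedding_arcCoord]
  have : arcCoord ⁻¹' {z : ℂ | z.re = c} = {c} ×ˢ univ := by
    ext q
    simp [arcCoord]
  rw [this, Measure.volume_eq_prod, Measure.prod_prod]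
  simp

theorem volume_fd_diff_fdo : volume (𝒟 \ 𝒟ᵒ) = 0 := by
  rw [volume_eq_lintegral]
  refine setLIntegral_measure_zero _ _ ?_
  have hsub : ((↑) '' (𝒟 \ 𝒟ᵒ) : Set ℂ) ⊆
      {z : ℂ | z.re = 1 / 2} ∪ {z : ℂ | z.re = -(1 / 2)} ∪ Metric.sphere 0 1 := by
    rw [image_sdiff UpperHalfPlane.coe_injective, ModularGroup.coe_fd, ModularGroup.coe_fdo]
    rintro z ⟨⟨h1, h2, h3⟩, h4⟩
    simp only [mem_ofPred_eq, not_and, not_lt] at h4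
    rcases h2.lt_or_eq with h5 | h5
    · left
      have h6 := le_antisymm h3 (h4 h1 h5)
      rcases abs_choice z.re with h7 | h7
      · left
        rw [mem_ofPred_eq, ← h6, h7]
      · right
        rw [mem_ofPred_eq, ← h6, h7, neg_neg]
    · right
      simp [← h5]
  refine measure_mono_null hsub (measure_union_null (measure_union_null ?_ ?_) ?_)
  · exact volume_re_eq _
  · exact volume_re_eq _
  · exact Measure.addHaar_sphere _ _ _

/-- Every orbit meets the closed domain, and the countably many translates of its null boundary can
be discarded. -/
theorem ae_exists_smul_mem_fdo : ∀ᵐ z : ℍ, ∃ γ : SL(2, ℤ), γ • z ∈ 𝒟ᵒ := by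
  have h : ∀ᵐ z : ℍ, ∀ γ : SL(2, ℤ), γ • z ∉ 𝒟 \ 𝒟ᵒ := by
    rw [ae_all_iff]
    intro γ
    have := (measurePreserving_smul γ (volume : Measure ℍ)).quasiMeasurePreserving.ae
      (measure_eq_zero_iff_ae_notMem.mp volume_fd_diff_fdo)
    exact this
  filter_upwards [h] with z hz
  obtain ⟨γ, hγ⟩ := ModularGroup.exists_smul_mem_fd z
  refine ⟨γ, ?_⟩
  by_contra hn
  exact hz γ ⟨hγ, hn⟩

variable (Γ : Subgroup SL(2, ℤ))

/-- The preimage in `SL(2, ℤ)` of the projectivization of `Γ`, namely `±Γ`. -/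
noncomputable def projClosure : Subgroup SL(2, ℤ) :=
  (projectivization Γ).comap (MulAction.toPermHom SL(2, ℤ) ℍ)

variable {Γ}

theorem le_projClosure : Γ ≤ projClosure Γ := Subgroup.le_comap_map _ _

instance [Γ.FiniteIndex] : (projClosure Γ).FiniteIndex := Subgroup.finiteIndex_of_le le_projClosure

theorem projIndex_eq : projIndex Γ = (projClosure Γ).index := by
  rw [projIndex, projClosure, Subgroup.index_comap, MonoidHom.range_eq_map]
  rfl

theorem neg_one_mem_projClosure : (-1 : SL(2, ℤ)) ∈ projClosure Γ := by
  have : MulAction.toPermHom SL(2, ℤ) ℍ (-1) = 1 := by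
    ext z
    simp
  rw [projClosure, Subgroup.mem_comap, this]
  exact one_mem _

theorem mk_out {Δ : Subgroup SL(2, ℤ)} (A : Cosets Δ) : (Quotient.mk'' A.out : Cosets Δ) = A :=
  Quotient.out_eq' A

/-- A union of translates of the standard fundamental domain, one for each coset. -/
def translatesDomain (Γ : Subgroup SL(2, ℤ)) : Set ℍ :=
  ⋃ A : Cosets (projClosure Γ), A.out • 𝒟ᵒ

theorem eq_or_eq_neg_of_smul_eq {a b : SL(2, ℤ)} {x y : ℍ} (hx : x ∈ 𝒟ᵒ) (hy : y ∈ 𝒟ᵒ)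
    (h : a • x = b • y) : a = b ∨ a = -b := by
  have h1 : (b⁻¹ * a) • x = y := by rw [mul_smul, h, inv_smul_smul]
  rcases ModularGroup.eq_one_or_neg_one_of_mem_fdo_mem_fdo hx (h1 ▸ hy) with h2 | h2
  · exact Or.inl (inv_mul_eq_one.mp h2).symm
  · right
    rw [inv_mul_eq_iff_eq_mul] at h2
    rw [h2]
    simp

theorem measurableSet_smul_fdo (a : SL(2, ℤ)) : MeasurableSet (a • 𝒟ᵒ) :=
  measurableSet_fdo.const_smul a

theorem mul_mem_projClosure {γ γ' a b : SL(2, ℤ)} (hγ : γ ∈ Γ) (hγ' : γ' ∈ Γ)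
    (h : γ * a = γ' * b ∨ γ * a = -(γ' * b)) :
    (Quotient.mk'' a : Cosets (projClosure Γ)) = Quotient.mk'' b := by
  refine Quotient.eq''.mpr ?_
  rw [QuotientGroup.rightRel_apply]
  have hγ1 := le_projClosure hγ
  have hγ2 := le_projClosure hγ'
  rcases h with h | h
  · have : b * a⁻¹ = γ'⁻¹ * γ := by
      rw [mul_inv_eq_iff_eq_mul, mul_assoc, h, inv_mul_cancel_left]
    rw [this]
    exact mul_mem (inv_mem hγ2) hγ1
  · have : b * a⁻¹ = -1 * (γ'⁻¹ * γ) := by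
      rw [mul_inv_eq_iff_eq_mul, mul_assoc, mul_assoc, h]
      simp
    rw [this]
    exact mul_mem neg_one_mem_projClosure (mul_mem (inv_mem hγ2) hγ1)

theorem pairwise_disjoint_translates :
    Pairwise (Function.onFun Disjoint fun A : Cosets (projClosure Γ) => A.out • 𝒟ᵒ) := by
  intro A B hAB
  refine disjoint_left.mpr ?_
  rintro _ ⟨x, hx, rfl⟩ ⟨y, hy, hxy⟩
  apply hAB
  rw [← mk_out A, ← mk_out B]
  refine mul_mem_projClosure (γ := 1) (γ' := 1) (one_mem Γ) (one_mem Γ) ?_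
  rw [one_mul, one_mul]
  exact eq_or_eq_neg_of_smul_eq hx hy hxy.symm

/-- Representatives are taken modulo `±Γ`, because `±1` act identically on `ℍ`. Disjointness follows
since points of the open domain are equivalent only through `±1`. -/
theorem isFundDomain_translatesDomain [Γ.FiniteIndex] : IsFundDomain Γ (translatesDomain Γ) where
  nullMeasurableSet := (MeasurableSet.iUnion fun A => measurableSet_smul_fdo _).nullMeasurableSet
  ae_covers := by
    filter_upwards [ae_exists_smul_mem_fdo] with z ⟨γ, hγ⟩
    set A : Cosets (projClosure Γ) := Quotient.mk'' γ⁻¹ with hA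
    have hrel := Quotient.eq''.mp (mk_out A)
    rw [QuotientGroup.rightRel_apply] at hrel
    refine ⟨⟨_, inv_mem hrel⟩, mem_iUnion.mpr ⟨A, γ • z, hγ, ?_⟩⟩
    change A.out • γ • z = ((MulAction.toPermHom SL(2, ℤ) ℍ) (γ⁻¹ * A.out⁻¹))⁻¹ z
    rw [← map_inv, mul_inv_rev, inv_inv, inv_inv]
    change _ = (A.out * γ) • z
    rw [mul_smul]
  aedisjoint h₁ h₂ hne := by
    refine Disjoint.aedisjoint (disjoint_left.mpr ?_)
    rintro _ ⟨x, hx, rfl⟩ ⟨y, hy, hxy⟩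
    obtain ⟨A, a, ha, rfl⟩ := mem_iUnion.mp hx
    obtain ⟨B, b, hb, rfl⟩ := mem_iUnion.mp hy
    obtain ⟨γ₁, hγ₁, e₁⟩ := h₁.2
    obtain ⟨γ₂, hγ₂, e₂⟩ := h₂.2
    have e : (γ₁ * A.out) • a = (γ₂ * B.out) • b := by
      have := hxy.symm
      change h₁.1 (A.out • a) = h₂.1 (B.out • b) at this
      rw [← e₁, ← e₂] at this
      rw [mul_smul, mul_smul]
      exact this
    have h := eq_or_eq_neg_of_smul_eq ha hb e
    have hAB : A = B := by
      rw [← mk_out A, ← mk_out B]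
      exact mul_mem_projClosure hγ₁ hγ₂ h
    subst hAB
    apply hne
    apply Subtype.ext
    rw [← e₁, ← e₂]
    ext z
    rcases h with h | h
    · rw [mul_right_cancel h]
    · rw [← neg_mul] at h
      rw [mul_right_cancel h]
      simp

end domain

section average

variable {Γ Δ : Subgroup SL(2, ℤ)}

/-- The projection between coset spaces. -/
def cosetProj (h : Γ ≤ Δ) (A : Cosets Γ) : Cosets Δ :=
  Quotient.map' id (fun a b hab => by
    rw [QuotientGroup.rightRel_apply] at hab ⊢
    exact h hab) A

theorem cosetProj_cosetMul (h : Γ ≤ Δ) (A : Cosets Γ) (g : SL(2, ℤ)) :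
    cosetProj h (cosetMul A g) = cosetMul (cosetProj h A) g := by
  induction A using Quotient.inductionOn' with | h a => rfl

theorem card_cosets (Γ : Subgroup SL(2, ℤ)) : Nat.card (Cosets Γ) = Γ.index :=
  Nat.card_congr (QuotientGroup.quotientRightRelEquivQuotientLeftRel Γ)

/-- Averages over coset spaces are compatible with projections. -/
theorem average_cosets [Γ.FiniteIndex] [Δ.FiniteIndex] (h : Γ ≤ Δ) (J : Cosets Δ → ℂ) :
    ((Γ.index : ℕ) : ℂ)⁻¹ * ∑ᶠ A, J (cosetProj h A) = ((Δ.index : ℕ) : ℂ)⁻¹ * ∑ᶠ B, J B := by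
  classical
  cases nonempty_fintype (Cosets Γ)
  cases nonempty_fintype (Cosets Δ)
  set B₀ : Cosets Δ := Quotient.mk'' 1
  set m : Cosets Δ → ℕ := fun B => (Finset.univ.filter fun A : Cosets Γ => cosetProj h A = B).card
  -- Right translation permutes the fibres of the projection transitively, so they are equinumerous.
  -- The sum of the constant `1` then identifies their size with the quotient of the indices.
  have hm : ∀ B, m B = m B₀ := by
    intro B
    obtain ⟨g, rfl⟩ : ∃ g, B = cosetMul B₀ g := by
      induction B using Quotient.inductionOn' with | h b =>
      exact ⟨b, by simp [B₀, cosetMul]⟩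
    refine Finset.card_bij' (fun A _ => cosetMul A g⁻¹) (fun A _ => cosetMul A g) ?_ ?_ ?_ ?_
    · intro A hA
      simp only [Finset.mem_filter, Finset.mem_univ, true_and] at hA ⊢
      rw [cosetProj_cosetMul, hA]
      simp
    · intro A hA
      simp only [Finset.mem_filter, Finset.mem_univ, true_and] at hA ⊢
      rw [cosetProj_cosetMul, hA]
    · simp
    · simp
  have hsum : ∀ J : Cosets Δ → ℂ, ∑ A, J (cosetProj h A) = m B₀ * ∑ B, J B := by
    intro J
    rw [← Finset.sum_fiberwise Finset.univ (cosetProj h), Finset.mul_sum]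
    refine Finset.sum_congr rfl fun B _ => ?_
    rw [Finset.sum_congr rfl (g := fun _ => J B) fun A hA => by
      rw [(Finset.mem_filter.mp hA).2], Finset.sum_const, nsmul_eq_mul, ← hm B]
  have hcard := hsum fun _ => 1
  simp only [Finset.sum_const, Finset.card_univ, nsmul_eq_mul, mul_one, ← Nat.card_eq_fintype_card,
    card_cosets] at hcard
  rw [finsum_eq_sum_of_fintype, finsum_eq_sum_of_fintype, hsum]
  have h1 : ((Γ.index : ℕ) : ℂ) ≠ 0 := index_ne_zero
  have h2 : ((Δ.index : ℕ) : ℂ) ≠ 0 := index_ne_zero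
  field_simp
  rw [hcard]
  ring

end average

section unfolding

variable {Γ : Subgroup SL(2, ℤ)} {k : ℕ}

theorem petIntegrand_slash (f g : ℍ → ℂ) (a : SL(2, ℤ)) (z : ℍ) :
    petIntegrand k (f ∣[(k : ℤ)] a) (g ∣[(k : ℤ)] a) z = petIntegrand k f g (a • z) := by
  have h : ∀ (f g : ℍ → ℂ) (z : ℍ),
      petIntegrand k f g z = UpperHalfPlane.petersson (k : ℤ) g f z := fun f g z => by
    rw [petIntegrand, UpperHalfPlane.petersson, zpow_natCast]
    ring
  rw [h, h, petersson_slash_SL]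

variable (f g : CuspForm (Γ : Subgroup (GL (Fin 2) ℝ)) (k : ℤ))

theorem petIntegrand_smul {γ : SL(2, ℤ)} (hγ : γ ∈ Γ) (z : ℍ) :
    petIntegrand k f g (γ • z) = petIntegrand k f g z := by
  have hf : (f : ℍ → ℂ) ∣[(k : ℤ)] γ = f :=
    SlashInvariantFormClass.slash_action_eq f _ (Subgroup.mem_map_of_mem _ hγ)
  have hg : (g : ℍ → ℂ) ∣[(k : ℤ)] γ = g :=
    SlashInvariantFormClass.slash_action_eq g _ (Subgroup.mem_map_of_mem _ hγ)
  rw [← petIntegrand_slash, hf, hg]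

theorem setIntegral_smul_fdo (F : ℍ → ℂ) (a : SL(2, ℤ)) :
    ∫ z in a • 𝒟ᵒ, F z = ∫ z in 𝒟ᵒ, F (a • z) :=
  (measurePreserving_smul a (volume : Measure ℍ)).setIntegral_image_emb
    (measurableEmbedding_const_smul a) F 𝒟ᵒ

theorem integrableOn_smul_fdo (F : ℍ → ℂ) (a : SL(2, ℤ)) :
    IntegrableOn F (a • 𝒟ᵒ) ↔ IntegrableOn (fun z => F (a • z)) 𝒟ᵒ :=
  (measurePreserving_smul a (volume : Measure ℍ)).integrableOn_image
    (measurableEmbedding_const_smul a)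

/-- The Petersson product as an average over cosets of integrals over the standard domain. -/
theorem petersson_eq_average [Γ.FiniteIndex] (hk : 2 ≤ k) {F : Set ℍ} (hF : IsFundDomain Γ F) :
    petersson Γ k F f g = ((Γ.index : ℕ) : ℂ)⁻¹ *
      ∑ᶠ A, ∫ z in 𝒟ᵒ, petIntegrand k (formFamily f A) (formFamily g A) z := by
  obtain ⟨w, rfl⟩ : ∃ w, k = w + 2 := ⟨k - 2, by omega⟩
  cases nonempty_fintype (Cosets (projClosure Γ))
  have h1 : petersson Γ (w + 2) F f g = ((projIndex Γ : ℕ) : ℂ)⁻¹ *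
      ∫ z in translatesDomain Γ, petIntegrand (w + 2) f g z := by
    rw [petersson]
    congr 1
    -- The integrand is `Γ`-invariant, so any fundamental domain may be replaced by the explicit
    -- union of translates.
    refine IsFundamentalDomain.setIntegral_eq (G := projectivization Γ) hF
      isFundDomain_translatesDomain fun h z => ?_
    obtain ⟨γ, hγ, hh⟩ := exists_smul_eq h
    rw [hh]
    exact petIntegrand_smul f g hγ z
  set J : Cosets (projClosure Γ) → ℂ := fun A => ∫ z in 𝒟ᵒ, petIntegrand (w + 2) f g (A.out • z)
    with hJ
  have h2 : ∫ z in translatesDomain Γ, petIntegrand (w + 2) f g z = ∑ᶠ A, J A := by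
    rw [finsum_eq_sum_of_fintype, translatesDomain, integral_iUnion_fintype
      (fun A => measurableSet_smul_fdo _) pairwise_disjoint_translates]
    · exact Finset.sum_congr rfl fun A _ => setIntegral_smul_fdo _ _
    · intro A
      rw [integrableOn_smul_fdo]
      simp only [← petIntegrand_slash]
      exact integrableOn_petIntegrand
        ((isCuspFamily_formFamily f).holDecay (Quotient.mk'' A.out))
        ((isCuspFamily_formFamily g).holDecay (Quotient.mk'' A.out))
  rw [h1, h2, projIndex_eq, ← average_cosets le_projClosure]
  congr 1
  refine finsum_congr fun A => ?_
  induction A using Quotient.inductionOn' with | h a => ?_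
  simp only [hJ, formFamily_mk, petIntegrand_slash]
  refine setIntegral_congr_fun measurableSet_fdo fun z _ => ?_
  set B : Cosets (projClosure Γ) := cosetProj le_projClosure (Quotient.mk'' a) with hB
  have hrel : (Quotient.mk'' B.out : Cosets (projClosure Γ)) = Quotient.mk'' a := mk_out B
  have hmem := Quotient.eq''.mp hrel
  rw [QuotientGroup.rightRel_apply] at hmem
  obtain ⟨γ, hγ, e⟩ := hmem
  have hz : γ • B.out • z = a • z := by
    have := congrArg (fun p : Equiv.Perm ℍ => p (B.out • z)) e
    change γ • B.out • z = (a * B.out⁻¹) • B.out • z at this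
    rw [this, mul_smul, inv_smul_smul]
  change petIntegrand (w + 2) f g (B.out • z) = petIntegrand (w + 2) f g (a • z)
  rw [← hz, petIntegrand_smul f g hγ]

end unfolding

end Haberland

/-! ### Parity parts and Haberland's formula. -/

namespace Haberland

open Filter Topology Set Polynomial
open scoped Modular

section parity

variable {Γ : Subgroup SL(2, ℤ)} (hΓ : NormalizedByEps Γ) {w : ℕ} {P Q : Cosets Γ → ℂ[X]}

theorem coeff_comp_neg_X (P : ℂ[X]) (n : ℕ) : (P.comp (-X)).coeff n = (-1) ^ n * P.coeff n := by
  rw [← neg_one_mul, ← C_1, ← C_neg, comp_C_mul_X_coeff, mul_comm]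

theorem epsConj_epsConj (g : SL(2, ℤ)) : epsConj (epsConj g) = g := by
  ext i j
  rw [coe_epsConj]
  fin_cases i <;> fin_cases j <;> simp [coe_epsConj]

theorem cosetEps_cosetEps (A : Cosets Γ) : cosetEps hΓ (cosetEps hΓ A) = A := by
  induction A using Quotient.inductionOn' with | h a => ?_
  simp [cosetEps, epsConj_epsConj]

theorem indEps_indEps (P : Cosets Γ → ℂ[X]) : indEps hΓ (indEps hΓ P) = P := by
  funext A
  rw [indEps, indEps, cosetEps_cosetEps, comp_assoc]
  simp

theorem polySlash_comp_neg_X (w : ℕ) (P : ℂ[X]) (g : SL(2, ℤ)) :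
    polySlash w (P.comp (-X)) g = (polySlash w P (epsConj g)).comp (-X) := by
  rw [polySlash, polySlash, Polynomial.sum_comp]
  refine Finset.sum_congr rfl fun n _ => ?_
  rw [coeff_comp_neg_X]
  simp only [coe_epsConj, mul_comp, pow_comp, add_comp, C_comp, X_comp, C_mul, C_pow, C_neg, C_1]
  simp only [Matrix.of_apply, Matrix.cons_val', Matrix.cons_val_zero, Matrix.cons_val_one,
    Matrix.cons_val_fin_one, Int.cast_neg, C_neg]
  rw [show (C (g 0 0 : ℂ) * -X + -C (g 0 1 : ℂ) : ℂ[X]) = -1 * (C (g 0 0 : ℂ) * X + C (g 0 1 : ℂ))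
    by ring, mul_pow]
  ring

theorem indSlash_indEps (w : ℕ) (P : Cosets Γ → ℂ[X]) (g : SL(2, ℤ)) :
    indSlash w (indEps hΓ P) g = indEps hΓ (indSlash w P (epsConj g)) := by
  funext A
  rw [indSlash, indEps, polySlash_comp_neg_X, cosetEps_cosetMul, map_inv]
  rfl

theorem polyPairing_comp_neg_X (w : ℕ) (P Q : ℂ[X]) :
    polyPairing w (P.comp (-X)) (Q.comp (-X)) = (-1) ^ w * polyPairing w P Q := by
  rw [polyPairing, polyPairing, Finset.mul_sum]
  refine Finset.sum_congr rfl fun n hn => ?_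
  have hn' : n ≤ w := Nat.lt_succ_iff.mp (Finset.mem_range.mp hn)
  rw [coeff_comp_neg_X, coeff_comp_neg_X]
  have : (-1 : ℂ) ^ w = (-1) ^ n * (-1) ^ (w - n) := by rw [← pow_add, Nat.add_sub_cancel' hn']
  rw [this]
  ring

theorem indPairing_indEps (w : ℕ) (P Q : Cosets Γ → ℂ[X]) :
    indPairing w (indEps hΓ P) (indEps hΓ Q) = (-1) ^ w * indPairing w P Q := by
  simp only [indPairing, indEps, polyPairing_comp_neg_X]
  rw [← mul_finsum, mul_left_comm]
  congr 2
  exact finsum_comp_equiv (Function.Involutive.toPerm _ (cosetEps_cosetEps hΓ))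
    (f := fun A => polyPairing w (P A) (Q A))

theorem epsConj_T : epsConj ModularGroup.T = ModularGroup.T⁻¹ := by decide

/-- The pairing contributes `(-1)^w`, and one more sign comes from `ε T ε = T⁻¹`, which exchanges
the two terms of `T - T⁻¹`. -/
theorem modPairing_indEps [Γ.FiniteIndex] (w : ℕ) (P Q : Cosets Γ → ℂ[X]) :
    modPairing w (indEps hΓ P) (indEps hΓ Q) = (-1) ^ (w + 1) * modPairing w P Q := by
  rw [modPairing, modPairing, indSlash_indEps, indSlash_indEps, map_inv, epsConj_T, inv_inv,
    indPairing_sub_left, indPairing_sub_left, indPairing_indEps, indPairing_indEps]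
  ring

theorem parityPart_eq (κ : ℤˣ) (P : Cosets Γ → ℂ[X]) :
    parityPart hΓ κ P = fun A => C (1 / 2 : ℂ) *
      (P + fun A => C (((κ : ℤ) : ℂ)) * indEps hΓ P A) A := rfl

theorem modPairing_parityPart_left [Γ.FiniteIndex] (κ : ℤˣ) (P Q : Cosets Γ → ℂ[X]) :
    modPairing w (parityPart hΓ κ P) Q =
      1 / 2 * (modPairing w P Q + ((κ : ℤ) : ℂ) * modPairing w (indEps hΓ P) Q) := by
  have hC : ∀ (r : ℂ) (P : Cosets Γ → ℂ[X]) (g : SL(2, ℤ)),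
      indSlash w (fun A => C r * P A) g = fun A => C r * indSlash w P g A := fun r P g =>
    funext fun _ => polySlash_C_mul _ _ _ _
  simp only [modPairing, parityPart_eq, hC, indSlash_add, indPairing_sub_left,
    indPairing_C_mul_left, indPairing_add_left]
  ring

theorem modPairing_parityPart_right [Γ.FiniteIndex] (κ : ℤˣ) (P Q : Cosets Γ → ℂ[X]) :
    modPairing w P (parityPart hΓ κ Q) =
      1 / 2 * (modPairing w P Q + ((κ : ℤ) : ℂ) * modPairing w P (indEps hΓ Q)) := by
  simp only [modPairing, parityPart_eq, indPairing_C_mul_right, indPairing_add_right]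

theorem conjCoeff_parityPart (κ : ℤˣ) (P : Cosets Γ → ℂ[X]) :
    conjCoeff (parityPart hΓ κ P) = parityPart hΓ κ (conjCoeff P) := by
  funext A
  simp only [conjCoeff, parityPart, indEps, Polynomial.map_mul, Polynomial.map_add, map_C,
    Polynomial.map_comp, Polynomial.map_neg, map_X, map_div₀, map_one, map_ofNat, map_intCast,
    Polynomial.map_intCast]

theorem parityPart_sub (κ : ℤˣ) (P Q : Cosets Γ → ℂ[X]) :
    parityPart hΓ κ (P - Q) = parityPart hΓ κ P - parityPart hΓ κ Q := by
  funext A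
  simp only [parityPart, indEps, Pi.sub_apply, sub_comp]
  ring

theorem modPairing_zero_left [Γ.FiniteIndex] (w : ℕ) (Q : Cosets Γ → ℂ[X]) :
    modPairing w 0 Q = 0 := by
  simp [modPairing, indSlash, polySlash, indPairing, polyPairing]

end parity

section periods

variable {Γ : Subgroup SL(2, ℤ)} (hΓ : NormalizedByEps Γ) {w : ℕ} {f g : Cosets Γ → ℍ → ℂ}

/-- The reflection `z ↦ -conj z` fixes the imaginary axis pointwise. Conjugation therefore only
affects values, powers of `iy` and `dt = i dy`; the sign of `dt` accounts for the extra factor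
beyond `(-1)^w`. -/
theorem periodFam_epsFamily (w : ℕ) (g : Cosets Γ → ℍ → ℂ) :
    periodFam w (epsFamily hΓ (w + 2) g) =
      fun A => C ((-1) ^ (w + 1)) * indEps hΓ (conjCoeff (periodFam w g)) A := by
  funext A
  ext n
  rw [coeff_C_mul, indEps, coeff_comp_neg_X, conjCoeff, coeff_map]
  by_cases hn : n ≤ w
  · rw [periodFam, periodFam, coeff_periodIntegral _ hn, coeff_periodIntegral _ hn, map_mul,
      ← integral_conj, Complex.conj_I]
    have : ∫ y in Ioi (0 : ℝ), epsFamily hΓ (w + 2) g A (ofComplex (Complex.I * y)) *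
        ((C (Complex.I * y) - X : ℂ[X]) ^ w).coeff n =
        (-1) ^ (w - n) * ∫ y in Ioi (0 : ℝ), conj (g (cosetEps hΓ A) (ofComplex (Complex.I * y)) *
        ((C (Complex.I * y) - X : ℂ[X]) ^ w).coeff n) := by
      rw [← integral_const_mul]
      refine setIntegral_congr_fun measurableSet_Ioi fun y hy => ?_
      rw [coeff_C_sub_X_pow _ _ _ hn]
      simp only [epsFamily, slash_J_apply, ofComplex_neg_conj (im_I_mul hy), map_mul,
        map_pow, map_neg, map_one, Complex.conj_I, Complex.conj_ofReal,
        map_natCast, neg_mul, neg_neg]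
      rw [neg_pow (Complex.I * (y : ℂ)) (w - n)]
      have h1 : (-1 : ℂ) ^ (w - n) * (-1) ^ (w - n) = 1 := by rw [← mul_pow]; simp
      linear_combination (-(conj (g (cosetEps hΓ A) (ofComplex (Complex.I * y))) *
        ((-1) ^ n * (w.choose n : ℂ) * (Complex.I * y) ^ (w - n)))) * h1
    rw [this]
    have h2 : (-1 : ℂ) ^ w = (-1) ^ n * (-1) ^ (w - n) := by
      rw [← pow_add, Nat.add_sub_cancel' hn]
    have h3 : (-1 : ℂ) ^ n * (-1) ^ n = 1 := by rw [← mul_pow]; simp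
    rw [pow_succ, h2]
    set K := ∫ y in Ioi (0 : ℝ), conj (g (cosetEps hΓ A) (ofComplex (Complex.I * y)) *
        ((C (Complex.I * y) - X : ℂ[X]) ^ w).coeff n)
    linear_combination (-((-1) ^ (w - n) * K * Complex.I)) * h3
  · rw [coeff_eq_zero_of_natDegree_lt
      ((natDegree_periodFam_le w _ A).trans_lt (not_le.mp hn)), coeff_eq_zero_of_natDegree_lt
      ((natDegree_periodFam_le w _ _).trans_lt (not_le.mp hn))]
    simp

/-- The pairing of two holomorphic period families vanishes. Here it is applied with the reflected
family of `g`, itself a cusp family. -/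
theorem modPairing_conj_indEps_eq_zero [Γ.FiniteIndex] (hf : IsCuspFamily (w + 2) f)
    (hg : IsCuspFamily (w + 2) g) :
    modPairing w (periodFam w f) (indEps hΓ (conjCoeff (periodFam w g))) = 0 := by
  have h := modPairing_periodFam (AlgHom.id ℝ ℂ) hf (hg.eps hΓ)
  rw [integral_arc_id hf (hg.eps hΓ), mul_zero, mul_eq_zero, or_iff_right index_ne_zero,
    periodFam_epsFamily] at h
  have hid : ∀ P : Cosets Γ → ℂ[X], mapCoeff ((AlgHom.id ℝ ℂ : ℂ →ₐ[ℝ] ℂ) : ℂ →+* ℂ) P = P :=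
    fun P => funext fun A => Polynomial.map_id
  rw [hid, modPairing, indPairing_C_mul_right] at h
  exact (mul_eq_zero.mp h).resolve_left (by simp)

/-- Haberland's formula for families of functions. -/
theorem modPairing_parityPart [Γ.FiniteIndex] (hf : IsCuspFamily (w + 2) f)
    (hg : IsCuspFamily (w + 2) g) {κ₁ κ₂ : ℤˣ} (hκ : κ₁ * κ₂ = (-1) ^ (w + 1)) :
    modPairing w (parityPart hΓ κ₁ (periodFam w f))
      (conjCoeff (parityPart hΓ κ₂ (periodFam w g))) =
      3 * haberlandConst (w + 2) * (((Γ.index : ℕ) : ℂ)⁻¹ *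
        ∑ᶠ A, ∫ z in 𝒟ᵒ, petIntegrand (w + 2) (f A) (g A) z) := by
  have hκ' : ((κ₁ : ℤ) : ℂ) * ((κ₂ : ℤ) : ℂ) = (-1) ^ (w + 1) := by
    have := congrArg (fun u : ℤˣ => ((u : ℤ) : ℂ)) hκ
    push_cast at this
    exact this
  have hmain := modPairing_periodFam conjAlg hf hg
  rw [integral_arc_conj hf hg] at hmain
  change _ * modPairing w (periodFam w f) (conjCoeff (periodFam w g)) = _ at hmain
  have h0 := modPairing_conj_indEps_eq_zero hΓ hf hg
  have h1 : modPairing w (indEps hΓ (periodFam w f)) (conjCoeff (periodFam w g)) = 0 := by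
    rw [← indEps_indEps hΓ (conjCoeff (periodFam w g)), modPairing_indEps, h0, mul_zero]
  have hsq : ((-1 : ℂ) ^ (w + 1)) * (-1) ^ (w + 1) = 1 := by rw [← mul_pow]; simp
  -- Of the four terms the mixed ones are zero; the others add to `(1 + κ₁κ₂(-1)^(w+1)) / 4 = 1/2`
  -- times the full pairing, which turns the factor `6` into `3`.
  rw [conjCoeff_parityPart, modPairing_parityPart_left, modPairing_parityPart_right,
    modPairing_parityPart_right, h0, h1, modPairing_indEps]
  have hi : ((Γ.index : ℕ) : ℂ) ≠ 0 := index_ne_zero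
  field_simp
  set M := modPairing w (periodFam w f) (conjCoeff (periodFam w g))
  linear_combination M * Γ.index * (-1) ^ (w + 1) * hκ' + M * Γ.index * hsq + 2 * hmain

end periods

/-! ### Positivity of the Petersson product and injectivity. -/

section positivity

instance : Measure.IsOpenPosMeasure (volume : Measure ℍ) where
  open_pos U hU hne h := by
    have hU' : IsOpen ((↑) '' U : Set ℂ) := isOpenEmbedding_coe.isOpenMap U hU
    refine hU'.measure_ne_zero volume (hne.image _) ?_
    rw [volume_eq_lintegral, lintegral_eq_zero_iff (by fun_prop)] at h
    rw [← Measure.restrict_eq_zero, ← ae_eq_bot, ← Filter.eventually_false_iff_eq_bot]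
    filter_upwards [h, ae_restrict_mem hU'.measurableSet] with z hz hzU
    obtain ⟨τ, -, rfl⟩ := hzU
    simp [τ.im_ne_zero] at hz

theorem haberlandConst_ne_zero (k : ℕ) : haberlandConst k ≠ 0 := by
  simp [haberlandConst]

variable {Γ : Subgroup SL(2, ℤ)} {w : ℕ}

theorem petIntegrand_self (k : ℕ) (f : ℍ → ℂ) (z : ℍ) :
    petIntegrand k f f z = ((‖f z‖ ^ 2 * z.im ^ k : ℝ) : ℂ) := by
  rw [petIntegrand, Complex.mul_conj, Complex.normSq_eq_norm_sq]
  push_cast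
  rfl

/-- The Petersson square of a family of cusp forms vanishes only for the zero family. -/
theorem IsCuspFamily.ae_eq_zero [Γ.FiniteIndex] {f : Cosets Γ → ℍ → ℂ}
    (hf : IsCuspFamily (w + 2) f)
    (h : ∑ᶠ A, ∫ z in 𝒟ᵒ, petIntegrand (w + 2) (f A) (f A) z = 0) (A : Cosets Γ) :
    ∀ᵐ z ∂volume.restrict 𝒟ᵒ, f A z = 0 := by
  cases nonempty_fintype (Cosets Γ)
  simp only [petIntegrand_self, finsum_eq_sum_of_fintype] at h
  simp only [integral_complex_ofReal] at h
  rw [← Complex.ofReal_sum, Complex.ofReal_eq_zero] at h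
  have hnn : ∀ (A : Cosets Γ) (z : ℍ), 0 ≤ ‖f A z‖ ^ 2 * z.im ^ (w + 2) := fun A z => by
    have := z.im_pos
    positivity
  have hA := (Finset.sum_eq_zero_iff_of_nonneg fun A _ => integral_nonneg (hnn A)).mp h A
    (Finset.mem_univ A)
  have hint : IntegrableOn (fun z : ℍ => ‖f A z‖ ^ 2 * z.im ^ (w + 2)) 𝒟ᵒ := by
    have := (integrableOn_petIntegrand (w := w) (hf.holDecay A) (hf.holDecay A)).re
    simpa only [petIntegrand_self, RCLike.re_eq_complex_re, Complex.ofReal_re, IntegrableOn] using this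
  rw [integral_eq_zero_iff_of_nonneg (hnn A) hint] at hA
  filter_upwards [hA] with z hz
  simpa [z.im_ne_zero] using hz

end positivity

section injectivity

variable {Γ : Subgroup SL(2, ℤ)} {w : ℕ}

/-- Every `f_A` vanishes almost everywhere on the standard domain, hence `f` does so on each
translate, and these cover almost all of `ℍ`. Continuity finishes. -/
theorem eq_zero_of_sum_integral_eq_zero [Γ.FiniteIndex]
    (f : CuspForm (Γ : Subgroup (GL (Fin 2) ℝ)) ((w + 2 : ℕ) : ℤ))
    (h : ∑ᶠ A, ∫ z in 𝒟ᵒ, petIntegrand (w + 2) (formFamily f A) (formFamily f A) z = 0) :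
    f = 0 := by
  have h1 : ∀ᵐ z : ℍ, ∀ γ : SL(2, ℤ), γ • z ∈ 𝒟ᵒ → f z = 0 := by
    rw [ae_all_iff]
    intro γ
    have := (isCuspFamily_formFamily f).ae_eq_zero h (Quotient.mk'' γ⁻¹)
    rw [ae_restrict_iff' measurableSet_fdo] at this
    filter_upwards [(measurePreserving_smul γ (volume : Measure ℍ)).quasiMeasurePreserving.ae this]
      with z hz hmem
    have h2 := hz hmem
    have h3 := slash_apply_eval f (w + 2) γ⁻¹ (γ • z)
    rw [formFamily_mk] at h2
    rw [h2, zero_mul, inv_smul_smul] at h3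
    exact h3.symm
  have h2 : (f : ℍ → ℂ) =ᵐ[volume] 0 := by
    filter_upwards [h1, ae_exists_smul_mem_fdo] with z hz ⟨γ, hγ⟩
    exact hz γ hγ
  have hcont : Continuous (f : ℍ → ℂ) := (ModularFormClass.holo f).continuous
  exact DFunLike.coe_injective ((hcont.ae_eq_iff_eq volume continuous_zero).mp h2)

theorem formFamily_sub {k : ℕ} (f g : CuspForm (Γ : Subgroup (GL (Fin 2) ℝ)) (k : ℤ)) :
    formFamily (f - g) = formFamily f - formFamily g := by
  funext A
  induction A using Quotient.inductionOn' with | h a => ?_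
  simp [sub_eq_add_neg, SlashAction.add_slash, SlashAction.neg_slash]

theorem periodFam_sub {f g : Cosets Γ → ℍ → ℂ} (hf : IsCuspFamily (w + 2) f)
    (hg : IsCuspFamily (w + 2) g) :
    periodFam w (f - g) = periodFam w f - periodFam w g := by
  funext A
  ext n
  rw [Pi.sub_apply, coeff_sub]
  by_cases hn : n ≤ w
  · simp only [periodFam, coeff_periodIntegral _ hn, Pi.sub_apply, sub_mul]
    rw [← sub_mul, integral_sub]
    · exact integrableOn_period (hf.holDecay A) (by rw [← hf.slash]; exact hf.holDecay _) hn
    · exact integrableOn_period (hg.holDecay A) (by rw [← hg.slash]; exact hg.holDecay _) hn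
  · simp only [coeff_eq_zero_of_natDegree_lt
      ((natDegree_periodFam_le w _ A).trans_lt (not_le.mp hn)), sub_zero]

theorem rho_eq_periodFam (f : CuspForm (Γ : Subgroup (GL (Fin 2) ℝ)) ((w + 2 : ℕ) : ℤ)) :
    rho f = periodFam w (formFamily f) := funext (rho_apply f)

theorem injective_parityPart_rho [Γ.FiniteIndex] (hΓ : NormalizedByEps Γ) (κ : ℤˣ) :
    Function.Injective fun f : CuspForm (Γ : Subgroup (GL (Fin 2) ℝ)) ((w + 2 : ℕ) : ℤ) =>
      parityPart hΓ κ (rho f) := by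
  intro f g hfg
  simp only [rho_eq_periodFam] at hfg
  rw [← sub_eq_zero, ← parityPart_sub, ← periodFam_sub (isCuspFamily_formFamily f)
    (isCuspFamily_formFamily g), ← formFamily_sub] at hfg
  have h := isCuspFamily_formFamily (f - g)
  -- For a given sign `κ` the second sign is chosen to satisfy the parity condition, so that either
  -- parity part alone detects the Petersson norm of `f - g`.
  have key := modPairing_parityPart hΓ h h (κ₁ := κ) (κ₂ := κ⁻¹ * (-1) ^ (w + 1)) 
    (mul_inv_cancel_left _ _)
  rw [hfg, modPairing_zero_left] at key
  refine sub_eq_zero.mp (eq_zero_of_sum_integral_eq_zero (f - g) ?_)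
  have h1 := (mul_eq_zero.mp key.symm).resolve_left
    (mul_ne_zero three_ne_zero (haberlandConst_ne_zero _))
  exact (mul_eq_zero.mp h1).resolve_left (inv_ne_zero index_ne_zero)

theorem mul_eq_neg_one_pow {k : ℕ} {κ₁ κ₂ : ℤˣ} (he : Even k → κ₁ ≠ κ₂) (ho : Odd k → κ₁ = κ₂) :
    κ₁ * κ₂ = (-1) ^ (k + 1) := by
  rcases Nat.even_or_odd k with h | h
  · rw [pow_succ, h.neg_one_pow, one_mul, Int.units_ne_iff_eq_neg.mp (he h), neg_mul,
      Int.units_mul_self]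
  · rw [pow_succ, h.neg_one_pow, ho h, Int.units_mul_self]
    rfl

end injectivity

end Haberland

theorem theorem3p2 (Γ : Subgroup SL(2, ℤ)) [Γ.FiniteIndex] (hΓ : Haberland.NormalizedByEps Γ)
    (k : ℕ) (hk : 2 ≤ k) :
    (∀ F : Set ℍ, Haberland.IsFundDomain Γ F →
      ∀ f g : CuspForm (Γ : Subgroup (GL (Fin 2) ℝ)) (k : ℤ),
      ∀ κ₁ κ₂ : ℤˣ, (Even k → κ₁ ≠ κ₂) → (Odd k → κ₁ = κ₂) →
        3 * Haberland.haberlandConst k * Haberland.petersson Γ k F f g =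
          Haberland.modPairing (k - 2)
            (Haberland.parityPart hΓ κ₁ (Haberland.rho f))
            (Haberland.conjCoeff (Haberland.parityPart hΓ κ₂ (Haberland.rho g)))) ∧
    ∀ κ : ℤˣ, Function.Injective
      (fun f : CuspForm (Γ : Subgroup (GL (Fin 2) ℝ)) (k : ℤ) =>
        Haberland.parityPart hΓ κ (Haberland.rho f)) := by
  obtain ⟨w, rfl⟩ : ∃ w, k = w + 2 := ⟨k - 2, by omega⟩
  refine ⟨fun F hF f g κ₁ κ₂ he ho => ?_, fun κ => Haberland.injective_parityPart_rho hΓ κ⟩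
  have hκ : κ₁ * κ₂ = (-1) ^ (w + 1) := by
    rw [Haberland.mul_eq_neg_one_pow he ho, show w + 2 + 1 = w + 1 + 2 by ring, pow_add]
    simp
  rw [Haberland.petersson_eq_average f g hk hF, Haberland.rho_eq_periodFam,
    Haberland.rho_eq_periodFam]
  exact (Haberland.modPairing_parityPart hΓ (Haberland.isCuspFamily_formFamily f)
    (Haberland.isCuspFamily_formFamily g) hκ).symm
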